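/- Let $\mathfrak h$ be a finite-dimensional complex vector space and $W\subset GL(\mathfrak h)$ a finite subgroup. Let $S\subset W$ be the set of reflections, i.e. of elements $s$ with $\mathrm{rk}(s-1)=1$, and let $\mathbb C[S]^W$ be the set of $W$-invariant (under conjugation) functions $c:S\to\mathbb C$. For $s\in S$ let $\alpha_s\in\mathfrak h^*$ and $\alpha_s^\vee\in\mathfrak h$ be generators of $\mathrm{Im}(s|_{\mathfrak h^*}-1)$ and $\mathrm{Im}(s|_{\mathfrak h}-1)$ with $(\alpha_s,\alpha_s^\vee)=2$. For $c\in\mathbb C[S]^W$ the rational Cherednik algebra $H_c=H_c(W,\mathfrak h)$ is the quotient of $\mathbb CW\ltimes T(\mathfrak h\oplus\mathfrak h^*)$ by the relations $$[x,x']=0,\quad [y,y']=0,\quad [y,x]=(y,x)-\sum_{s\in S}c_s\,(y,\alpha_s)(x,\alpha_s^\vee)\,s\qquad(x,x'\in\mathfrak h^*,\ y,y'\in\mathfrak h).$$ Let $\mathcal O_c(W,\mathfrak h)_0$ be the category of $H_c$-modules that are finitely generated over $\mathbb C[\mathfrak h]=S\mathfrak h^*$ and on which $\mathfrak h$ acts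 locally nilpotently, and let $e_W=\frac1{|W|}\sum_{w\in W}w$. An $H_c$-module $M\neq0$ is called aspherical if $e_WM=0$. Let $\Sigma(W,\mathfrak h)$ be the set of $c\in\mathbb C[S]^W$ for which $\mathcal O_c(W,\mathfrak h)_0$ contains an aspherical module (such $c$ are called aspherical), and let $FDA(W,\mathfrak h)$ be the set of $c$ for which $H_c$ has a finite-dimensional aspherical module. A parabolic subgroup of $W$ is the stabilizer of a point of $\mathfrak h$. For a parabolic subgroup $W'$ let $\Sigma'(W',\mathfrak h/\mathfrak h^{W'})\subset\mathbb C[S]^W$ be the preimage of $\Sigma(W',\mathfrak h/\mathfrak h^{W'})$ under the restriction of functions $c\mapsto c'=c|_{S\cap W'}$ (here $S\cap W'$ is also the set of reflections of $W'$ acting on $\mathfrak h/\mathfrak h^{W'}$). Then: (i) $c\in\Sigma(W,\mathfrak h)$ if and only if $H_ce_WH_c\neq H_c$. (ii) $$\Sigma(W,\mathfrak h)=FDA(W,\mathfrak h)\cup\bigcup_{W'}\Sigma'(W',\mathfrak h/\mathfrak h^{W'}),$$ where $W'$ runs over all parabolic subgroups of $W$. Moreover, if $\mathfrak h^W=0$,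 the same equality holds with $W'$ running over the proper parabolic subgroups $W'\neq W$ only. -/

import Mathlib

/-!
Rational Cherednik algebras `H_c(W, 𝔥)` of a finite group `W` acting linearly on a complex vector
space `𝔥 = V` through `ρ : Representation ℂ W V`.
-/

universe u v

noncomputable section

namespace Cherednik

variable {W : Type u} [Group W] {V : Type v} [AddCommGroup V] [Module ℂ V]

/-- The set `S` of reflections: the elements `s` with `rk (s - 1) = 1` on `𝔥`. -/
def reflections (ρ : Representation ℂ W V) : Set W :=
  {s | Module.finrank ℂ (LinearMap.range (ρ s - 1)) = 1}

/-- A vector of `Im (s - 1)` that is fixed by `s` vanishes. -/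
theorem eq_zero_of_fixed [Finite W] (ρ : Representation ℂ W V) (s : W) {u v : V}
    (h : ρ s v - v = u) (hu : ρ s u = u) : u = 0 := by
  have key : ∀ k : ℕ, ρ (s ^ k) v = v + (k : ℂ) • u := by
    intro k
    induction k with
    | zero => simp
    | succ k ih =>
      rw [pow_succ', map_mul, Module.End.mul_apply, ih, map_add, map_smul, hu,
        sub_eq_iff_eq_add.mp h]
      push_cast
      module
  have h1 := key (orderOf s)
  rw [pow_orderOf_eq_one, map_one, Module.End.one_apply, left_eq_add, smul_eq_zero] at h1
  rcases h1 with h1 | h1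
  · exact absurd (Nat.cast_eq_zero.mp h1) (isOfFinOrder_of_finite s).orderOf_pos.ne'
  · exact h1

/-- For a reflection `s` there are generators `α_s` of `Im (s|_{𝔥*} - 1)` and `α_s^∨` of
`Im (s|_𝔥 - 1)` with `(α_s, α_s^∨) = 2`. -/
theorem exists_root [Finite W] (ρ : Representation ℂ W V) (s : reflections ρ) :
    ∃ p : Module.Dual ℂ V × V,
      Submodule.span ℂ {p.1} = LinearMap.range (ρ.dual s.1 - 1) ∧
      Submodule.span ℂ {p.2} = LinearMap.range (ρ s.1 - 1) ∧ p.1 p.2 = 2 := by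
  obtain ⟨s, hs⟩ := s
  obtain ⟨⟨u, hur⟩, hu0, hu⟩ := finrank_eq_one_iff'.mp hs
  have hu0' : u ≠ 0 := fun h => hu0 (Subtype.ext h)
  have hspan : Submodule.span ℂ {u} = LinearMap.range (ρ s - 1) := by
    apply le_antisymm
    · rwa [Submodule.span_singleton_le_iff_mem]
    · intro w hw
      obtain ⟨c, hc⟩ := hu ⟨w, hw⟩
      exact Submodule.mem_span_singleton.mpr ⟨c, congrArg Subtype.val hc⟩
  obtain ⟨ψ, hψ⟩ := Module.Projective.exists_dual_ne_zero ℂ hu0'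
  -- `φ` is the functional with `(s - 1) v = φ v • u`
  set φ : Module.Dual ℂ V := (ψ u)⁻¹ • (ψ ∘ₗ (ρ s - 1)) with hφ
  have hs1 : ∀ v, ρ s v - v = φ v • u := by
    intro v
    have : ρ s v - v ∈ Submodule.span ℂ {u} := hspan ▸ ⟨v, rfl⟩
    obtain ⟨a, ha⟩ := Submodule.mem_span_singleton.mp this
    have : φ v = a := by
      simp only [hφ, LinearMap.smul_apply, LinearMap.comp_apply, LinearMap.sub_apply,
        Module.End.one_apply, ← ha, map_smul, smul_eq_mul]
      field_simp
    rw [this, ha]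
  obtain ⟨v, hv⟩ := hur
  have hφu : φ u ≠ 0 := by
    intro h
    refine hu0' (eq_zero_of_fixed ρ s (v := v) hv ?_)
    have := hs1 u
    rwa [h, zero_smul, sub_eq_zero] at this
  have hinv : ∀ w, ρ s (ρ s⁻¹ w) = w := fun w => by
    rw [← Module.End.mul_apply, ← map_mul, mul_inv_cancel, map_one, Module.End.one_apply]
  have hinv' : ∀ w, ρ s⁻¹ (ρ s w) = w := fun w => by
    rw [← Module.End.mul_apply, ← map_mul, inv_mul_cancel, map_one, Module.End.one_apply]
  have hdual : ∀ x : Module.Dual ℂ V, (ρ.dual s - 1) x = (-(x (ρ s⁻¹ u))) • φ := by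
    intro x
    ext w
    have h := congrArg (fun z => x (ρ s⁻¹ z)) (hs1 w)
    simp only [map_sub, hinv', map_smul, smul_eq_mul] at h
    simp only [LinearMap.sub_apply, Module.End.one_apply, Representation.dual_apply,
      LinearMap.smul_apply, smul_eq_mul, Module.Dual.transpose_apply, LinearMap.comp_apply]
    linear_combination -h
  have hu1 : ρ s⁻¹ u ≠ 0 := fun h => hu0' (by rw [← hinv u, h, map_zero])
  refine ⟨((2 * (φ u)⁻¹) • φ, u), ?_, hspan, ?_⟩
  · apply le_antisymm
    · rw [Submodule.span_singleton_le_iff_mem]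
      obtain ⟨x, hx⟩ := Module.Projective.exists_dual_ne_zero ℂ hu1
      refine Submodule.smul_mem _ _ ?_
      refine ⟨(-(x (ρ s⁻¹ u)))⁻¹ • x, ?_⟩
      rw [map_smul, hdual, smul_smul, inv_mul_cancel₀ (neg_ne_zero.mpr hx), one_smul]
    · rintro _ ⟨x, rfl⟩
      rw [hdual]
      refine Submodule.mem_span_singleton.mpr ⟨-(x (ρ s⁻¹ u)) * (2 * (φ u)⁻¹)⁻¹, ?_⟩
      rw [smul_smul, inv_mul_cancel_right₀ (mul_ne_zero two_ne_zero (inv_ne_zero hφu))]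
  · simp [hφu]

/-- `α_s ∈ 𝔥*`. Only `α_s ⊗ α_s^∨` is used below; it does not depend on the choice. -/
def root [Finite W] (ρ : Representation ℂ W V) (s : reflections ρ) : Module.Dual ℂ V :=
  (exists_root ρ s).choose.1

/-- `α_s^∨ ∈ 𝔥`. -/
def coroot [Finite W] (ρ : Representation ℂ W V) (s : reflections ρ) : V :=
  (exists_root ρ s).choose.2

/-- Parameters: the `W`-invariant functions `c : S → ℂ`, that is, the set `ℂ[S]^W`. -/
def Parameter (ρ : Representation ℂ W V) : Type u :=
  {c : reflections ρ → ℂ //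
    ∀ (g : W) (s t : reflections ρ), (t : W) = g * s * g⁻¹ → c t = c s}

/-- Generators of the rational Cherednik algebra: `w ∈ W`, `x ∈ 𝔥*` and `y ∈ 𝔥`. -/
inductive Gen (W : Type u) (V : Type v) [AddCommGroup V] [Module ℂ V] : Type (max u v)
  | w (g : W)
  | x (a : Module.Dual ℂ V)
  | y (b : V)

open FreeAlgebra in
/-- Defining relations. All but the last three present `ℂW ⋉ T(𝔥 ⊕ 𝔥*)`; the last three are
`[x, x'] = 0`, `[y, y'] = 0` and `[y, x] = (y, x) - ∑ c_s (y, α_s) (x, α_s^∨) s`. -/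
inductive Rel [Finite W] (ρ : Representation ℂ W V) (c : Parameter ρ) :
    FreeAlgebra ℂ (Gen W V) → FreeAlgebra ℂ (Gen W V) → Prop
  | w_one : Rel ρ c (ι ℂ (.w 1)) 1
  | w_mul (g h : W) : Rel ρ c (ι ℂ (.w (g * h))) (ι ℂ (.w g) * ι ℂ (.w h))
  | x_add (a a' : Module.Dual ℂ V) :
      Rel ρ c (ι ℂ (.x (a + a'))) (ι ℂ (.x a) + ι ℂ (.x a'))
  | x_smul (r : ℂ) (a : Module.Dual ℂ V) : Rel ρ c (ι ℂ (.x (r • a))) (r • ι ℂ (.x a))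
  | y_add (b b' : V) : Rel ρ c (ι ℂ (.y (b + b'))) (ι ℂ (.y b) + ι ℂ (.y b'))
  | y_smul (r : ℂ) (b : V) : Rel ρ c (ι ℂ (.y (r • b))) (r • ι ℂ (.y b))
  | w_x (g : W) (a : Module.Dual ℂ V) :
      Rel ρ c (ι ℂ (.w g) * ι ℂ (.x a)) (ι ℂ (.x (ρ.dual g a)) * ι ℂ (.w g))
  | w_y (g : W) (b : V) :
      Rel ρ c (ι ℂ (.w g) * ι ℂ (.y b)) (ι ℂ (.y (ρ g b)) * ι ℂ (.w g))
  | x_comm (a a' : Module.Dual ℂ V) :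
      Rel ρ c (ι ℂ (.x a) * ι ℂ (.x a')) (ι ℂ (.x a') * ι ℂ (.x a))
  | y_comm (b b' : V) : Rel ρ c (ι ℂ (.y b) * ι ℂ (.y b')) (ι ℂ (.y b') * ι ℂ (.y b))
  | y_x (b : V) (a : Module.Dual ℂ V) :
      Rel ρ c (ι ℂ (.y b) * ι ℂ (.x a) - ι ℂ (.x a) * ι ℂ (.y b))
        (algebraMap ℂ _ (a b) -
          ∑ᶠ s : reflections ρ, (c.1 s * root ρ s b * a (coroot ρ s)) • ι ℂ (.w (s : W)))

/-- The rational Cherednik algebra `H_c(W, 𝔥)`. -/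
abbrev H [Finite W] (ρ : Representation ℂ W V) (c : Parameter ρ) : Type (max u v) :=
  RingQuot (Rel ρ c)

section

variable [Finite W] (ρ : Representation ℂ W V) (c : Parameter ρ)

/-- The image of a generator in `H_c(W, 𝔥)`. -/
def gen (z : Gen W V) : H ρ c := RingQuot.mkAlgHom ℂ (Rel ρ c) (FreeAlgebra.ι ℂ z)

/-- The idempotent `e_W = |W|⁻¹ ∑ w`. -/
def idem : H ρ c := (Nat.card W : ℂ)⁻¹ • ∑ᶠ g : W, gen ρ c (.w g)

/-- The subalgebra `ℂ[𝔥] = S𝔥*` of `H_c(W, 𝔥)`, generated by `𝔥*`. -/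
def polySubalgebra : Subalgebra ℂ (H ρ c) :=
  Algebra.adjoin ℂ (Set.range fun a : Module.Dual ℂ V => gen ρ c (.x a))

/-- The two-sided ideal `H_c e_W H_c`: the span of the products `a * e_W * b`. -/
def sphericalIdeal : Submodule ℂ (H ρ c) := ⊤ * Submodule.span ℂ {idem ρ c} * ⊤

/-- Membership in the category `𝒪_c(W, 𝔥)_0`: finitely generated over `ℂ[𝔥]` and locally
nilpotent under the action of `𝔥`. -/
def InCatO (M : Type*) [AddCommGroup M] [Module (H ρ c) M] : Prop :=
  Module.Finite (polySubalgebra ρ c) M ∧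
    ∀ (b : V) (m : M), ∃ N : ℕ, gen ρ c (.y b) ^ N • m = 0

/-- A nonzero module `M` is aspherical if `e_W M = 0`. -/
def IsAspherical (M : Type*) [AddCommGroup M] [Module (H ρ c) M] : Prop :=
  Nontrivial M ∧ ∀ m : M, idem ρ c • m = 0

end

/-- `Σ(W, 𝔥)`: the parameters `c` for which `𝒪_c(W, 𝔥)_0` contains an aspherical module. -/
def asphericalSet [Finite W] (ρ : Representation ℂ W V) : Set (Parameter ρ) :=
  {c | ∃ (M : Type (max u v)) (_ : AddCommGroup M) (_ : Module (H ρ c) M),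
    InCatO ρ c M ∧ IsAspherical ρ c M}

/-- `FDA(W, 𝔥)`: the parameters `c` for which `H_c(W, 𝔥)` has a finite dimensional aspherical
representation. -/
def fdaSet [Finite W] (ρ : Representation ℂ W V) : Set (Parameter ρ) :=
  {c | ∃ (M : Type (max u v)) (_ : AddCommGroup M) (_ : Module ℂ M) (_ : Module (H ρ c) M)
    (_ : IsScalarTower ℂ (H ρ c) M), FiniteDimensional ℂ M ∧ IsAspherical ρ c M}

/-- A parabolic subgroup is the stabilizer of a point of `𝔥`. -/
def IsParabolic (ρ : Representation ℂ W V) (P : Subgroup W) : Prop :=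
  ∃ b : V, ∀ g : W, g ∈ P ↔ ρ g b = b

/-- The subspace `𝔥^{W'}` of vectors fixed by a subgroup `W'`. -/
def fixedSpace (ρ : Representation ℂ W V) (P : Subgroup W) : Submodule ℂ V :=
  Representation.invariants (ρ.comp P.subtype : Representation ℂ P V)

theorem fixedSpace_le_comap (ρ : Representation ℂ W V) (P : Subgroup W) (g : P) :
    fixedSpace ρ P ≤ (fixedSpace ρ P).comap ((ρ.comp P.subtype) g) := by
  intro v hv
  have h : (ρ.comp P.subtype) g v = v := hv g
  rw [Submodule.mem_comap, h]
  exact hv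

/-- The action of a subgroup `W'` of `W` on `𝔥 / 𝔥^{W'}`. -/
def quotRep (ρ : Representation ℂ W V) (P : Subgroup W) :
    Representation ℂ P (V ⧸ fixedSpace ρ P) :=
  Representation.quotient (ρ.comp P.subtype) (fixedSpace ρ P) (fixedSpace_le_comap ρ P)

/-- An element of `W'` that is a reflection on `𝔥 / 𝔥^{W'}` is a reflection on `𝔥`, and
conversely. -/
theorem mem_reflections_quotRep [Finite W] (ρ : Representation ℂ W V) (P : Subgroup W) (s : P) :
    s ∈ reflections (quotRep ρ P) ↔ (s : W) ∈ reflections ρ := by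
  set F := fixedSpace ρ P
  have hr : LinearMap.range (quotRep ρ P s - 1) =
      LinearMap.range (F.mkQ.domRestrict (LinearMap.range (ρ (s : W) - 1))) := by
    have hmk : ∀ v : V, (quotRep ρ P s - 1) (F.mkQ v) = F.mkQ ((ρ (s : W) - 1) v) :=
      fun v => rfl
    apply le_antisymm
    · rintro _ ⟨q, rfl⟩
      obtain ⟨v, rfl⟩ := F.mkQ_surjective q
      exact ⟨⟨_, ⟨v, rfl⟩⟩, (hmk v).symm⟩
    · rintro _ ⟨⟨_, ⟨v, rfl⟩⟩, rfl⟩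
      exact ⟨F.mkQ v, hmk v⟩
  have hinj : Function.Injective (F.mkQ.domRestrict (LinearMap.range (ρ (s : W) - 1))) := by
    rw [← LinearMap.ker_eq_bot, LinearMap.ker_eq_bot']
    rintro ⟨u, ⟨v, hv⟩⟩ h
    have hu : u ∈ F := by simpa using h
    exact Subtype.ext (eq_zero_of_fixed ρ (s : W) (v := v) hv (hu s))
  simp only [reflections, Set.mem_ofPred_eq]
  rw [hr, LinearMap.finrank_range_of_inj hinj]

/-- The restriction map `c ↦ c'` to the reflections of a subgroup `W'`, acting on
`𝔥 / 𝔥^{W'}`. -/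
def Parameter.restrict [Finite W] {ρ : Representation ℂ W V} (P : Subgroup W) (c : Parameter ρ) :
    Parameter (quotRep ρ P) :=
  ⟨fun s => c.1 ⟨((s : P) : W), (mem_reflections_quotRep ρ P s).mp s.2⟩,
    fun g s t h => c.2 g ⟨_, (mem_reflections_quotRep ρ P s).mp s.2⟩
      ⟨_, (mem_reflections_quotRep ρ P t).mp t.2⟩ (by simp [h])⟩

end Cherednik

end

/-!
A realization is an algebra homomorphism from `H_c`, and it is aspherical when it kills `∑ w`. For
instance `H_c / H_c e_W H_c` is one, so (i) asks for a module in category `𝒪` over this quotient `A`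
when `A ≠ 0`. The left ideal `A 𝔥` is proper. Otherwise Nakayama's lemma, over the commutative
algebra of left multiplications by `ℂ[𝔥]` and right multiplications by `ℂ[𝔥*]`, over which `A` is
finitely generated by the triangular decomposition, would write the identity of `A` as a
combination of operators of negative degree for the Euler element. By the same decomposition
`A / A 𝔥` lies in category `𝒪`.

Part (ii) can now be checked on arbitrary nonzero aspherical realizations. Let `W'` be the
stabilizer of `b`. The generalized weight space of `b` in a realization of `W` is a realization of
`W'`, once `𝔥` is corrected by the Dunkl terms of the reflections `s` outside `W'`, which make sense
because `α_s(b) ≠ 0` makes `α_s` invertible there. The same correction turns the induced module of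
a realization of `W'` with the single generalized weight `b` into a realization of `W`, and such
realizations of `W'` arise as quotients by left ideals `A (x - (x, b))`. Since
`𝔥 ≅ 𝔥^{W'} ⊕ 𝔥 / 𝔥^{W'}`, polynomial differential operators on the first summand pass between `𝔥`
and `𝔥 / 𝔥^{W'}`.

By the Nullstellensatz, a module finitely generated over `ℂ[𝔥]` is finite dimensional or its dual
contains a `ℂ[𝔥]`-eigenvector of some weight `b ≠ 0`. In the second case the weight space of `b` in
the dual, which is a realization for a dual parameter, is nonzero.
-/

noncomputable section

namespace Cherednik

variable {W : Type u} [Group W] {V : Type v} [AddCommGroup V] [Module ℂ V]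

/-! ### Reflections and their eigenvalues -/

section Reflections

variable [Finite W] (ρ : Representation ℂ W V) (s : reflections ρ)

theorem root_coroot : root ρ s (coroot ρ s) = 2 :=
  (exists_root ρ s).choose_spec.2.2

theorem coroot_ne_zero : coroot ρ s ≠ 0 := by
  intro h
  simpa [h] using root_coroot ρ s

theorem span_coroot : Submodule.span ℂ {coroot ρ s} = LinearMap.range (ρ s.1 - 1) :=
  (exists_root ρ s).choose_spec.2.1

theorem exists_smul_coroot_eq_sub (v : V) : ∃ a : ℂ, a • coroot ρ s = ρ s.1 v - v :=
  Submodule.mem_span_singleton.mp (span_coroot ρ s ▸ ⟨v, rfl⟩)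

theorem exists_sub_eq_coroot : ∃ v : V, ρ s.1 v - v = coroot ρ s := by
  have h := Submodule.mem_span_singleton_self (R := ℂ) (coroot ρ s)
  rwa [span_coroot] at h

theorem root_apply_eq_zero_of_fixed {v : V} (hv : ρ s.1 v = v) : root ρ s v = 0 := by
  obtain ⟨x, hx⟩ : root ρ s ∈ LinearMap.range (ρ.dual s.1 - 1) :=
    (exists_root ρ s).choose_spec.1 ▸ Submodule.mem_span_singleton_self (root ρ s)
  simp [← hx, Representation.dual_apply, Module.Dual.transpose_apply,
    ρ.inv_apply_eq_iff.mpr hv.symm]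

theorem exists_apply_coroot_eq_smul : ∃ l : ℂ, ρ s.1 (coroot ρ s) = l • coroot ρ s := by
  obtain ⟨a, ha⟩ := exists_smul_coroot_eq_sub ρ s (coroot ρ s)
  exact ⟨a + 1, by rw [add_smul, ha, one_smul, sub_add_cancel]⟩

/-- The eigenvalue `λ_s ≠ 1` of a reflection `s`, that is, its eigenvalue on `α_s^∨`. -/
def reflectionEigenvalue : ℂ := (exists_apply_coroot_eq_smul ρ s).choose

theorem apply_coroot : ρ s.1 (coroot ρ s) = reflectionEigenvalue ρ s • coroot ρ s :=
  (exists_apply_coroot_eq_smul ρ s).choose_spec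

theorem reflectionEigenvalue_ne_one : reflectionEigenvalue ρ s ≠ 1 := by
  intro h
  obtain ⟨v, hv⟩ := exists_sub_eq_coroot ρ s
  exact coroot_ne_zero ρ s (eq_zero_of_fixed ρ s.1 hv (by rw [apply_coroot, h, one_smul]))

theorem reflectionEigenvalue_ne_zero : reflectionEigenvalue ρ s ≠ 0 := by
  intro h
  have h0 : ρ s.1 (coroot ρ s) = ρ s.1 0 := by rw [apply_coroot, h, zero_smul, map_zero]
  exact coroot_ne_zero ρ s ((ρ.apply_bijective s.1).injective h0)

theorem sub_apply_eq_smul_coroot (v : V) :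
    v - ρ s.1 v = root ρ s v • ((1 - reflectionEigenvalue ρ s) / 2) • coroot ρ s := by
  have hl : 1 - reflectionEigenvalue ρ s ≠ 0 :=
    sub_ne_zero.mpr (reflectionEigenvalue_ne_one ρ s).symm
  obtain ⟨a, ha⟩ := exists_smul_coroot_eq_sub ρ s v
  have hv : root ρ s (v + (a / (1 - reflectionEigenvalue ρ s)) • coroot ρ s) = 0 := by
    apply root_apply_eq_zero_of_fixed
    rw [map_add, map_smul, apply_coroot, ← sub_add_cancel (ρ s.1 v) v, ← ha]
    match_scalars <;> field_simp
    ring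
  rw [map_add, map_smul, root_coroot, smul_eq_mul] at hv
  rw [← neg_sub, ← ha, eq_neg_of_add_eq_zero_left hv]
  match_scalars
  field_simp

theorem reflectionEigenvalue_eq_of_intertwining {W' V' : Type*} [Group W'] [Finite W']
    [AddCommGroup V'] [Module ℂ V'] (ρ' : Representation ℂ W' V') (s' : reflections ρ')
    (f : V →ₗ[ℂ] V') (hf : ∀ v, f (ρ s.1 v) = ρ' s'.1 (f v)) (h0 : f (coroot ρ s) ≠ 0) :
    reflectionEigenvalue ρ s = reflectionEigenvalue ρ' s' := by
  obtain ⟨v, hv⟩ := exists_sub_eq_coroot ρ s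
  obtain ⟨a, ha⟩ := exists_smul_coroot_eq_sub ρ' s' (f v)
  have hcoroot : f (coroot ρ s) = a • coroot ρ' s' := by rw [ha, ← hv, map_sub, hf]
  refine smul_left_injective ℂ h0 ?_
  calc reflectionEigenvalue ρ s • f (coroot ρ s) = ρ' s'.1 (f (coroot ρ s)) := by
        rw [← hf, apply_coroot, map_smul]
    _ = reflectionEigenvalue ρ' s' • f (coroot ρ s) := by
      rw [hcoroot, map_smul, apply_coroot, smul_comm]

end Reflections

theorem conj_mem_reflections (ρ : Representation ℂ W V) (h : W) {g : W}
    (hg : g ∈ reflections ρ) : h * g * h⁻¹ ∈ reflections ρ := by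
  let e : V ≃ₗ[ℂ] V := LinearEquiv.ofBijective (ρ h) (ρ.apply_bijective h)
  have hrange : LinearMap.range (ρ (h * g * h⁻¹) - 1) =
      (LinearMap.range (ρ g - 1)).map (e : V →ₗ[ℂ] V) := by
    ext x
    constructor
    · rintro ⟨y, rfl⟩
      exact ⟨_, ⟨ρ h⁻¹ y, rfl⟩, by simp [e]⟩
    · rintro ⟨_, ⟨y, rfl⟩, rfl⟩
      exact ⟨ρ h y, by simp [e]⟩
  rw [reflections, Set.mem_ofPred_eq] at hg ⊢
  rw [hrange, LinearEquiv.finrank_map_eq, hg]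

theorem conj_mem_reflections_iff (ρ : Representation ℂ W V) (h g : W) :
    h * g * h⁻¹ ∈ reflections ρ ↔ g ∈ reflections ρ := by
  refine ⟨fun hg => ?_, conj_mem_reflections ρ h⟩
  simpa [mul_assoc] using conj_mem_reflections ρ h⁻¹ hg

theorem reflectionEigenvalue_conj [Finite W] (ρ : Representation ℂ W V) (h : W)
    (s t : reflections ρ) (hst : (t : W) = h * s * h⁻¹) :
    reflectionEigenvalue ρ t = reflectionEigenvalue ρ s := by
  refine (reflectionEigenvalue_eq_of_intertwining ρ s ρ t (ρ h) (fun v => ?_) fun h0 => ?_).symm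
  · simp [hst]
  · exact coroot_ne_zero ρ s ((ρ.apply_bijective h).injective (h0.trans (map_zero _).symm))

namespace Parameter

variable {ρ : Representation ℂ W V}

open Classical in
/-- The class function on `W` obtained from an element of `ℂ[S]^W` by extending it by zero. -/
def extend (c : Parameter ρ) (g : W) : ℂ :=
  if h : g ∈ reflections ρ then c.1 ⟨g, h⟩ else 0

theorem extend_coe (c : Parameter ρ) (s : reflections ρ) : c.extend s = c.1 s := dif_pos s.2

theorem extend_of_notMem (c : Parameter ρ) {g : W} (hg : g ∉ reflections ρ) : c.extend g = 0 :=
  dif_neg hg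

theorem extend_conj (c : Parameter ρ) (h g : W) : c.extend (h * g * h⁻¹) = c.extend g := by
  by_cases hg : g ∈ reflections ρ
  · exact (c.extend_coe ⟨_, conj_mem_reflections ρ h hg⟩).trans
      ((c.2 h ⟨g, hg⟩ _ rfl).trans (c.extend_coe ⟨g, hg⟩).symm)
  · rw [c.extend_of_notMem hg, c.extend_of_notMem (by rwa [conj_mem_reflections_iff])]

/-- The parameter `s ↦ 2 c_s / (1 - λ_s)`. As `(y, α_s) α_s^∨ = 2 (1 - λ_s)⁻¹ (y - s y)`, it is the
coefficient of `(y - s y, x) s` in the commutator `[y, x]`. -/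
def weight [Finite W] (c : Parameter ρ) : Parameter ρ :=
  ⟨fun s => c.1 s * (2 / (1 - reflectionEigenvalue ρ s)),
    fun g s t h => by simp only [c.2 g s t h, reflectionEigenvalue_conj ρ g s t h]⟩

/-- The parameter `s ↦ -λ_s c_s`, which turns the weight of `s` into that of `s⁻¹` in the opposite
algebra. -/
def oppositeWeight [Finite W] (c : Parameter ρ) : Parameter ρ :=
  ⟨fun s => -reflectionEigenvalue ρ s * c.1 s,
    fun g s t h => by simp only [c.2 g s t h, reflectionEigenvalue_conj ρ g s t h]⟩

theorem weight_apply [Finite W] (c : Parameter ρ) (s : reflections ρ) :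
    c.weight.1 s = c.1 s * (2 / (1 - reflectionEigenvalue ρ s)) := rfl

theorem oppositeWeight_apply [Finite W] (c : Parameter ρ) (s : reflections ρ) :
    c.oppositeWeight.1 s = -reflectionEigenvalue ρ s * c.1 s := rfl

end Parameter

/-- The reflection data entering the commutator of `y` and `x`: a class function `k` supported on
elements acting by `v ↦ v - α v • β`. The class function `k'` is characterized by
`k g (1 - g) = k' g (1 - g⁻¹)`; it is the weight of `g⁻¹` in the opposite algebra. -/
structure Coupling (ρ : Representation ℂ W V) where
  k : W → ℂ
  k' : W → ℂ
  α : W → Module.Dual ℂ V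
  β : W → V
  k_conj : ∀ h g, k (h * g * h⁻¹) = k g
  k'_conj : ∀ h g, k' (h * g * h⁻¹) = k' g
  k_eq_zero_iff : ∀ g, k g = 0 ↔ k' g = 0
  sub_apply : ∀ g, k g ≠ 0 → ∀ v, v - ρ g v = α g v • β g
  compat : ∀ g v, k g • (v - ρ g v) = k' g • (v - ρ g⁻¹ v)

theorem sub_apply_eq_neg_reflectionEigenvalue_smul [Finite W] (ρ : Representation ℂ W V)
    (s : reflections ρ) (v : V) :
    v - ρ s.1 v = -reflectionEigenvalue ρ s • (v - ρ s.1⁻¹ v) := by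
  have h := congrArg (ρ s.1) (sub_apply_eq_smul_coroot ρ s (ρ s.1⁻¹ v))
  rw [ρ.self_inv_apply, map_sub, ρ.self_inv_apply, map_smul, map_smul, apply_coroot] at h
  have h' := sub_apply_eq_smul_coroot ρ s (ρ s.1⁻¹ v)
  rw [ρ.self_inv_apply] at h'
  rw [h, ← neg_sub (ρ s.1⁻¹ v), h']
  match_scalars
  ring

open Classical in
/-- The coupling attached to a parameter `c`. -/
def Parameter.coupling [Finite W] {ρ : Representation ℂ W V} (c : Parameter ρ) : Coupling ρ where
  k := c.weight.extend
  k' := c.weight.oppositeWeight.extend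
  α g := if h : g ∈ reflections ρ then root ρ ⟨g, h⟩ else 0
  β g := if h : g ∈ reflections ρ then
    ((1 - reflectionEigenvalue ρ ⟨g, h⟩) / 2) • coroot ρ ⟨g, h⟩ else 0
  k_conj := c.weight.extend_conj
  k'_conj := c.weight.oppositeWeight.extend_conj
  k_eq_zero_iff g := by
    by_cases hg : g ∈ reflections ρ
    · lift g to reflections ρ using hg
      simp [extend_coe, oppositeWeight_apply, reflectionEigenvalue_ne_zero]
    · simp only [extend_of_notMem _ hg]
  sub_apply g hk v := by
    by_cases hg : g ∈ reflections ρ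
    · rw [dif_pos hg, dif_pos hg]
      exact sub_apply_eq_smul_coroot ρ ⟨g, hg⟩ v
    · exact absurd (extend_of_notMem _ hg) hk
  compat g v := by
    by_cases hg : g ∈ reflections ρ
    · lift g to reflections ρ using hg
      rw [extend_coe, extend_coe, oppositeWeight_apply,
        sub_apply_eq_neg_reflectionEigenvalue_smul, smul_smul, mul_comm]
    · simp only [extend_of_notMem _ hg, zero_smul]

theorem Parameter.finsum_reflections_eq_sum [Fintype W] {ρ : Representation ℂ W V}
    (c : Parameter ρ) {M : Type*} [AddCommGroup M] [Module ℂ M] (m : W → M) (b : V)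
    (a : Module.Dual ℂ V) :
    (∑ᶠ s : reflections ρ, (c.1 s * root ρ s b * a (coroot ρ s)) • m s) =
      ∑ g, (c.coupling.k g * a (b - ρ g b)) • m g := by
  classical
  rw [finsum_eq_sum_of_fintype]
  refine Fintype.sum_of_injective _ Subtype.val_injective _ _ (fun g hg => ?_) fun s => ?_
  · have hk : c.coupling.k g = 0 := extend_of_notMem _ fun h => hg ⟨⟨g, h⟩, rfl⟩
    rw [hk, zero_mul, zero_smul]
  · have hk : c.coupling.k s = c.1 s * (2 / (1 - reflectionEigenvalue ρ s)) := extend_coe _ s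
    have hl : 1 - reflectionEigenvalue ρ s ≠ 0 :=
      sub_ne_zero.mpr (reflectionEigenvalue_ne_one ρ s).symm
    rw [hk, sub_apply_eq_smul_coroot, map_smul, map_smul, smul_eq_mul, smul_eq_mul]
    field_simp

/-- The restriction of a coupling to a subgroup. -/
def Coupling.restrict {ρ : Representation ℂ W V} (κ : Coupling ρ) (P : Subgroup W) :
    Coupling (ρ.comp P.subtype : Representation ℂ P V) where
  k g := κ.k g
  k' g := κ.k' g
  α g := κ.α g
  β g := κ.β g
  k_conj h g := κ.k_conj h g
  k'_conj h g := κ.k'_conj h g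
  k_eq_zero_iff g := κ.k_eq_zero_iff g
  sub_apply g := κ.sub_apply g
  compat g v := κ.compat g v

/-! ### Realizations of the defining relations -/

/-- A realization, in an algebra `A`, of the generators and relations of the rational Cherednik
algebra whose commutator `[y, x]` has the coefficient `k g * (y - g y, x)` at `g`. For
`k = c.coupling.k` this is the same as an algebra homomorphism `H_c(W, 𝔥) → A`; the latitude in `k`
makes it possible to keep `k` while changing the space on which `W` acts. -/
structure Realization [Fintype W] (ρ : Representation ℂ W V) (k : W → ℂ) (A : Type*) [Ring A]
    [Algebra ℂ A] where
  T : W →* A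
  X : Module.Dual ℂ V →ₗ[ℂ] A
  Y : V →ₗ[ℂ] A
  T_mul_X : ∀ g a, T g * X a = X (ρ.dual g a) * T g
  T_mul_Y : ∀ g b, T g * Y b = Y (ρ g b) * T g
  X_comm : ∀ a a', X a * X a' = X a' * X a
  Y_comm : ∀ b b', Y b * Y b' = Y b' * Y b
  Y_X : ∀ b a, Y b * X a - X a * Y b =
    algebraMap ℂ A (a b) - ∑ g, (k g * a (b - ρ g b)) • T g

namespace Realization

variable [Fintype W] {ρ : Representation ℂ W V} {k : W → ℂ} {A B : Type*} [Ring A] [Algebra ℂ A]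
  [Ring B] [Algebra ℂ B]

/-- A realization is aspherical if `∑ w`, equivalently `e_W`, acts by zero. -/
def Aspherical (r : Realization ρ k A) : Prop := ∑ g, r.T g = 0

/-- The image of a realization under an algebra homomorphism. -/
def map (r : Realization ρ k A) (f : A →ₐ[ℂ] B) : Realization ρ k B where
  T := (f : A →* B).comp r.T
  X := f.toLinearMap ∘ₗ r.X
  Y := f.toLinearMap ∘ₗ r.Y
  T_mul_X g a := by simpa using congrArg f (r.T_mul_X g a)
  T_mul_Y g a := by simpa using congrArg f (r.T_mul_Y g a)
  X_comm a a' := by simpa using congrArg f (r.X_comm a a')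
  Y_comm a a' := by simpa using congrArg f (r.Y_comm a a')
  Y_X b a := by simpa using congrArg f (r.Y_X b a)

theorem Aspherical.map {r : Realization ρ k A} (hr : r.Aspherical) (f : A →ₐ[ℂ] B) :
    (r.map f).Aspherical := by
  simpa [Aspherical, Realization.map] using congrArg f hr

/-- The realization generates the algebra in which it takes its values. -/
def Generates (r : Realization ρ k A) : Prop :=
  Algebra.adjoin ℂ (Set.range r.X ∪ Set.range r.Y ∪ Set.range r.T) = ⊤

theorem Generates.map {r : Realization ρ k A} (hr : r.Generates) {f : A →ₐ[ℂ] B}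
    (hf : Function.Surjective f) : (r.map f).Generates := by
  have h := congrArg (Subalgebra.map f) hr
  rwa [AlgHom.map_adjoin, Algebra.map_top, (AlgHom.range_eq_top f).mpr hf, Set.image_union,
    Set.image_union, ← Set.range_comp, ← Set.range_comp, ← Set.range_comp] at h

/-- The values of a realization on generators. -/
def genValue (r : Realization ρ k A) : Gen W V → A
  | .w g => r.T g
  | .x a => r.X a
  | .y b => r.Y b

end Realization

section CherednikAlgebra

variable [Fintype W] {ρ : Representation ℂ W V} (c : Parameter ρ)

/-- The tautological realization in `H_c(W, 𝔥)`. -/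
def universalRealization : Realization ρ c.coupling.k (H ρ c) where
  T :=
    { toFun := fun g => gen ρ c (.w g)
      map_one' := by simpa [gen] using RingQuot.mkAlgHom_rel ℂ (Rel.w_one (c := c))
      map_mul' := fun g h => by
        simpa [gen] using RingQuot.mkAlgHom_rel ℂ (Rel.w_mul (c := c) g h) }
  X :=
    { toFun := fun a => gen ρ c (.x a)
      map_add' := fun a a' => by
        simpa [gen] using RingQuot.mkAlgHom_rel ℂ (Rel.x_add (c := c) a a')
      map_smul' := fun t a => by
        simpa [gen] using RingQuot.mkAlgHom_rel ℂ (Rel.x_smul (c := c) t a) }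
  Y :=
    { toFun := fun b => gen ρ c (.y b)
      map_add' := fun b b' => by
        simpa [gen] using RingQuot.mkAlgHom_rel ℂ (Rel.y_add (c := c) b b')
      map_smul' := fun t b => by
        simpa [gen] using RingQuot.mkAlgHom_rel ℂ (Rel.y_smul (c := c) t b) }
  T_mul_X g a := by simpa [gen] using RingQuot.mkAlgHom_rel ℂ (Rel.w_x (c := c) g a)
  T_mul_Y g b := by simpa [gen] using RingQuot.mkAlgHom_rel ℂ (Rel.w_y (c := c) g b)
  X_comm a a' := by simpa [gen] using RingQuot.mkAlgHom_rel ℂ (Rel.x_comm (c := c) a a')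
  Y_comm b b' := by simpa [gen] using RingQuot.mkAlgHom_rel ℂ (Rel.y_comm (c := c) b b')
  Y_X b a := by
    have h := RingQuot.mkAlgHom_rel ℂ (Rel.y_x (c := c) b a)
    rw [c.finsum_reflections_eq_sum (fun g => FreeAlgebra.ι ℂ (Gen.w g)), map_sub, map_sub,
      map_mul, map_mul, map_sum, AlgHom.commutes] at h
    simp only [map_smul] at h
    exact h

theorem universalRealization_generates : (universalRealization c).Generates := by
  have hgen : Set.range (gen ρ c) =
      RingQuot.mkAlgHom ℂ (Rel ρ c) '' Set.range (FreeAlgebra.ι ℂ) := by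
    rw [← Set.range_comp]
    rfl
  have htop : Algebra.adjoin ℂ (Set.range (gen ρ c)) = ⊤ := by
    rw [hgen, ← AlgHom.map_adjoin, FreeAlgebra.adjoin_range_ι, Algebra.map_top,
      AlgHom.range_eq_top]
    exact RingQuot.mkAlgHom_surjective ℂ _
  refine top_le_iff.mp (htop.ge.trans (Algebra.adjoin_mono ?_))
  rintro _ ⟨g | a | b, rfl⟩
  · exact Or.inr ⟨g, rfl⟩
  · exact Or.inl (Or.inl ⟨a, rfl⟩)
  · exact Or.inl (Or.inr ⟨b, rfl⟩)

variable {c} {A : Type*} [Ring A] [Algebra ℂ A]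

/-- The homomorphism from `H_c(W, 𝔥)` defined by a realization. -/
def Realization.toAlgHom (r : Realization ρ c.coupling.k A) : H ρ c →ₐ[ℂ] A :=
  RingQuot.liftAlgHom ℂ ⟨FreeAlgebra.lift ℂ r.genValue, by
    intro x y h
    cases h with
    | w_one | w_mul | x_add | x_smul | y_add | y_smul => simp [genValue]
    | w_x g a => simpa [genValue] using r.T_mul_X g a
    | w_y g b => simpa [genValue] using r.T_mul_Y g b
    | x_comm a a' => simpa [genValue] using r.X_comm a a'
    | y_comm b b' => simpa [genValue] using r.Y_comm b b'
    | y_x b a =>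
      rw [c.finsum_reflections_eq_sum (fun g => FreeAlgebra.ι ℂ (Gen.w g))]
      simpa [genValue] using r.Y_X b a⟩

theorem Realization.toAlgHom_gen (r : Realization ρ c.coupling.k A) (z : Gen W V) :
    r.toAlgHom (gen ρ c z) = r.genValue z := by
  simp [toAlgHom, gen]

theorem universalRealization_map_aspherical_iff (f : H ρ c →ₐ[ℂ] A) :
    ((universalRealization c).map f).Aspherical ↔ f (idem ρ c) = 0 := by
  have hcard : (Nat.card W : ℂ)⁻¹ ≠ 0 := inv_ne_zero (Nat.cast_ne_zero.mpr Nat.card_pos.ne')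
  rw [idem, finsum_eq_sum_of_fintype, map_smul, map_sum, smul_eq_zero_iff_right hcard]
  rfl

theorem Realization.Aspherical.toAlgHom_idem {r : Realization ρ c.coupling.k A}
    (hr : r.Aspherical) : r.toAlgHom (idem ρ c) = 0 := by
  refine (universalRealization_map_aspherical_iff r.toAlgHom).mp (Eq.trans ?_ hr)
  exact Finset.sum_congr rfl fun g _ => r.toAlgHom_gen (.w g)

end CherednikAlgebra

/-! ### The ideal generated by the symmetrizer -/

section SphericalIdeal

variable [Finite W] {ρ : Representation ℂ W V} {c : Parameter ρ}

theorem sphericalIdeal_ne_top_of_algHom {A : Type*} [Ring A] [Algebra ℂ A] [Nontrivial A]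
    (f : H ρ c →ₐ[ℂ] A) (hf : f (idem ρ c) = 0) : sphericalIdeal ρ c ≠ ⊤ := by
  have hle : sphericalIdeal ρ c ≤ LinearMap.ker f.toLinearMap := by
    rw [sphericalIdeal, Submodule.mul_le]
    intro x hx y _
    suffices f x = 0 by simp [this]
    refine Submodule.mul_induction_on hx (fun m _ n hn => ?_) fun m n hm hn => ?_
    · obtain ⟨t, rfl⟩ := Submodule.mem_span_singleton.mp hn
      simp [hf]
    · rw [map_add, hm, hn, add_zero]
  intro h
  have h1 : (1 : H ρ c) ∈ LinearMap.ker f.toLinearMap := hle (h ▸ Submodule.mem_top)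
  simp at h1

theorem sphericalIdeal_ne_top_of_isAspherical {M : Type*} [AddCommGroup M] [Module (H ρ c) M]
    (hM : IsAspherical ρ c M) : sphericalIdeal ρ c ≠ ⊤ := by
  let : Module ℂ M := Module.compHom M (algebraMap ℂ (H ρ c))
  have : IsScalarTower ℂ (H ρ c) M := IsScalarTower.of_algebraMap_smul fun _ _ => rfl
  have := hM.1
  exact sphericalIdeal_ne_top_of_algHom (Algebra.lsmul ℂ ℂ M) (LinearMap.ext hM.2)

theorem Realization.Aspherical.sphericalIdeal_ne_top [Fintype W] {ρ : Representation ℂ W V}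
    {c : Parameter ρ} {A : Type*} [Ring A] [Algebra ℂ A] [Nontrivial A]
    {r : Realization ρ c.coupling.k A} (hr : r.Aspherical) : sphericalIdeal ρ c ≠ ⊤ :=
  sphericalIdeal_ne_top_of_algHom _ hr.toAlgHom_idem

variable (ρ c) in
/-- The two-sided ideal `H_c e_W H_c`, as an `Ideal`. -/
def sphericalTwoSidedIdeal : Ideal (H ρ c) :=
  { (sphericalIdeal ρ c).toAddSubmonoid with
    smul_mem' := fun a x hx => by
      have h : ⊤ * sphericalIdeal ρ c ≤ sphericalIdeal ρ c := by
        rw [sphericalIdeal, ← mul_assoc, ← mul_assoc]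
        exact mul_le_mul' (mul_le_mul' le_top le_rfl) le_rfl
      exact h (Submodule.mul_mem_mul Submodule.mem_top hx) }

instance : (sphericalTwoSidedIdeal ρ c).IsTwoSided :=
  ⟨fun {x} b hx => by
    have h : sphericalIdeal ρ c * ⊤ ≤ sphericalIdeal ρ c := by
      rw [sphericalIdeal, mul_assoc]
      exact mul_le_mul' le_rfl le_top
    exact h (Submodule.mul_mem_mul hx Submodule.mem_top)⟩

theorem idem_mem_sphericalTwoSidedIdeal : idem ρ c ∈ sphericalTwoSidedIdeal ρ c := by
  have h : 1 * idem ρ c * 1 ∈ sphericalIdeal ρ c :=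
    Submodule.mul_mem_mul (Submodule.mul_mem_mul Submodule.mem_top
      (Submodule.mem_span_singleton_self _)) Submodule.mem_top
  rwa [one_mul, mul_one] at h

theorem nontrivial_quotient_sphericalTwoSidedIdeal (h : sphericalIdeal ρ c ≠ ⊤) :
    Nontrivial (H ρ c ⧸ sphericalTwoSidedIdeal ρ c) := by
  refine Ideal.Quotient.nontrivial_iff.mpr fun h' => h (eq_top_iff.mpr fun x _ => ?_)
  have hx : x ∈ sphericalTwoSidedIdeal ρ c := h' ▸ Submodule.mem_top
  exact hx

end SphericalIdeal

section QuotientRealization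

variable [Fintype W] {ρ : Representation ℂ W V} (c : Parameter ρ)

/-- The tautological realization in `H_c / H_c e_W H_c`. -/
def quotientRealization : Realization ρ c.coupling.k (H ρ c ⧸ sphericalTwoSidedIdeal ρ c) :=
  (universalRealization c).map (Ideal.Quotient.mkₐ ℂ _)

theorem quotientRealization_aspherical : (quotientRealization c).Aspherical := by
  rw [quotientRealization, universalRealization_map_aspherical_iff, Ideal.Quotient.mkₐ_eq_mk,
    Ideal.Quotient.eq_zero_iff_mem]
  exact idem_mem_sphericalTwoSidedIdeal

theorem quotientRealization_generates : (quotientRealization c).Generates :=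
  (universalRealization_generates c).map (Ideal.Quotient.mkₐ_surjective ℂ _)

end QuotientRealization

/-! ### Triangular decompositions -/

section Triangular

variable {W A : Type*} [Group W] [Ring A]

theorem map_mul_map_inv (T : W →* A) (g : W) : T g * T g⁻¹ = 1 := by
  rw [← map_mul, mul_inv_cancel, map_one]

theorem map_inv_mul_map (T : W →* A) (g : W) : T g⁻¹ * T g = 1 := by
  rw [← map_mul, inv_mul_cancel, map_one]

theorem mul_eq_mul_conj (T : W →* A) (g : W) (z : A) : z * T g = T g * (T g⁻¹ * z * T g) := by
  rw [mul_assoc, ← mul_assoc (T g), map_mul_map_inv, one_mul]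

theorem pow_mul_eq_mul_conj_pow (T : W →* A) (g : W) (z : A) (n : ℕ) :
    z ^ n * T g = T g * (T g⁻¹ * z * T g) ^ n := by
  have h : SemiconjBy (T g) (T g⁻¹ * z * T g) z := (mul_eq_mul_conj T g z).symm
  exact (h.pow_right n).symm

variable [Algebra ℂ A]

theorem span_range_mul_span_range_le (T : W →* A) :
    Submodule.span ℂ (Set.range T) * Submodule.span ℂ (Set.range T) ≤
      Submodule.span ℂ (Set.range T) := by
  rw [Submodule.span_mul_span]
  refine Submodule.span_mono ?_
  rintro _ ⟨_, ⟨g, rfl⟩, _, ⟨g', rfl⟩, rfl⟩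
  exact ⟨g * g', map_mul T g g'⟩

theorem one_mem_span_range (T : W →* A) : (1 : A) ∈ Submodule.span ℂ (Set.range T) :=
  Submodule.subset_span ⟨1, map_one T⟩

/-- The elements of an algebra that preserve a given subspace of a module. -/
def stabilizingSubalgebra (A : Type*) [Ring A] [Algebra ℂ A] {M : Type*} [AddCommGroup M]
    [Module ℂ M] [Module A M] [IsScalarTower ℂ A M] (N : Submodule ℂ M) : Subalgebra ℂ A where
  carrier := {x | ∀ n ∈ N, x • n ∈ N}
  mul_mem' {x y} hx hy n hn := by
    rw [mul_smul]
    exact hx _ (hy n hn)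
  add_mem' {x y} hx hy n hn := by
    rw [add_smul]
    exact N.add_mem (hx n hn) (hy n hn)
  algebraMap_mem' t n hn := by
    rw [algebraMap_smul]
    exact N.smul_mem t hn

theorem adjoin_le_of_mul_le {s : Set A} {N : Submodule ℂ A} (h1 : (1 : A) ∈ N)
    (hs : ∀ x ∈ s, ∀ n ∈ N, x * n ∈ N) : (Algebra.adjoin ℂ s).toSubmodule ≤ N := by
  intro x hx
  simpa using (Algebra.adjoin_le hs : Algebra.adjoin ℂ s ≤ stabilizingSubalgebra A N) hx 1 h1

/-- A triangular structure on an algebra: two commuting families `U`, `Z`, each normalized by a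
group `T`, with the commutators between `Z` and `U` in the span of `T`. -/
structure Triangular (T : W →* A) (U Z : Submodule ℂ A) : Prop where
  conj_left : ∀ g, ∀ x ∈ U, T g * x * T g⁻¹ ∈ U
  conj_right : ∀ g, ∀ z ∈ Z, T g * z * T g⁻¹ ∈ Z
  commutator : ∀ z ∈ Z, ∀ x ∈ U, z * x - x * z ∈ Submodule.span ℂ (Set.range T)
  comm_left : ∀ x ∈ U, ∀ y ∈ U, x * y = y * x
  comm_right : ∀ x ∈ Z, ∀ y ∈ Z, x * y = y * x

namespace Triangular

variable {T : W →* A} {U Z : Submodule ℂ A}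

theorem conj_inv_mem (h : Triangular T U Z) (g : W) {z : A} (hz : z ∈ Z) :
    T g⁻¹ * z * T g ∈ Z := by
  simpa using h.conj_right g⁻¹ z hz

theorem conj_mem_adjoin (h : Triangular T U Z) (g : W) {p : A}
    (hp : p ∈ Algebra.adjoin ℂ (U : Set A)) :
    T g * p * T g⁻¹ ∈ Algebra.adjoin ℂ (U : Set A) := by
  let conj := MulSemiringAction.toAlgHom ℂ A (ConjAct.toConjAct (T.toHomUnits g))
  have hconj : ∀ a, conj a = T g * a * T g⁻¹ := fun a => by
    simp [conj, ConjAct.units_smul_def, ← map_inv]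
  have hle : (Algebra.adjoin ℂ (U : Set A)).map conj ≤ Algebra.adjoin ℂ (U : Set A) := by
    rw [AlgHom.map_adjoin]
    refine Algebra.adjoin_mono ?_
    rintro _ ⟨x, hx, rfl⟩
    rw [hconj]
    exact h.conj_left g x hx
  rw [← hconj]
  exact hle ⟨p, hp, rfl⟩

theorem span_range_mul_adjoin_le (h : Triangular T U Z) :
    Submodule.span ℂ (Set.range T) * (Algebra.adjoin ℂ (U : Set A)).toSubmodule ≤
      (Algebra.adjoin ℂ (U : Set A)).toSubmodule * Submodule.span ℂ (Set.range T) := by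
  rw [Submodule.mul_le]
  intro t ht p hp
  induction ht using Submodule.span_induction with
  | mem t ht =>
    obtain ⟨g, rfl⟩ := ht
    have hTp : T g * p = T g * p * T g⁻¹ * T g := by
      rw [mul_assoc _ (T g⁻¹), map_inv_mul_map, mul_one]
    rw [hTp]
    exact Submodule.mul_mem_mul (h.conj_mem_adjoin g hp) (Submodule.subset_span ⟨g, rfl⟩)
  | zero => rw [zero_mul]; exact zero_mem _
  | add x y _ _ hx hy => rw [add_mul]; exact add_mem hx hy
  | smul t x _ hx => rw [smul_mul_assoc]; exact Submodule.smul_mem _ _ hx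

theorem mul_span_range_le (h : Triangular T U Z) :
    Z * Submodule.span ℂ (Set.range T) ≤ Submodule.span ℂ (Set.range T) * Z := by
  rw [Submodule.mul_le]
  intro z hz t ht
  induction ht using Submodule.span_induction with
  | mem t ht =>
    obtain ⟨g, rfl⟩ := ht
    rw [mul_eq_mul_conj]
    exact Submodule.mul_mem_mul (Submodule.subset_span ⟨g, rfl⟩) (h.conj_inv_mem g hz)
  | zero => rw [mul_zero]; exact zero_mem _
  | add x y _ _ hx hy => rw [mul_add]; exact add_mem hx hy
  | smul t x _ hx => rw [mul_smul_comm]; exact Submodule.smul_mem _ _ hx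

theorem commutator_mem (h : Triangular T U Z) {z : A} (hz : z ∈ Z) {p : A}
    (hp : p ∈ Algebra.adjoin ℂ (U : Set A)) :
    z * p - p * z ∈
      (Algebra.adjoin ℂ (U : Set A)).toSubmodule * Submodule.span ℂ (Set.range T) := by
  set S := Algebra.adjoin ℂ (U : Set A)
  set C := Submodule.span ℂ (Set.range T)
  have hSS : S.toSubmodule * S.toSubmodule = S.toSubmodule :=
    (Subalgebra.isIdempotentElem_toSubmodule S).eq
  induction hp using Algebra.adjoin_induction with
  | mem x hx =>
    rw [← one_mul (z * x - x * z)]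
    exact Submodule.mul_mem_mul (one_mem S) (h.commutator z hz x hx)
  | algebraMap t =>
    rw [← Algebra.commutes, sub_self]
    exact zero_mem _
  | add x y _ _ hx hy =>
    have hadd : z * (x + y) - (x + y) * z = (z * x - x * z) + (z * y - y * z) := by noncomm_ring
    rw [hadd]
    exact add_mem hx hy
  | mul x y hxS hyS hx hy =>
    have hleibniz : z * (x * y) - x * y * z = (z * x - x * z) * y + x * (z * y - y * z) := by
      noncomm_ring
    have hSCS : S.toSubmodule * C * S.toSubmodule ≤ S.toSubmodule * C := by
      rw [mul_assoc]
      refine (mul_le_mul' le_rfl h.span_range_mul_adjoin_le).trans ?_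
      rw [← mul_assoc, hSS]
    have hSSC : S.toSubmodule * (S.toSubmodule * C) ≤ S.toSubmodule * C := by
      rw [← mul_assoc, hSS]
    rw [hleibniz]
    exact add_mem (hSCS (Submodule.mul_mem_mul hx hyS)) (hSSC (Submodule.mul_mem_mul hxS hy))

theorem mul_adjoin_le (h : Triangular T U Z) :
    Z * (Algebra.adjoin ℂ (U : Set A)).toSubmodule ≤
      (Algebra.adjoin ℂ (U : Set A)).toSubmodule * (Submodule.span ℂ (Set.range T) ⊔ Z) := by
  rw [Submodule.mul_le, Submodule.mul_sup]
  intro z hz p hp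
  rw [← sub_add_cancel (z * p) (p * z)]
  exact Submodule.add_mem_sup (h.commutator_mem hz hp) (Submodule.mul_mem_mul hp hz)

theorem decomposition (h : Triangular T U Z)
    (hgen : Algebra.adjoin ℂ ((U : Set A) ∪ Z ∪ Set.range T) = ⊤) :
    (Algebra.adjoin ℂ (U : Set A)).toSubmodule * Submodule.span ℂ (Set.range T) *
      (Algebra.adjoin ℂ (Z : Set A)).toSubmodule = ⊤ := by
  rw [eq_top_iff, ← Algebra.top_toSubmodule, ← hgen]
  set S := (Algebra.adjoin ℂ (U : Set A)).toSubmodule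
  set C := Submodule.span ℂ (Set.range T)
  set R := (Algebra.adjoin ℂ (Z : Set A)).toSubmodule
  have hUS : U ≤ S := fun x hx => Algebra.subset_adjoin hx
  have hZR : Z ≤ R := fun x hx => Algebra.subset_adjoin hx
  have hSS : S * S = S := (Subalgebra.isIdempotentElem_toSubmodule _).eq
  have hRR : R * R = R := (Subalgebra.isIdempotentElem_toSubmodule _).eq
  have hCC : C * C ≤ C := span_range_mul_span_range_le T
  have hU : U * (S * C * R) ≤ S * C * R := calc
    U * (S * C * R) ≤ S * (S * C * R) := by gcongr
    _ = S * C * R := by rw [← mul_assoc, ← mul_assoc, hSS]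
  have hC : C * (S * C * R) ≤ S * C * R := calc
    C * (S * C * R) = C * S * C * R := by simp only [mul_assoc]
    _ ≤ S * C * C * R :=
      mul_le_mul' (mul_le_mul' h.span_range_mul_adjoin_le le_rfl) le_rfl
    _ = S * (C * C) * R := by simp only [mul_assoc]
    _ ≤ S * C * R := by gcongr
  have hZ : Z * (S * C * R) ≤ S * C * R := calc
    Z * (S * C * R) = Z * S * C * R := by simp only [mul_assoc]
    _ ≤ S * (C ⊔ Z) * C * R := mul_le_mul' (mul_le_mul' h.mul_adjoin_le le_rfl) le_rfl
    _ = S * (C * C ⊔ Z * C) * R := by rw [mul_assoc S, Submodule.sup_mul]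
    _ ≤ S * (C ⊔ C * Z) * R :=
      mul_le_mul' (mul_le_mul' le_rfl (sup_le_sup hCC h.mul_span_range_le)) le_rfl
    _ = S * C * R ⊔ S * C * (Z * R) := by
      simp only [Submodule.mul_sup, Submodule.sup_mul, mul_assoc]
    _ ≤ S * C * R ⊔ S * C * (R * R) := by gcongr
    _ = S * C * R := by rw [hRR, sup_idem]
  refine adjoin_le_of_mul_le ?_ ?_
  · have hone : (1 : A) * 1 * 1 ∈ S * C * R :=
      Submodule.mul_mem_mul (Submodule.mul_mem_mul (one_mem (Algebra.adjoin ℂ (U : Set A)))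
        (one_mem_span_range T)) (one_mem (Algebra.adjoin ℂ (Z : Set A)))
    simpa only [mul_one] using hone
  · rintro x ((hx | hx) | hx) n hn
    · exact hU (Submodule.mul_mem_mul hx hn)
    · exact hZ (Submodule.mul_mem_mul hx hn)
    · exact hC (Submodule.mul_mem_mul (Submodule.subset_span hx) hn)

end Triangular

/-! ### Gradings by eigenvalues of `ad D` -/

/-- The operator `ad D` of commutation with `D`. -/
def innerDerivation (D : A) : Module.End ℂ A := LinearMap.mulLeft ℂ D - LinearMap.mulRight ℂ D

theorem mem_eigenspace_innerDerivation_iff {D f : A} {a : ℂ} :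
    f ∈ (innerDerivation D).eigenspace a ↔ D * f - f * D = a • f := by
  rw [Module.End.mem_eigenspace_iff]
  rfl

theorem gradedMonoid_eigenspace_innerDerivation (D : A) (η : ℂ) :
    SetLike.GradedMonoid fun n : ℕ => (innerDerivation D).eigenspace (n • η) where
  one_mem := by simp [innerDerivation]
  mul_mem m n f g hf hg := by
    rw [mem_eigenspace_innerDerivation_iff] at hf hg ⊢
    have hleibniz : D * (f * g) - f * g * D = (D * f - f * D) * g + f * (D * g - g * D) := by
      noncomm_ring
    rw [hleibniz, hf, hg, smul_mul_assoc, mul_smul_comm, ← add_smul, ← add_smul]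

theorem one_notMem_adjoin_mul_span [Nontrivial A] {D : A} {η : ℂ} (hη : η ≠ 0) {L R : Set A}
    (hL : ∀ f ∈ L, D * f = f * D) (hR : ∀ f ∈ R, D * f - f * D = η • f) :
    (1 : A) ∉ (Algebra.adjoin ℂ (L ∪ R)).toSubmodule * Submodule.span ℂ R := by
  intro hone
  let G : ℕ → Submodule ℂ A := fun n => (innerDerivation D).eigenspace (n • η)
  have : SetLike.GradedMonoid G := gradedMonoid_eigenspace_innerDerivation D η
  have hspan : Submodule.span ℂ R ≤ G 1 := Submodule.span_le.mpr fun f hf => by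
    simpa [G, innerDerivation] using hR f hf
  have hadjoin : (Algebra.adjoin ℂ (L ∪ R)).toSubmodule ≤ ⨆ n, G n := by
    rw [Submodule.iSup_eq_toSubmodule_range]
    refine Algebra.adjoin_le (S := (DirectSum.coeAlgHom G).range) ?_
    rw [← Subalgebra.coe_toSubmodule, ← Submodule.iSup_eq_toSubmodule_range]
    rintro f (hf | hf)
    · exact Submodule.mem_iSup_of_mem 0 (by simp [G, innerDerivation, hL f hf])
    · exact Submodule.mem_iSup_of_mem 1 (hspan (Submodule.subset_span hf))
  have hpos : (⨆ n, G n) * G 1 ≤ ⨆ (a : ℂ) (_ : a ≠ 0), (innerDerivation D).eigenspace a := by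
    rw [Submodule.iSup_mul]
    refine iSup_le fun n => (Submodule.mul_le.mpr fun f hf g hg => ?_).trans
      (le_iSup₂_of_le ((n + 1) • η) (smul_ne_zero n.succ_ne_zero hη) le_rfl)
    exact SetLike.GradedMul.mul_mem hf hg
  have hone_zero : (1 : A) ∈ (innerDerivation D).eigenspace 0 := by
    simp [innerDerivation]
  exact one_ne_zero (Submodule.disjoint_def.mp ((innerDerivation D).eigenspaces_iSupIndep 0) 1
    hone_zero (hpos (mul_le_mul' hadjoin hspan hone)))

/-! ### Properness of one-sided ideals -/

theorem mulLeft_mem_adjoin {U : Set A} {p : A} (hp : p ∈ Algebra.adjoin ℂ U) :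
    LinearMap.mulLeft ℂ p ∈ Algebra.adjoin ℂ (LinearMap.mulLeft ℂ '' U) := by
  have h := AlgHom.map_adjoin (Algebra.lmul ℂ A) U
  exact h.le ⟨p, hp, rfl⟩

theorem mulRight_mem_adjoin {Z : Set A} {p : A} (hp : p ∈ Algebra.adjoin ℂ Z) :
    LinearMap.mulRight ℂ p ∈ Algebra.adjoin ℂ (LinearMap.mulRight ℂ '' Z) := by
  have hop : MulOpposite.op p ∈ Algebra.adjoin ℂ (MulOpposite.op '' Z) := by
    rw [show MulOpposite.op '' Z = MulOpposite.unop ⁻¹' Z from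
      MulOpposite.opEquiv.image_eq_preimage_symm Z]
    exact (Subalgebra.op_adjoin (R := ℂ) Z).le hp
  have h := AlgHom.map_adjoin (Algebra.lsmul ℂ ℂ A : Aᵐᵒᵖ →ₐ[ℂ] Module.End ℂ A)
    (MulOpposite.op '' Z)
  rw [Set.image_image] at h
  exact h.le ⟨_, hop, rfl⟩

open scoped IsMulCommutative in
theorem one_mem_mul_span_of_finite {M : Type*} [AddCommGroup M] [Module ℂ M]
    (C : Subalgebra ℂ (Module.End ℂ M)) [IsMulCommutative C] {R : Set (Module.End ℂ M)}
    (hRC : R ⊆ C) {s : Set M} (hs : s.Finite) (hgen : Submodule.span C s = ⊤)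
    (hR : ⨆ f ∈ R, LinearMap.range f = ⊤) :
    (1 : Module.End ℂ M) ∈ C.toSubmodule * Submodule.span ℂ R := by
  let I : Ideal C := Ideal.span {x | x.1 ∈ R}
  have hfg : (⊤ : Submodule C M).FG := hgen ▸ Submodule.fg_span hs
  have hle : (⊤ : Submodule C M) ≤ I • ⊤ := by
    rw [← Submodule.restrictScalars_le (S := ℂ), Submodule.restrictScalars_top, ← hR]
    refine iSup₂_le fun f hf => ?_
    rintro _ ⟨n, rfl⟩
    have hmem : (⟨f, hRC hf⟩ : C) • n ∈ I • (⊤ : Submodule C M) :=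
      Submodule.smul_mem_smul (Ideal.subset_span hf) Submodule.mem_top
    exact hmem
  obtain ⟨r, hrI, hr⟩ :=
    Submodule.exists_mem_and_smul_eq_self_of_fg_of_le_smul I ⊤ hfg hle
  have hr1 : r.1 = 1 := LinearMap.ext fun m => hr m Submodule.mem_top
  rw [← hr1]
  clear hr1 hr
  induction hrI using Submodule.closure_induction with
  | zero => exact zero_mem _
  | add x y _ _ hx hy => exact add_mem hx hy
  | smul_mem r z hz => exact Submodule.mul_mem_mul r.2 (Submodule.subset_span hz)

namespace Triangular

variable {T : W →* A} {U Z : Submodule ℂ A}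

/-- The operators on an algebra given by left multiplication by `U` and right multiplication by
`Z`. For a triangular structure they commute, and the triangular decomposition says that the algebra
is finitely generated over them. -/
def multiplications (U Z : Submodule ℂ A) : Subalgebra ℂ (Module.End ℂ A) :=
  Algebra.adjoin ℂ (LinearMap.mulLeft ℂ '' (U : Set A) ∪ LinearMap.mulRight ℂ '' (Z : Set A))

theorem isMulCommutative_multiplications (h : Triangular T U Z) :
    IsMulCommutative (multiplications U Z) := by
  refine Algebra.isMulCommutative_adjoin ℂ ?_
  rintro _ (⟨x, hx, rfl⟩ | ⟨x, hx, rfl⟩) _ (⟨y, hy, rfl⟩ | ⟨y, hy, rfl⟩) <;>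
    refine LinearMap.ext fun a => ?_
  · simp [← mul_assoc, h.comm_left x hx y hy]
  · simp [mul_assoc]
  · simp [mul_assoc]
  · simp [mul_assoc, h.comm_right x hx y hy]

theorem span_multiplications_range (h : Triangular T U Z)
    (hgen : Algebra.adjoin ℂ ((U : Set A) ∪ Z ∪ Set.range T) = ⊤) :
    Submodule.span (multiplications U Z) (Set.range T) = ⊤ := by
  set N := Submodule.span (multiplications U Z) (Set.range T)
  have hstable : ∀ f ∈ multiplications U Z, ∀ n ∈ N, f n ∈ N := fun f hf n hn =>
    N.smul_mem ⟨f, hf⟩ hn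
  have hleft : (Algebra.adjoin ℂ (U : Set A)).toSubmodule * Submodule.span ℂ (Set.range T) ≤
      N.restrictScalars ℂ := Submodule.mul_le.mpr fun p hp t ht =>
    hstable _ (Algebra.adjoin_mono Set.subset_union_left (mulLeft_mem_adjoin hp)) t
      (Submodule.span_le_restrictScalars ℂ _ _ ht)
  rw [← Submodule.restrictScalars_eq_top_iff ℂ, eq_top_iff, ← h.decomposition hgen]
  exact Submodule.mul_le.mpr fun m hm q hq =>
    hstable _ (Algebra.adjoin_mono Set.subset_union_right (mulRight_mem_adjoin hq)) m (hleft hm)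

/-- If the left ideal were everything, Nakayama's lemma over the `multiplications` would write `1`
in terms of right multiplications by `Z`, all of nonzero degree for `ad E`. -/
theorem one_notMem_span [Finite W] [Nontrivial A] (h : Triangular T U Z)
    (hgen : Algebra.adjoin ℂ ((U : Set A) ∪ Z ∪ Set.range T) = ⊤) {E : A} {ε : ℂ} (hε : ε ≠ 0)
    (hE : ∀ z ∈ Z, E * z - z * E = ε • z) : (1 : A) ∉ Ideal.span (Z : Set A) := by
  intro h1
  have := h.isMulCommutative_multiplications
  have hrange : ⨆ f ∈ LinearMap.mulRight ℂ '' (Z : Set A), LinearMap.range f = ⊤ := by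
    refine eq_top_iff.mpr fun a _ => ?_
    have ha : a ∈ Ideal.span (Z : Set A) := (Ideal.eq_top_iff_one _).mpr h1 ▸ Submodule.mem_top
    induction ha using Submodule.closure_induction with
    | zero => exact zero_mem _
    | add x y _ _ hx hy => exact add_mem (hx trivial) (hy trivial)
    | smul_mem r z hz =>
      exact Submodule.mem_iSup_of_mem _ (Submodule.mem_iSup_of_mem ⟨z, hz, rfl⟩ ⟨r, rfl⟩)
  refine one_notMem_adjoin_mul_span (D := LinearMap.mulRight ℂ E) (neg_ne_zero.mpr hε) ?_ ?_
    (one_mem_mul_span_of_finite (multiplications U Z)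
      (fun f hf => Algebra.subset_adjoin (Or.inr hf)) (Set.finite_range T)
      (h.span_multiplications_range hgen) hrange)
  · rintro _ ⟨x, -, rfl⟩
    refine LinearMap.ext fun a => ?_
    simp [mul_assoc]
  · rintro _ ⟨z, hz, rfl⟩
    refine LinearMap.ext fun a => ?_
    have hEz : a * (z * E - E * z) = a * (-ε • z) := by rw [neg_smul, ← hE z hz, neg_sub]
    simpa [mul_sub, mul_assoc] using hEz

end Triangular

/-! ### Local nilpotency -/

section LocallyNilpotent

variable {M : Type*} [AddCommGroup M] [Module ℂ M] [Module A M] [IsScalarTower ℂ A M]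

/-- The vectors on which every element of `Z` acts nilpotently. -/
def locallyNilpotentPart (Z : Submodule ℂ A) (M : Type*) [AddCommGroup M] [Module ℂ M] [Module A M]
    [IsScalarTower ℂ A M] : Submodule ℂ M where
  carrier := {m | ∀ z ∈ Z, ∃ n : ℕ, z ^ n • m = 0}
  zero_mem' z _ := ⟨0, smul_zero _⟩
  add_mem' {m m'} hm hm' z hz := by
    obtain ⟨n, hn⟩ := hm z hz
    obtain ⟨n', hn'⟩ := hm' z hz
    refine ⟨n' + n, ?_⟩
    rw [smul_add, pow_add, mul_smul, hn, smul_zero, zero_add, ← pow_add, add_comm, pow_add,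
      mul_smul, hn', smul_zero]
  smul_mem' t m hm z hz := by
    obtain ⟨n, hn⟩ := hm z hz
    exact ⟨n, by rw [smul_algebra_smul_comm, hn, smul_zero]⟩

namespace Triangular

variable {T : W →* A} {U Z : Submodule ℂ A}

theorem range_subset_stabilizingSubalgebra (h : Triangular T U Z) :
    Set.range T ⊆ stabilizingSubalgebra A (locallyNilpotentPart Z M) := by
  rintro _ ⟨g, rfl⟩ m hm z hz
  obtain ⟨n, hn⟩ := hm _ (h.conj_inv_mem g hz)
  exact ⟨n, by rw [← mul_smul, pow_mul_eq_mul_conj_pow, mul_smul, hn, smul_zero]⟩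

theorem right_subset_stabilizingSubalgebra (h : Triangular T U Z) :
    (Z : Set A) ⊆ stabilizingSubalgebra A (locallyNilpotentPart Z M) := by
  intro x hx m hm z hz
  obtain ⟨n, hn⟩ := hm z hz
  have hc : Commute z x := h.comm_right z hz x hx
  exact ⟨n, by rw [← mul_smul, (hc.pow_left n).eq, mul_smul, hn, smul_zero]⟩

theorem pow_smul_smul_sub_mem (h : Triangular T U Z) {x z : A} (hx : x ∈ U) (hz : z ∈ Z) {m : M}
    (hm : m ∈ locallyNilpotentPart Z M) (n : ℕ) :
    z ^ n • x • m - x • z ^ n • m ∈ locallyNilpotentPart Z M := by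
  have hzS : z ∈ stabilizingSubalgebra A (locallyNilpotentPart Z M) :=
    h.right_subset_stabilizingSubalgebra hz
  have hspan : Submodule.span ℂ (Set.range T) ≤
      (stabilizingSubalgebra A (locallyNilpotentPart Z M)).toSubmodule :=
    Submodule.span_le.mpr h.range_subset_stabilizingSubalgebra
  induction n with
  | zero => simp
  | succ n ih =>
    have hstep : z ^ (n + 1) • x • m - x • z ^ (n + 1) • m =
        z • (z ^ n • x • m - x • z ^ n • m) + (z * x - x * z) • z ^ n • m := by
      rw [pow_succ', smul_sub, sub_smul]
      simp only [mul_smul]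
      abel
    rw [hstep]
    exact add_mem (hzS _ ih) (hspan (h.commutator z hz x hx) _ (pow_mem hzS n m hm))

theorem left_subset_stabilizingSubalgebra (h : Triangular T U Z) :
    (U : Set A) ⊆ stabilizingSubalgebra A (locallyNilpotentPart Z M) := by
  intro x hx m hm z hz
  obtain ⟨n, hn⟩ := hm z hz
  obtain ⟨j, hj⟩ := h.pow_smul_smul_sub_mem hx hz hm n z hz
  rw [hn, smul_zero, sub_zero, ← mul_smul, ← pow_add] at hj
  exact ⟨_, hj⟩

theorem smul_mem_locallyNilpotentPart (h : Triangular T U Z)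
    (hgen : Algebra.adjoin ℂ ((U : Set A) ∪ Z ∪ Set.range T) = ⊤) (x : A) {m : M}
    (hm : m ∈ locallyNilpotentPart Z M) : x • m ∈ locallyNilpotentPart Z M := by
  have htop : ⊤ ≤ stabilizingSubalgebra A (locallyNilpotentPart Z M) := by
    rw [← hgen, Algebra.adjoin_le_iff, Set.union_subset_iff, Set.union_subset_iff]
    exact ⟨⟨h.left_subset_stabilizingSubalgebra, h.right_subset_stabilizingSubalgebra⟩,
      h.range_subset_stabilizingSubalgebra⟩
  exact htop (Algebra.mem_top (x := x)) m hm

end Triangular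

end LocallyNilpotent

end Triangular

namespace Triangular

variable {A : Type*} [Ring A] [Algebra ℂ A] {T : W →* A} {U Z : Submodule ℂ A}

theorem adjoin_mul_span_sup_eq_top (h : Triangular T U Z)
    (hgen : Algebra.adjoin ℂ ((U : Set A) ∪ Z ∪ Set.range T) = ⊤) {J : Ideal A}
    (hJ : (Z : Set A) ⊆ J) :
    (Algebra.adjoin ℂ (U : Set A)).toSubmodule * Submodule.span ℂ (Set.range T) ⊔
      J.restrictScalars ℂ = ⊤ := by
  have hmulJ : ∀ N : Submodule ℂ A, N * J.restrictScalars ℂ ≤ J.restrictScalars ℂ := fun N =>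
    Submodule.mul_le.mpr fun a _ j hj => J.mul_mem_left a hj
  have hZ : (Algebra.adjoin ℂ (Z : Set A)).toSubmodule ≤ 1 ⊔ J.restrictScalars ℂ := by
    refine adjoin_le_of_mul_le (Submodule.mem_sup_left (Submodule.one_le.mp le_rfl))
      fun z hz n hn => ?_
    have hzn : z * n ∈ Z * (1 ⊔ J.restrictScalars ℂ) := Submodule.mul_mem_mul hz hn
    rw [Submodule.mul_sup, mul_one] at hzn
    exact Submodule.mem_sup_right (sup_le (show Z ≤ J.restrictScalars ℂ from hJ) (hmulJ Z) hzn)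
  rw [eq_top_iff, ← h.decomposition hgen]
  refine (mul_le_mul' le_rfl hZ).trans ?_
  rw [Submodule.mul_sup, mul_one]
  exact sup_le_sup le_rfl (hmulJ _)

theorem finite_quotient [Finite W] (h : Triangular T U Z)
    (hgen : Algebra.adjoin ℂ ((U : Set A) ∪ Z ∪ Set.range T) = ⊤) {J : Ideal A}
    (hJ : (Z : Set A) ⊆ J) : Module.Finite (Algebra.adjoin ℂ (U : Set A)) (A ⧸ J) := by
  let P := Algebra.adjoin ℂ (U : Set A)
  let π : A →ₗ[P] A ⧸ J := J.mkQ.restrictScalars P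
  have hspan : P.toSubmodule * Submodule.span ℂ (Set.range T) ≤
      (Submodule.span P (Set.range T)).restrictScalars ℂ :=
    Submodule.mul_le.mpr fun p hp t ht =>
      (Submodule.span P _).smul_mem ⟨p, hp⟩ (Submodule.span_le_restrictScalars ℂ P _ ht)
  have hmap : (Submodule.span P (Set.range T)).map π = ⊤ := by
    refine eq_top_iff.mpr fun m _ => ?_
    obtain ⟨x, rfl⟩ := Submodule.Quotient.mk_surjective J m
    obtain ⟨s, hs, j, hj, rfl⟩ := Submodule.mem_sup.mp
      (h.adjoin_mul_span_sup_eq_top hgen hJ ▸ Submodule.mem_top (x := x))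
    refine ⟨s, hspan hs, (Submodule.Quotient.eq J).mpr ?_⟩
    rw [sub_add_cancel_left]
    exact J.neg_mem hj
  exact ⟨hmap ▸ (Submodule.fg_span (Set.finite_range T)).map π⟩

theorem exists_pow_smul_eq_zero (h : Triangular T U Z)
    (hgen : Algebra.adjoin ℂ ((U : Set A) ∪ Z ∪ Set.range T) = ⊤) {J : Ideal A}
    (hJ : (Z : Set A) ⊆ J) (m : A ⧸ J) {z : A} (hz : z ∈ Z) : ∃ n : ℕ, z ^ n • m = 0 := by
  have hone : Submodule.Quotient.mk 1 ∈ locallyNilpotentPart Z (A ⧸ J) := fun y hy => by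
    refine ⟨1, ?_⟩
    rw [pow_one, ← Submodule.Quotient.mk_smul, Submodule.Quotient.mk_eq_zero, smul_eq_mul, mul_one]
    exact hJ hy
  obtain ⟨x, rfl⟩ := Submodule.Quotient.mk_surjective J m
  have hx := h.smul_mem_locallyNilpotentPart hgen x hone z hz
  rwa [← Submodule.Quotient.mk_smul, smul_eq_mul, mul_one] at hx

end Triangular

/-! ### The Euler element -/

namespace Realization

variable [Fintype W] {ρ : Representation ℂ W V} {k : W → ℂ} {A : Type*} [Ring A] [Algebra ℂ A]
  (r : Realization ρ k A)

theorem conj_X (g : W) (a : Module.Dual ℂ V) : r.T g * r.X a * r.T g⁻¹ = r.X (ρ.dual g a) := by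
  rw [r.T_mul_X, mul_assoc, map_mul_map_inv, mul_one]

theorem conj_Y (g : W) (b : V) : r.T g * r.Y b * r.T g⁻¹ = r.Y (ρ g b) := by
  rw [r.T_mul_Y, mul_assoc, map_mul_map_inv, mul_one]

theorem X_mul_T (g : W) (a : Module.Dual ℂ V) : r.X a * r.T g = r.T g * r.X (ρ.dual g⁻¹ a) := by
  rw [r.T_mul_X, Representation.self_inv_apply]

theorem Y_mul_T (g : W) (b : V) : r.Y b * r.T g = r.T g * r.Y (ρ g⁻¹ b) := by
  rw [r.T_mul_Y, Representation.self_inv_apply]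

theorem Y_X_mem_span (b : V) (a : Module.Dual ℂ V) :
    r.Y b * r.X a - r.X a * r.Y b ∈ Submodule.span ℂ (Set.range r.T) := by
  rw [r.Y_X, Algebra.algebraMap_eq_smul_one]
  exact sub_mem (Submodule.smul_mem _ _ (one_mem_span_range r.T))
    (sum_mem fun g _ => Submodule.smul_mem _ _ (Submodule.subset_span ⟨g, rfl⟩))

theorem triangular : Triangular r.T (LinearMap.range r.X) (LinearMap.range r.Y) where
  conj_left := by
    rintro g _ ⟨a, rfl⟩
    exact ⟨_, (r.conj_X g a).symm⟩
  conj_right := by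
    rintro g _ ⟨a, rfl⟩
    exact ⟨_, (r.conj_Y g a).symm⟩
  commutator := by
    rintro _ ⟨b, rfl⟩ _ ⟨a, rfl⟩
    exact r.Y_X_mem_span b a
  comm_left := by
    rintro _ ⟨a, rfl⟩ _ ⟨b, rfl⟩
    exact r.X_comm a b
  comm_right := by
    rintro _ ⟨a, rfl⟩ _ ⟨b, rfl⟩
    exact r.Y_comm a b

theorem triangular_swap : Triangular r.T (LinearMap.range r.Y) (LinearMap.range r.X) where
  conj_left := r.triangular.conj_right
  conj_right := r.triangular.conj_left
  commutator := by
    rintro _ ⟨a, rfl⟩ _ ⟨b, rfl⟩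
    rw [← neg_sub]
    exact neg_mem (r.Y_X_mem_span b a)
  comm_left := r.triangular.comm_right
  comm_right := r.triangular.comm_left

/-- The Euler element, whose commutator with `X` and `Y` has weights `1` and `-1`. -/
def euler [FiniteDimensional ℂ V] : A :=
  ∑ i, r.Y (Module.finBasis ℂ V i) * r.X ((Module.finBasis ℂ V).coord i) + ∑ g, k g • r.T g

theorem euler_Y [FiniteDimensional ℂ V] (b : V) :
    r.euler * r.Y b - r.Y b * r.euler = (-1 : ℂ) • r.Y b := by
  set B := Module.finBasis ℂ V
  have hexpand : ∀ v : V, ∑ i, B.coord i v • r.Y (B i) = r.Y v := fun v => by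
    simp only [← map_smul, ← map_sum, Module.Basis.coord_apply, B.sum_repr]
  have hYX : ∀ i, r.Y (B i) * r.X (B.coord i) * r.Y b - r.Y b * (r.Y (B i) * r.X (B.coord i)) =
      -(B.coord i b • r.Y (B i)) +
        ∑ g, k g • (B.coord i (b - ρ g b) • r.Y (B i) * r.T g) := fun i => calc
    _ = -(r.Y (B i) * (r.Y b * r.X (B.coord i) - r.X (B.coord i) * r.Y b)) := by
      rw [← mul_assoc, r.Y_comm b (B i)]
      noncomm_ring
    _ = _ := by
      rw [r.Y_X, mul_sub, neg_sub, sub_eq_neg_add, Finset.mul_sum, ← Algebra.commutes,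
        ← Algebra.smul_def]
      simp only [mul_smul_comm, mul_smul, smul_mul_assoc]
  have hT : ∀ g, k g • r.T g * r.Y b - r.Y b * k g • r.T g =
      -(k g • (r.Y (b - ρ g b) * r.T g)) := fun g => by
    rw [smul_mul_assoc, mul_smul_comm, r.T_mul_Y, map_sub, sub_mul, smul_sub, neg_sub]
  rw [euler, add_mul, mul_add, Finset.sum_mul, Finset.mul_sum, Finset.sum_mul, Finset.mul_sum,
    add_sub_add_comm, ← Finset.sum_sub_distrib, ← Finset.sum_sub_distrib,
    Finset.sum_congr rfl fun i _ => hYX i, Finset.sum_congr rfl fun g _ => hT g,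
    Finset.sum_add_distrib, Finset.sum_neg_distrib, hexpand, Finset.sum_comm]
  simp only [← Finset.smul_sum, ← Finset.sum_mul, hexpand, Finset.sum_neg_distrib,
    add_neg_cancel_right, neg_smul, one_smul]

theorem euler_X [FiniteDimensional ℂ V] (a : Module.Dual ℂ V) :
    r.euler * r.X a - r.X a * r.euler = (1 : ℂ) • r.X a := by
  set B := Module.finBasis ℂ V
  have hexpand : ∀ a : Module.Dual ℂ V, ∑ i, a (B i) • r.X (B.coord i) = r.X a := fun a => by
    simp only [← map_smul, ← map_sum, B.sum_dual_apply_smul_coord]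
  have hYX : ∀ i, r.Y (B i) * r.X (B.coord i) * r.X a - r.X a * (r.Y (B i) * r.X (B.coord i)) =
      a (B i) • r.X (B.coord i) -
        ∑ g, k g • (r.T g * (a - ρ.dual g⁻¹ a) (B i) • r.X (B.coord i)) := fun i => calc
    _ = (r.Y (B i) * r.X a - r.X a * r.Y (B i)) * r.X (B.coord i) := by
      rw [mul_assoc, r.X_comm (B.coord i) a]
      noncomm_ring
    _ = _ := by
      rw [r.Y_X, sub_mul, Finset.sum_mul, ← Algebra.smul_def]
      simp [mul_smul, Representation.dual_apply, Module.Dual.transpose_apply]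
  have hT : ∀ g, k g • r.T g * r.X a - r.X a * k g • r.T g =
      k g • (r.T g * r.X (a - ρ.dual g⁻¹ a)) := fun g => by
    rw [smul_mul_assoc, mul_smul_comm, map_sub, mul_sub, r.X_mul_T, smul_sub]
  rw [euler, add_mul, mul_add, Finset.sum_mul, Finset.mul_sum, Finset.sum_mul, Finset.mul_sum,
    add_sub_add_comm, ← Finset.sum_sub_distrib, ← Finset.sum_sub_distrib,
    Finset.sum_congr rfl fun i _ => hYX i, Finset.sum_congr rfl fun g _ => hT g,
    Finset.sum_sub_distrib, hexpand, Finset.sum_comm]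
  simp only [← Finset.smul_sum, ← Finset.mul_sum, hexpand, sub_add_cancel, one_smul]

variable {r}

theorem Generates.one_notMem_span_Y [FiniteDimensional ℂ V] [Nontrivial A] (hr : r.Generates) :
    (1 : A) ∉ Ideal.span (Set.range r.Y) := by
  refine r.triangular.one_notMem_span hr (E := r.euler) (neg_ne_zero.mpr one_ne_zero) ?_
  rintro _ ⟨b, rfl⟩
  exact r.euler_Y b

theorem Generates.one_notMem_span_X [FiniteDimensional ℂ V] [Nontrivial A] (hr : r.Generates) :
    (1 : A) ∉ Ideal.span (Set.range r.X) := by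
  rw [Generates, Set.union_comm (Set.range r.X)] at hr
  refine r.triangular_swap.one_notMem_span hr (E := r.euler) one_ne_zero ?_
  rintro _ ⟨a, rfl⟩
  exact r.euler_X a

end Realization

/-! ### Asphericity and the spherical ideal -/

section CategoryO

variable [Fintype W] {ρ : Representation ℂ W V} (c : Parameter ρ)

/-- The left ideal `H_c e_W H_c + H_c 𝔥`. The quotient of `H_c` by it is the largest aspherical
module generated by a vector killed by `𝔥`. -/
def lowestWeightIdeal : Ideal (H ρ c) :=
  sphericalTwoSidedIdeal ρ c ⊔ Ideal.span (Set.range (universalRealization c).Y)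

theorem range_Y_subset_lowestWeightIdeal :
    Set.range (universalRealization c).Y ⊆ lowestWeightIdeal c :=
  Ideal.subset_span.trans (SetLike.coe_subset_coe.mpr le_sup_right)

theorem inCatO_quotient_lowestWeightIdeal : InCatO ρ c (H ρ c ⧸ lowestWeightIdeal c) :=
  ⟨(universalRealization c).triangular.finite_quotient (universalRealization_generates c)
      (range_Y_subset_lowestWeightIdeal c),
    fun b m => (universalRealization c).triangular.exists_pow_smul_eq_zero
      (universalRealization_generates c) (range_Y_subset_lowestWeightIdeal c) m ⟨b, rfl⟩⟩

variable {c}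

theorem lowestWeightIdeal_ne_top [FiniteDimensional ℂ V] (h : sphericalIdeal ρ c ≠ ⊤) :
    lowestWeightIdeal c ≠ ⊤ := by
  intro htop
  have := nontrivial_quotient_sphericalTwoSidedIdeal h
  let π := Ideal.Quotient.mk (sphericalTwoSidedIdeal ρ c)
  have hπ : Ideal.map π (Ideal.span (Set.range (universalRealization c).Y)) =
      Ideal.span (Set.range (quotientRealization c).Y) := by
    rw [Ideal.map_span, ← Set.range_comp]
    rfl
  have hmap : Ideal.map π (lowestWeightIdeal c) =
      Ideal.span (Set.range (quotientRealization c).Y) := by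
    rw [lowestWeightIdeal, Ideal.map_sup, Ideal.map_quotient_self, bot_sup_eq, hπ]
  refine (quotientRealization_generates c).one_notMem_span_Y ?_
  rw [← hmap, htop, Ideal.map_top]
  exact Submodule.mem_top

theorem isAspherical_quotient_lowestWeightIdeal [FiniteDimensional ℂ V]
    (h : sphericalIdeal ρ c ≠ ⊤) : IsAspherical ρ c (H ρ c ⧸ lowestWeightIdeal c) := by
  refine ⟨Submodule.Quotient.nontrivial_iff.mpr (lowestWeightIdeal_ne_top h), fun m => ?_⟩
  obtain ⟨x, rfl⟩ := Submodule.Quotient.mk_surjective _ m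
  rw [← Submodule.Quotient.mk_smul, Submodule.Quotient.mk_eq_zero]
  exact Submodule.mem_sup_left
    (Ideal.mul_mem_right x (sphericalTwoSidedIdeal ρ c) idem_mem_sphericalTwoSidedIdeal)

end CategoryO

section AsphericalSet

variable [Finite W] [FiniteDimensional ℂ V] {ρ : Representation ℂ W V}

theorem mem_asphericalSet_iff_sphericalIdeal_ne_top {c : Parameter ρ} :
    c ∈ asphericalSet ρ ↔ sphericalIdeal ρ c ≠ ⊤ := by
  constructor
  · rintro ⟨M, _, _, _, hM⟩
    exact sphericalIdeal_ne_top_of_isAspherical hM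
  · intro h
    have := Fintype.ofFinite W
    exact ⟨_, inferInstance, inferInstance, inCatO_quotient_lowestWeightIdeal c,
      isAspherical_quotient_lowestWeightIdeal h⟩

theorem fdaSet_subset_asphericalSet : fdaSet ρ ⊆ asphericalSet ρ := by
  rintro c ⟨M, _, _, _, _, _, hM⟩
  exact mem_asphericalSet_iff_sphericalIdeal_ne_top.mpr (sphericalIdeal_ne_top_of_isAspherical hM)

end AsphericalSet

/-! ### The rank two identity -/

section ProportionalCoroots

variable [Finite W] (ρ : Representation ℂ W V)

theorem apply_ne_zero_of_sub_apply_eq_smul {s : W} {α : Module.Dual ℂ V} {β : V}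
    (hs : ∀ v, v - ρ s v = α v • β) (hα : α ≠ 0) (hβ : β ≠ 0) : α β ≠ 0 := by
  intro h
  obtain ⟨v, hv⟩ := DFunLike.ne_iff.mp hα
  have hfix : ρ s ((-α v) • β) = (-α v) • β := by
    rw [map_smul, ← sub_eq_zero.mp ((hs β).trans (by rw [h, zero_smul]))]
  have hzero := eq_zero_of_fixed ρ s (v := v) (by rw [neg_smul, ← hs, neg_sub]) hfix
  exact (smul_ne_zero (neg_ne_zero.mpr hv) hβ) hzero

omit [Finite W] in
theorem apply_mul_mul_inv_of_eigenvector {s t : W} {β : V} (hβ : β ≠ 0) {x y : ℂ}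
    (hs : ρ s β = x • β) (ht : ρ t β = y • β) : ρ (s * t * (t * s)⁻¹) β = β := by
  have hst : ρ (s * t) β = (x * y) • β := by
    rw [map_mul, Module.End.mul_apply, ht, map_smul, hs, smul_smul, mul_comm]
  have hts : ρ (t * s) β = (x * y) • β := by
    rw [map_mul, Module.End.mul_apply, hs, map_smul, ht, smul_smul]
  have hxy : x * y ≠ 0 := by
    intro h
    rw [h, zero_smul, ← map_zero (ρ (t * s))] at hts
    exact hβ ((ρ.apply_bijective _).injective hts)
  have hinv : ρ (t * s)⁻¹ β = (x * y)⁻¹ • β := by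
    rw [ρ.inv_apply_eq_iff, map_smul, hts, smul_smul, inv_mul_cancel₀ hxy, one_smul]
  rw [map_mul, Module.End.mul_apply, hinv, map_smul, hst, smul_smul, inv_mul_cancel₀ hxy, one_smul]

/-- If `α u = 0` and `α' u ≠ 0`, then the commutator of `s` and `t` would be unipotent of
infinite order. -/
theorem root_ker_le_of_coroot_eq_smul {s t : W} {α α' : Module.Dual ℂ V} {β β' : V}
    (hs : ∀ v, v - ρ s v = α v • β) (ht : ∀ v, v - ρ t v = α' v • β') (hα : α ≠ 0)
    (hβ' : β' ≠ 0) {c : ℂ} (hc : β' = c • β) {u : V} (hu : α u = 0) : α' u = 0 := by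
  have hc0 : c ≠ 0 := by rintro rfl; exact hβ' (by rw [hc, zero_smul])
  have hβ : β ≠ 0 := by rintro rfl; exact hβ' (by rw [hc, smul_zero])
  have hs' : ∀ v, ρ s v = v - α v • β := fun v => by rw [← hs, sub_sub_cancel]
  have ht' : ∀ v, ρ t v = v - (α' v * c) • β := fun v => by
    rw [mul_smul, ← hc, ← ht, sub_sub_cancel]
  have hβfix : ρ (s * t * (t * s)⁻¹) β = β :=
    apply_mul_mul_inv_of_eigenvector ρ hβ (x := 1 - α β) (y := 1 - α' β * c)
      (by rw [hs', sub_smul, one_smul]) (by rw [ht', sub_smul, one_smul])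
  have hunip : ρ (s * t * (t * s)⁻¹) (ρ (t * s) u) - ρ (t * s) u = (α' u * c * α β) • β := by
    rw [← Module.End.mul_apply, ← map_mul, inv_mul_cancel_right, map_mul, map_mul,
      Module.End.mul_apply, Module.End.mul_apply, ht', hs' u, hu, zero_smul, sub_zero, ht',
      map_sub, map_smul, hs' u, hu, hs']
    module
  have hzero := eq_zero_of_fixed ρ _ hunip (by rw [map_smul, hβfix])
  simpa [hβ, hc0, apply_ne_zero_of_sub_apply_eq_smul ρ hs hα hβ] using hzero

end ProportionalCoroots

theorem eq_smul_of_ker_le {α α' : Module.Dual ℂ V} (h : ∀ u, α u = 0 → α' u = 0) {b : V}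
    (hb : α b ≠ 0) : α' = (α' b / α b) • α := by
  ext v
  have hv := h (v - (α v / α b) • b) (by
    rw [map_sub, map_smul, smul_eq_mul, div_mul_cancel₀ _ hb, sub_self])
  rw [map_sub, map_smul, smul_eq_mul, sub_eq_zero] at hv
  rw [hv, LinearMap.smul_apply, smul_eq_mul, div_mul_comm, div_mul_comm, mul_comm]

theorem exists_dual_of_notMem_span {x y : V} (h : y ∉ Submodule.span ℂ {x}) :
    ∃ f : Module.Dual ℂ V, f x = 0 ∧ f y = 1 := by
  obtain ⟨f, hf, hle⟩ := Submodule.exists_le_ker_of_notMem h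
  have hx : f x = 0 := hle (Submodule.mem_span_singleton_self x)
  exact ⟨(f y)⁻¹ • f, by simp [hx], by simp [inv_mul_cancel₀ hf]⟩

namespace Coupling

variable {ρ : Representation ℂ W V} (κ : Coupling ρ)

theorem apply_eq {g : W} (hg : κ.k g ≠ 0) (v : V) : ρ g v = v - κ.α g v • κ.β g := by
  rw [← κ.sub_apply g hg, sub_sub_cancel]

theorem α_apply_ne_zero {g : W} (hg : κ.k g ≠ 0) {b : V} (hb : ρ g b ≠ b) : κ.α g b ≠ 0 :=
  fun h => hb (by rw [κ.apply_eq hg, h, zero_smul, sub_zero])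

theorem β_ne_zero {g : W} (hg : κ.k g ≠ 0) {b : V} (hb : ρ g b ≠ b) : κ.β g ≠ 0 :=
  fun h => hb (by rw [κ.apply_eq hg, h, smul_zero, sub_zero])

theorem sub_apply_mul {s t : W} (hs : κ.k s ≠ 0) (ht : κ.k t ≠ 0) (v : V) :
    v - ρ (s * t) v = κ.α t v • κ.β t + (κ.α s v - κ.α t v * κ.α s (κ.β t)) • κ.β s := by
  rw [map_mul, Module.End.mul_apply, κ.apply_eq hs, κ.apply_eq ht, map_sub, map_smul, smul_eq_mul]
  abel

/-- Applying functionals dual to the coroots of `s` and `t` to `1 - s t = 1 - s₀ t₀` expresses the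
roots of `s` and `t` through those of `s₀` and `t₀`. -/
theorem α_mem_span_pair_of_mul_eq_mul {s t s₀ t₀ : W} (h : s * t = s₀ * t₀) (hs : κ.k s ≠ 0)
    (ht : κ.k t ≠ 0) (hs₀ : κ.k s₀ ≠ 0) (ht₀ : κ.k t₀ ≠ 0) {f f' : Module.Dual ℂ V}
    (hfs : f (κ.β s) = 0) (hft : f (κ.β t) = 1) (hfs' : f' (κ.β s) = 1) (hft' : f' (κ.β t) = 0) :
    κ.α s ∈ Submodule.span ℂ {κ.α s₀, κ.α t₀} ∧ κ.α t ∈ Submodule.span ℂ {κ.α s₀, κ.α t₀} := by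
  have hprod : ∀ v, κ.α t v • κ.β t + (κ.α s v - κ.α t v * κ.α s (κ.β t)) • κ.β s =
      κ.α t₀ v • κ.β t₀ + (κ.α s₀ v - κ.α t₀ v * κ.α s₀ (κ.β t₀)) • κ.β s₀ := fun v => by
    rw [← κ.sub_apply_mul hs ht, h, κ.sub_apply_mul hs₀ ht₀]
  have hα₀ : ∀ φ : Module.Dual ℂ V, φ (κ.β t₀) • κ.α t₀ +
      φ (κ.β s₀) • (κ.α s₀ - κ.α s₀ (κ.β t₀) • κ.α t₀) ∈ Submodule.span ℂ {κ.α s₀, κ.α t₀} := by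
    intro φ
    have hs₀ : κ.α s₀ ∈ Submodule.span ℂ {κ.α s₀, κ.α t₀} :=
      Submodule.subset_span (Set.mem_insert _ _)
    have ht₀ : κ.α t₀ ∈ Submodule.span ℂ {κ.α s₀, κ.α t₀} :=
      Submodule.subset_span (Set.mem_insert_of_mem _ rfl)
    exact add_mem (Submodule.smul_mem _ _ ht₀)
      (Submodule.smul_mem _ _ (sub_mem hs₀ (Submodule.smul_mem _ _ ht₀)))
  have hα : ∀ φ : Module.Dual ℂ V, φ (κ.β t) • κ.α t +
      φ (κ.β s) • (κ.α s - κ.α s (κ.β t) • κ.α t) ∈ Submodule.span ℂ {κ.α s₀, κ.α t₀} := by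
    intro φ
    convert hα₀ φ using 1
    ext v
    have hφ := congrArg φ (hprod v)
    simp only [map_add, map_smul, smul_eq_mul, LinearMap.add_apply, LinearMap.sub_apply,
      LinearMap.smul_apply] at hφ ⊢
    linear_combination hφ
  have hαt := hα f
  have hαs := hα f'
  rw [hfs, hft, zero_smul, add_zero, one_smul] at hαt
  rw [hfs', hft', zero_smul, zero_add, one_smul] at hαs
  exact ⟨sub_add_cancel (κ.α s) _ ▸ add_mem hαs (Submodule.smul_mem _ _ hαt), hαt⟩

theorem ker_le_or_mem_span_pair_of_mul_eq_mul [Finite W] {s t s₀ t₀ : W} (h : s * t = s₀ * t₀)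
    (hs : κ.k s ≠ 0) (ht : κ.k t ≠ 0) (hs₀ : κ.k s₀ ≠ 0) (ht₀ : κ.k t₀ ≠ 0) {b : V}
    (hsb : ρ s b ≠ b) (htb : ρ t b ≠ b) :
    (∀ u, κ.α s u = 0 → κ.α t u = 0) ∨
      κ.α s ∈ Submodule.span ℂ {κ.α s₀, κ.α t₀} ∧ κ.α t ∈ Submodule.span ℂ {κ.α s₀, κ.α t₀} := by
  have hα : κ.α s ≠ 0 := fun h0 => κ.α_apply_ne_zero hs hsb (by rw [h0, LinearMap.zero_apply])
  have hβs := κ.β_ne_zero hs hsb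
  have hβt := κ.β_ne_zero ht htb
  by_cases hmem : κ.β t ∈ Submodule.span ℂ {κ.β s}
  · obtain ⟨c, hc⟩ := Submodule.mem_span_singleton.mp hmem
    exact .inl fun u hu => root_ker_le_of_coroot_eq_smul ρ (κ.sub_apply s hs) (κ.sub_apply t ht)
      hα hβt hc.symm hu
  · have hmem' : κ.β s ∉ Submodule.span ℂ {κ.β t} := by
      intro hst
      obtain ⟨c, hc⟩ := Submodule.mem_span_singleton.mp hst
      have hc0 : c ≠ 0 := by rintro rfl; exact hβs (by rw [← hc, zero_smul])
      exact hmem (Submodule.mem_span_singleton.mpr ⟨c⁻¹, by rw [← hc, inv_smul_smul₀ hc0]⟩)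
    obtain ⟨f, hfs, hft⟩ := exists_dual_of_notMem_span hmem
    obtain ⟨f', hft', hfs'⟩ := exists_dual_of_notMem_span hmem'
    exact .inr (κ.α_mem_span_pair_of_mul_eq_mul h hs ht hs₀ ht₀ hfs hft hfs' hft')

/-- The bivector `α_s ∧ α_t`, as a bilinear form on `𝔥`. The commutativity of Dunkl operators
reduces to identities between the functions `α_s ∧ α_t / (α_s α_t)`. -/
def wedge (s t : W) (v v' : V) : ℂ := κ.α s v * κ.α t v' - κ.α s v' * κ.α t v

section

variable {R : Type*} [CommRing R] [Algebra ℂ R] (X : Module.Dual ℂ V →ₗ[ℂ] R) {ω : W → R} {b : V}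

/-- For linearly independent roots this is the Plücker relation for three vectors in a plane. -/
theorem wedge_plucker [Finite W] {s t s₀ t₀ : W} (h : s * t = s₀ * t₀) (hs : κ.k s ≠ 0)
    (ht : κ.k t ≠ 0) (hs₀ : κ.k s₀ ≠ 0) (ht₀ : κ.k t₀ ≠ 0) (hsb : ρ s b ≠ b) (htb : ρ t b ≠ b)
    (v v' : V) :
    κ.wedge s t v v' • X (κ.α s₀) - κ.wedge s₀ t v v' • X (κ.α s) +
      κ.wedge s₀ s v v' • X (κ.α t) = 0 := by
  rw [← map_smul, ← map_smul, ← map_smul, ← map_sub, ← map_add]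
  convert map_zero X
  ext u
  rcases κ.ker_le_or_mem_span_pair_of_mul_eq_mul h hs ht hs₀ ht₀ hsb htb with hker | ⟨hαs, hαt⟩
  · have hαt := eq_smul_of_ker_le hker (κ.α_apply_ne_zero hs hsb)
    generalize κ.α t b / κ.α s b = c at hαt
    simp only [wedge, hαt, LinearMap.add_apply, LinearMap.sub_apply, LinearMap.smul_apply,
      smul_eq_mul, LinearMap.zero_apply]
    ring
  · obtain ⟨p, q, hαs⟩ := Submodule.mem_span_pair.mp hαs
    obtain ⟨p', q', hαt⟩ := Submodule.mem_span_pair.mp hαt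
    simp only [wedge, ← hαs, ← hαt, LinearMap.add_apply, LinearMap.sub_apply,
      LinearMap.smul_apply, smul_eq_mul, LinearMap.zero_apply]
    ring

theorem wedge_cocycle [Finite W] (hω : ∀ s, κ.k s ≠ 0 → ρ s b ≠ b → X (κ.α s) * ω s = 1)
    {s t s₀ t₀ : W} (h : s * t = s₀ * t₀) (hs : κ.k s ≠ 0) (ht : κ.k t ≠ 0) (hs₀ : κ.k s₀ ≠ 0)
    (ht₀ : κ.k t₀ ≠ 0) (hsb : ρ s b ≠ b) (htb : ρ t b ≠ b) (hsb₀ : ρ s₀ b ≠ b) (v v' : V) :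
    κ.wedge s t v v' • (ω s * ω t) =
      κ.wedge s₀ t v v' • (ω s₀ * ω t) - κ.wedge s₀ s v v' • (ω s₀ * ω s) := by
  have hplucker := κ.wedge_plucker X h hs ht hs₀ ht₀ hsb htb v v'
  simp only [Algebra.smul_def] at hplucker ⊢
  linear_combination (ω s₀ * ω s * ω t) * hplucker -
    algebraMap ℂ R (κ.wedge s t v v') * ω s * ω t * hω s₀ hs₀ hsb₀ +
    algebraMap ℂ R (κ.wedge s₀ t v v') * ω s₀ * ω t * hω s hs hsb -
    algebraMap ℂ R (κ.wedge s₀ s v v') * ω s₀ * ω s * hω t ht htb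

end

end Coupling

theorem commute_ringInverse_right {E : Type*} [Ring E] {x y : E}
    (h : Commute x y) : Commute x (Ring.inverse y) := by
  by_cases hy : IsUnit y
  · obtain ⟨u, rfl⟩ := hy
    rw [Ring.inverse_unit]
    exact h.units_inv_right
  · rw [Ring.inverse_non_unit _ hy]
    exact Commute.zero_right x

theorem inv_mul_apply_eq_iff {ρ : Representation ℂ W V} {b : V} {s g : W} (hg : ρ g b = b) :
    ρ (s⁻¹ * g) b = b ↔ ρ s b = b := by
  rw [map_mul, Module.End.mul_apply, hg, ρ.inv_apply_eq_iff, eq_comm]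

open Classical in
theorem sum_mul_left_of_apply_ne [Fintype W] {M : Type*} [AddCommMonoid M]
    {ρ : Representation ℂ W V} {b : V} {s : W} (hs : ρ s b ≠ b) (F : W → M)
    (hF : ∀ g, ρ g b ≠ b → F g = 0) :
    ∑ t with ρ t b ≠ b, F (s * t) = ∑ g with ρ g b = b, F g := by
  have hreindex : ∑ t with ρ t b ≠ b, F (s * t) = ∑ g with ρ (s⁻¹ * g) b ≠ b, F g :=
    Finset.sum_equiv (Equiv.mulLeft s) (fun t => by simp) fun t _ => rfl
  rw [hreindex]
  refine (Finset.sum_subset (fun g hg => ?_) fun g _ hg => hF g ?_).symm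
  · rw [Finset.mem_filter_univ] at hg ⊢
    rwa [Ne, inv_mul_apply_eq_iff hg]
  · rwa [Finset.mem_filter_univ] at hg

namespace Coupling

variable [Fintype W] {ρ : Representation ℂ W V} (κ : Coupling ρ) {b : V} {q : W → ℂ} {g : W}

open Classical in
/-- Fixing one factorization `g = s₀ t₀`, the cocycle identity writes the summand of `s` as
`F (s⁻¹ g) - F s` up to the weight `q s * q (s⁻¹ g)`, which is invariant under `s ↦ s⁻¹ g`. -/
theorem sum_wedge_eq_zero {R : Type*} [CommRing R] [Algebra ℂ R] (X : Module.Dual ℂ V →ₗ[ℂ] R)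
    {ω : W → R} (hω : ∀ s, κ.k s ≠ 0 → ρ s b ≠ b → X (κ.α s) * ω s = 1)
    (hq_conj : ∀ h g, q (h * g * h⁻¹) = q g) (hq : ∀ g, q g ≠ 0 → κ.k g ≠ 0) (hg : ρ g b = b)
    (v v' : V) :
    ∑ s with ρ s b ≠ b,
      (q s * q (s⁻¹ * g) * κ.wedge s (s⁻¹ * g) v v') • (ω s * ω (s⁻¹ * g)) = 0 := by
  by_contra hsum
  obtain ⟨s₀, hs₀, hne⟩ := Finset.exists_ne_zero_of_sum_ne_zero hsum
  have hq₀ := left_ne_zero_of_mul (left_ne_zero_of_smul hne)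
  let F : W → R := fun s => κ.wedge s₀ s v v' • (ω s₀ * ω s)
  have hterm : ∀ s ∈ Finset.univ.filter (ρ · b ≠ b),
      (q s * q (s⁻¹ * g) * κ.wedge s (s⁻¹ * g) v v') • (ω s * ω (s⁻¹ * g)) =
        (q s * q (s⁻¹ * g)) • F (s⁻¹ * g) - (q s * q (s⁻¹ * g)) • F s := by
    intro s hs
    rw [Finset.mem_filter_univ] at hs hs₀
    by_cases hqs : q s * q (s⁻¹ * g) = 0
    · simp only [hqs, zero_mul, zero_smul, sub_zero]
    · rw [mul_smul, ← smul_sub, κ.wedge_cocycle X hω (s₀ := s₀) (t₀ := s₀⁻¹ * g)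
        (by rw [mul_inv_cancel_left, mul_inv_cancel_left]) (hq _ (left_ne_zero_of_mul hqs))
        (hq _ (right_ne_zero_of_mul hqs)) (hq _ (left_ne_zero_of_mul hq₀))
        (hq _ (right_ne_zero_of_mul hq₀)) hs (by rwa [Ne, inv_mul_apply_eq_iff hg]) hs₀]
  have hinvol : ∀ s, (s⁻¹ * g)⁻¹ * g = g⁻¹ * s * g⁻¹⁻¹ := fun s => by group
  refine hsum ?_
  rw [Finset.sum_congr rfl hterm, Finset.sum_sub_distrib, sub_eq_zero]
  refine Finset.sum_equiv ((Equiv.inv W).trans (Equiv.mulRight g)) (fun s => ?_) fun s _ => ?_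
  · rw [Finset.mem_filter_univ, Finset.mem_filter_univ]
    exact (inv_mul_apply_eq_iff hg).not.symm
  · change (q s * q (s⁻¹ * g)) • F (s⁻¹ * g) =
      (q (s⁻¹ * g) * q ((s⁻¹ * g)⁻¹ * g)) • F (s⁻¹ * g)
    rw [hinvol, hq_conj, mul_comm]

open scoped IsMulCommutative in
open Classical in
theorem sum_wedge_ringInverse_eq_zero {E : Type*} [Ring E] [Algebra ℂ E]
    (X : Module.Dual ℂ V →ₗ[ℂ] E) (hX : ∀ a a', Commute (X a) (X a'))
    (hunit : ∀ s, κ.k s ≠ 0 → ρ s b ≠ b → IsUnit (X (κ.α s)))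
    (hq_conj : ∀ h g, q (h * g * h⁻¹) = q g) (hq : ∀ g, q g ≠ 0 → κ.k g ≠ 0) (hg : ρ g b = b)
    (v v' : V) :
    ∑ s with ρ s b ≠ b, (q s * q (s⁻¹ * g) * κ.wedge s (s⁻¹ * g) v v') •
        (Ring.inverse (X (κ.α s)) * Ring.inverse (X (κ.α (s⁻¹ * g)))) = 0 := by
  let S : Set E := Set.range X ∪ Set.range fun s => Ring.inverse (X (κ.α s))
  have hcomm : ∀ x ∈ S, ∀ y ∈ S, x * y = y * x := by
    rintro _ (⟨a, rfl⟩ | ⟨s, rfl⟩) _ (⟨a', rfl⟩ | ⟨s', rfl⟩)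
    · exact hX a a'
    · exact commute_ringInverse_right (hX _ _)
    · exact (commute_ringInverse_right (hX _ _)).symm
    · exact (hX _ _).ringInverse_ringInverse
  have := Algebra.isMulCommutative_adjoin ℂ hcomm
  let R := Algebra.adjoin ℂ S
  let X' : Module.Dual ℂ V →ₗ[ℂ] R := X.codRestrict R.toSubmodule fun a =>
    Algebra.subset_adjoin (Or.inl ⟨a, rfl⟩)
  let ω : W → R := fun s => ⟨Ring.inverse (X (κ.α s)), Algebra.subset_adjoin (Or.inr ⟨s, rfl⟩)⟩
  have hω : ∀ s, κ.k s ≠ 0 → ρ s b ≠ b → X' (κ.α s) * ω s = 1 := fun s hs hb =>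
    Subtype.ext (Ring.mul_inverse_cancel _ (hunit s hs hb))
  have hsum := congrArg R.val (κ.sum_wedge_eq_zero X' hω hq_conj hq hg v v')
  simp only [map_sum, map_smul, map_mul, map_zero] at hsum
  exact hsum

end Coupling

/-! ### Generalized weight spaces -/

theorem isUnit_of_forall_mem_maxGenEigenspace {N : Type*} [AddCommGroup N] [Module ℂ N]
    {f : Module.End ℂ N} {μ : ℂ} (hμ : μ ≠ 0) (h : ∀ m, m ∈ f.maxGenEigenspace μ) : IsUnit f := by
  have hcomm : Commute (f - μ • 1) (-μ • (1 : Module.End ℂ N)) :=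
    (Commute.one_right _).smul_right _
  have hsub : f - μ • 1 - -μ • 1 = f := by module
  rw [Module.End.isUnit_iff]
  refine ⟨?_, fun m => ?_⟩
  · rw [← LinearMap.ker_eq_bot, ← Module.End.eigenspace_zero, eq_bot_iff]
    intro m hm
    exact Submodule.disjoint_def.mp (f.disjoint_genEigenspace hμ.symm 1 ⊤) m hm (h m)
  · obtain ⟨n, hn⟩ := (Module.End.mem_maxGenEigenspace f μ m).mp (h m)
    obtain ⟨p, hp⟩ := hcomm.sub_dvd_pow_sub_pow n
    rw [hsub, smul_pow, one_pow] at hp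
    refine ⟨-((-μ) ^ n)⁻¹ • p m, ?_⟩
    rw [map_smul, ← Module.End.mul_apply, ← hp, LinearMap.sub_apply, hn, zero_sub, neg_smul,
      smul_neg, neg_neg, LinearMap.smul_apply, Module.End.one_apply, smul_smul,
      inv_mul_cancel₀ (pow_ne_zero _ (neg_ne_zero.mpr hμ)), one_smul]

namespace Realization

variable [Fintype W] {ρ : Representation ℂ W V} {k : W → ℂ} {L : Type*} [AddCommGroup L]
  [Module ℂ L] (r : Realization ρ k (Module.End ℂ L))

/-- The generalized weight space at `u` for the action of `𝔥* ⊆ ℂ[𝔥]`: the vectors supported at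
the point `u` of `𝔥`. -/
def weightSpace (u : V) : Submodule ℂ L := ⨅ a : Module.Dual ℂ V, (r.X a).maxGenEigenspace (a u)

theorem mem_weightSpace {u : V} {m : L} :
    m ∈ r.weightSpace u ↔ ∀ a : Module.Dual ℂ V, ∃ n : ℕ, ((r.X a - a u • 1) ^ n) m = 0 := by
  simp only [weightSpace, Submodule.mem_iInf, Module.End.mem_maxGenEigenspace]

theorem X_mem_weightSpace {u : V} {m : L} (hm : m ∈ r.weightSpace u) (a : Module.Dual ℂ V) :
    r.X a m ∈ r.weightSpace u :=
  (Submodule.mem_iInf _).mpr fun a' => Module.End.mapsTo_maxGenEigenspace_of_comm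
    (r.X_comm a' a) _ ((Submodule.mem_iInf _).mp hm a')

theorem T_mem_weightSpace {u : V} {m : L} (hm : m ∈ r.weightSpace u) (g : W) :
    r.T g m ∈ r.weightSpace (ρ g u) := by
  rw [mem_weightSpace] at hm ⊢
  intro a
  obtain ⟨n, hn⟩ := hm (ρ.dual g⁻¹ a)
  have hconj : SemiconjBy (r.T g) (r.X (ρ.dual g⁻¹ a) - (ρ.dual g⁻¹ a) u • 1)
      (r.X a - a (ρ g u) • 1) := by
    rw [SemiconjBy, sub_mul, mul_sub, r.X_mul_T, smul_one_mul, mul_smul_one]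
    simp [Representation.dual_apply, Module.Dual.transpose_apply]
  refine ⟨n, ?_⟩
  rw [← Module.End.mul_apply, ← (hconj.pow_right n).eq, Module.End.mul_apply, hn, map_zero]

theorem iSupIndep_weightSpace : iSupIndep r.weightSpace := by
  have h := Module.End.independent_iInf_maxGenEigenspace_of_forall_mapsTo (fun a => r.X a)
    (fun a a' φ => Module.End.mapsTo_maxGenEigenspace_of_comm (r.X_comm a' a) φ)
  refine h.comp (f := fun u (a : Module.Dual ℂ V) => a u) fun u u' huu => ?_
  rw [← sub_eq_zero, ← Module.forall_dual_apply_eq_zero_iff ℂ]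
  exact fun a => by rw [map_sub, sub_eq_zero]; exact congrFun huu a

/-- The action of `𝔥*` on a generalized weight space. -/
def weightX (b : V) : Module.Dual ℂ V →ₗ[ℂ] Module.End ℂ (r.weightSpace b) where
  toFun a := (r.X a).restrict fun _ hm => r.X_mem_weightSpace hm a
  map_add' a a' := by ext; simp
  map_smul' t a := by ext; simp

@[simp]
theorem coe_weightX (b : V) (a : Module.Dual ℂ V) (m : r.weightSpace b) :
    (r.weightX b a m : L) = r.X a m := rfl

theorem weightX_comm (b : V) (a a' : Module.Dual ℂ V) :
    Commute (r.weightX b a) (r.weightX b a') := by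
  ext m
  exact LinearMap.congr_fun (r.X_comm a a') m.1

theorem mem_maxGenEigenspace_weightX (b : V) (a : Module.Dual ℂ V) (m : r.weightSpace b) :
    m ∈ (r.weightX b a).maxGenEigenspace (a b) := by
  obtain ⟨n, hn⟩ := r.mem_weightSpace.mp m.2 a
  have hmem : ∀ m ∈ r.weightSpace b, (r.X a - a b • 1) m ∈ r.weightSpace b := fun m hm =>
    sub_mem (r.X_mem_weightSpace hm a) (Submodule.smul_mem _ _ hm)
  have hrestrict : r.weightX b a - a b • 1 = (r.X a - a b • 1).restrict hmem := by
    ext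
    simp
  rw [Module.End.mem_maxGenEigenspace]
  refine ⟨n, Subtype.ext ?_⟩
  rw [hrestrict, Module.End.pow_restrict, LinearMap.coe_restrict_apply, hn, Submodule.coe_zero]

theorem isUnit_weightX {b : V} {a : Module.Dual ℂ V} (h : a b ≠ 0) : IsUnit (r.weightX b a) :=
  isUnit_of_forall_mem_maxGenEigenspace h (r.mem_maxGenEigenspace_weightX b a)

end Realization

/-! ### Restriction to the stabilizer of a point -/

namespace Coupling

variable {ρ : Representation ℂ W V} (κ : Coupling ρ)

theorem dual_inv_apply {s : W} (hs : κ.k s ≠ 0) (a : Module.Dual ℂ V) :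
    ρ.dual s⁻¹ a = a - a (κ.β s) • κ.α s := by
  ext v
  simp [Representation.dual_apply, Module.Dual.transpose_apply, κ.apply_eq hs, mul_comm]

theorem α_inv_apply {s : W} (hs : κ.k s ≠ 0) (t : W) (v : V) :
    κ.α t (ρ s⁻¹ v) = κ.α t v + κ.α s v * κ.α t (ρ s⁻¹ (κ.β s)) := by
  have h := congrArg (fun x => κ.α t (ρ s⁻¹ x)) (κ.sub_apply s hs v)
  simp only [map_sub, map_smul, smul_eq_mul, ρ.inv_self_apply] at h
  linear_combination h

end Coupling

namespace Realization

section Weights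

variable [Fintype W] {ρ : Representation ℂ W V} {k : W → ℂ} {L : Type*} [AddCommGroup L]
  [Module ℂ L] (r : Realization ρ k (Module.End ℂ L)) (b : V)

theorem apply_mem_weightSpace_of_commutator_mem (f : r.weightSpace b →ₗ[ℂ] L)
    (hf : ∀ a m, f (r.weightX b a m) - r.X a (f m) ∈ r.weightSpace b) (m : r.weightSpace b) :
    f m ∈ r.weightSpace b := by
  rw [mem_weightSpace]
  intro a
  let N := r.weightSpace b
  let D := r.X a - a b • 1
  have hD : N ≤ N.comap D := fun x hx =>
    sub_mem (r.X_mem_weightSpace hx a) (Submodule.smul_mem _ _ hx)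
  have hcomm : N.mapQ N D hD ∘ₗ N.mkQ ∘ₗ f =
      (N.mkQ ∘ₗ f) ∘ₗ (r.weightX b a - a b • 1) := by
    ext m
    refine ((Submodule.Quotient.eq N).mpr ?_).symm
    convert hf a m using 1
    simp only [D, LinearMap.sub_apply, LinearMap.smul_apply, Module.End.one_apply, map_sub,
      map_smul]
    abel
  obtain ⟨n, hn⟩ := (Module.End.mem_maxGenEigenspace _ _ _).mp
    (r.mem_maxGenEigenspace_weightX b a m)
  have hmem : (D ^ n) (f m) ∈ N := by
    have hpow := LinearMap.congr_fun (Module.End.commute_pow_left_of_commute hcomm n) m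
    rw [← Submodule.mapQ_pow, LinearMap.comp_apply, LinearMap.comp_apply (N.mkQ ∘ₗ f), hn,
      map_zero] at hpow
    exact (Submodule.Quotient.mk_eq_zero N).mp hpow
  obtain ⟨n', hn'⟩ := r.mem_weightSpace.mp hmem a
  exact ⟨n' + n, by rw [pow_add, Module.End.mul_apply, hn']⟩

/-- The sum of the generalized weight spaces away from `b`. -/
def offWeight : Submodule ℂ L := ⨆ (u) (_ : u ≠ b), r.weightSpace u

theorem weightSpace_le_offWeight {u : V} (hu : u ≠ b) : r.weightSpace u ≤ r.offWeight b :=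
  le_iSup₂_of_le u hu le_rfl

theorem mkQ_offWeight_injOn : Set.InjOn (r.offWeight b).mkQ (r.weightSpace b) :=
  fun _ hx _ hy hxy => sub_eq_zero.mp (Submodule.disjoint_def.mp (r.iSupIndep_weightSpace b) _
    (sub_mem hx hy) ((Submodule.Quotient.eq _).mp hxy))

theorem T_mem_offWeight {g : W} (hg : ρ g b = b) {x : L} (hx : x ∈ r.offWeight b) :
    r.T g x ∈ r.offWeight b := by
  suffices h : r.offWeight b ≤ (r.offWeight b).comap (r.T g) from h hx
  refine iSup₂_le fun u hu y hy => r.weightSpace_le_offWeight b ?_ (r.T_mem_weightSpace hy g)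
  exact fun h => hu ((ρ.apply_bijective g).injective (h.trans hg.symm))

theorem mkQ_offWeight_T_eq_zero {g : W} (hg : ρ g b ≠ b) {m : L} (hm : m ∈ r.weightSpace b) :
    (r.offWeight b).mkQ (r.T g m) = 0 :=
  (Submodule.Quotient.mk_eq_zero _).mpr
    (r.weightSpace_le_offWeight b hg (r.T_mem_weightSpace hm g))

variable {b} {P : Subgroup W} (hP : ∀ g, g ∈ P ↔ ρ g b = b)

/-- The action of the stabilizer `P` of `b` on the generalized weight space at `b`. -/
def weightT : P →* Module.End ℂ (r.weightSpace b) where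
  toFun g := (r.T g).restrict fun m hm => by
    simpa only [(hP g).mp g.2] using r.T_mem_weightSpace hm (g : W)
  map_one' := by ext m; simp
  map_mul' g h := by ext m; simp

theorem coe_weightT (g : P) (m : r.weightSpace b) : (r.weightT hP g m : L) = r.T g m := rfl

end Weights

variable [Fintype W] {ρ : Representation ℂ W V} {κ : Coupling ρ} {L : Type*} [AddCommGroup L]
  [Module ℂ L] (r : Realization ρ κ.k (Module.End ℂ L)) (b : V)

/-- The inverse of `α_s` on the generalized weight space at `b`; it is an inverse only if `s` moves
`b`, and `0` or junk otherwise. -/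
def rootInv (s : W) : Module.End ℂ (r.weightSpace b) := Ring.inverse (r.weightX b (κ.α s))

theorem weightX_rootInv {s : W} (hs : κ.k s ≠ 0) (hb : ρ s b ≠ b) (m : r.weightSpace b) :
    r.weightX b (κ.α s) (r.rootInv b s m) = m :=
  LinearMap.congr_fun
    (Ring.mul_inverse_cancel _ (r.isUnit_weightX (κ.α_apply_ne_zero hs hb))) m

theorem rootInv_weightX (s : W) (a : Module.Dual ℂ V) (m : r.weightSpace b) :
    r.rootInv b s (r.weightX b a m) = r.weightX b a (r.rootInv b s m) :=
  LinearMap.congr_fun (commute_ringInverse_right (r.weightX_comm b a (κ.α s))).symm.eq m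

theorem rootInv_comm (s t : W) : Commute (r.rootInv b s) (r.rootInv b t) :=
  (r.weightX_comm b (κ.α s) (κ.α t)).ringInverse_ringInverse

/-- The summand `k_s (v, α_s) s α_s⁻¹` of the Dunkl-type operator attached to `v`. It maps the
generalized weight space at `b` to the one at `s b`. -/
def dunklTerm (s : W) : V →ₗ[ℂ] r.weightSpace b →ₗ[ℂ] L :=
  (κ.k s • κ.α s).smulRight (r.T s ∘ₗ (r.weightSpace b).subtype ∘ₗ r.rootInv b s)

theorem dunklTerm_apply (s : W) (v : V) (m : r.weightSpace b) :
    r.dunklTerm b s v m = (κ.k s * κ.α s v) • r.T s (r.rootInv b s m) := rfl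

theorem dunklTerm_weightX {s : W} (hb : ρ s b ≠ b) (v : V) (a : Module.Dual ℂ V)
    (m : r.weightSpace b) :
    r.dunklTerm b s v (r.weightX b a m) - r.X a (r.dunklTerm b s v m) =
      (κ.k s * a (v - ρ s v)) • r.T s m := by
  by_cases hs : κ.k s = 0
  · simp [dunklTerm_apply, hs]
  have hXT : r.X a (r.T s (r.rootInv b s m)) =
      r.T s (r.weightX b a (r.rootInv b s m)) - a (κ.β s) • r.T s m := by
    rw [← Module.End.mul_apply, r.X_mul_T, κ.dual_inv_apply hs, Module.End.mul_apply, map_sub,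
      map_smul, LinearMap.sub_apply, LinearMap.smul_apply, map_sub, map_smul, ← coe_weightX,
      ← coe_weightX, r.weightX_rootInv b hs hb]
  rw [dunklTerm_apply, dunklTerm_apply, map_smul, hXT, r.rootInv_weightX, ← smul_sub,
    sub_sub_cancel, smul_smul, κ.sub_apply s hs, map_smul, smul_eq_mul, mul_assoc]

open Classical in
/-- The component preserving the generalized weight space at `b` of the action of `𝔥`, obtained by
adding to `y` the summands that move `b`. -/
def diagonalY : V →ₗ[ℂ] r.weightSpace b →ₗ[ℂ] L :=
  LinearMap.lcomp ℂ L (r.weightSpace b).subtype ∘ₗ r.Y + ∑ s with ρ s b ≠ b, r.dunklTerm b s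

open Classical in
theorem diagonalY_apply (v : V) (m : r.weightSpace b) :
    r.diagonalY b v m = r.Y v m + ∑ s with ρ s b ≠ b, r.dunklTerm b s v m := by
  simp [diagonalY]

open Classical in
theorem diagonalY_weightX (v : V) (a : Module.Dual ℂ V) (m : r.weightSpace b) :
    r.diagonalY b v (r.weightX b a m) - r.X a (r.diagonalY b v m) =
      a v • (m : L) - ∑ s with ρ s b = b, (κ.k s * a (v - ρ s v)) • r.T s m := by
  have hYX := LinearMap.congr_fun (r.Y_X v a) (m : L)
  simp only [LinearMap.sub_apply, Module.End.mul_apply, Module.algebraMap_end_apply,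
    LinearMap.sum_apply, LinearMap.smul_apply] at hYX
  have hterm : ∀ s ∈ Finset.univ.filter (ρ · b ≠ b),
      r.dunklTerm b s v (r.weightX b a m) - r.X a (r.dunklTerm b s v m) =
        (κ.k s * a (v - ρ s v)) • r.T s m := fun s hs =>
    r.dunklTerm_weightX b (Finset.mem_filter.mp hs).2 v a m
  rw [diagonalY_apply, diagonalY_apply, map_add, map_sum, coe_weightX, add_sub_add_comm, hYX,
    ← Finset.sum_sub_distrib, Finset.sum_congr rfl hterm,
    ← Finset.sum_filter_add_sum_filter_not Finset.univ (ρ · b = b)]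
  abel

theorem diagonalY_mem (v : V) (m : r.weightSpace b) : r.diagonalY b v m ∈ r.weightSpace b := by
  classical
  refine r.apply_mem_weightSpace_of_commutator_mem b _ (fun a m => ?_) m
  rw [diagonalY_weightX]
  refine sub_mem (Submodule.smul_mem _ _ m.2) (sum_mem fun s hs => Submodule.smul_mem _ _ ?_)
  simpa only [(Finset.mem_filter_univ _).mp hs] using r.T_mem_weightSpace m.2 s

/-- The action of `𝔥` on a generalized weight space. -/
def weightY : V →ₗ[ℂ] Module.End ℂ (r.weightSpace b) where
  toFun v := (r.diagonalY b v).codRestrict _ (r.diagonalY_mem b v)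
  map_add' v v' := by ext; simp
  map_smul' t v := by ext; simp

theorem coe_weightY (v : V) (m : r.weightSpace b) :
    (r.weightY b v m : L) = r.diagonalY b v m := rfl

open Classical in
theorem Y_apply_eq_weightY_sub (v : V) (m : r.weightSpace b) :
    r.Y v m = r.weightY b v m - ∑ s with ρ s b ≠ b, r.dunklTerm b s v m := by
  rw [coe_weightY, diagonalY_apply, add_sub_cancel_right]

theorem mkQ_offWeight_Y (v : V) (m : r.weightSpace b) :
    (r.offWeight b).mkQ (r.Y v m) = (r.offWeight b).mkQ (r.weightY b v m) := by
  classical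
  rw [Y_apply_eq_weightY_sub, map_sub, map_sum, Finset.sum_eq_zero, sub_zero]
  intro s hs
  rw [dunklTerm_apply, map_smul, r.mkQ_offWeight_T_eq_zero b (Finset.mem_filter.mp hs).2
    (r.rootInv b s m).2, smul_zero]

open Classical in
theorem mkQ_offWeight_Y_T {s : W} (hs : ρ s b ≠ b) (v : V) (m : r.weightSpace b) :
    (r.offWeight b).mkQ (r.Y v (r.T s m)) =
      -∑ g with ρ g b = b, (κ.k (s⁻¹ * g) * κ.α (s⁻¹ * g) (ρ s⁻¹ v)) •
        (r.offWeight b).mkQ (r.T g (r.rootInv b (s⁻¹ * g) m)) := by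
  have hterm : ∀ t, (r.offWeight b).mkQ (r.T s (r.dunklTerm b t (ρ s⁻¹ v) m)) =
      (κ.k (s⁻¹ * (s * t)) * κ.α (s⁻¹ * (s * t)) (ρ s⁻¹ v)) •
        (r.offWeight b).mkQ (r.T (s * t) (r.rootInv b (s⁻¹ * (s * t)) m)) := fun t => by
    rw [dunklTerm_apply, map_smul, map_smul, ← Module.End.mul_apply, ← map_mul,
      inv_mul_cancel_left]
  rw [← Module.End.mul_apply, r.Y_mul_T, Module.End.mul_apply, Y_apply_eq_weightY_sub, map_sub,
    map_sub, map_sum, map_sum, r.mkQ_offWeight_T_eq_zero b hs (r.weightY b _ m).2, zero_sub,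
    Finset.sum_congr rfl fun t _ => hterm t, sum_mul_left_of_apply_ne hs fun g =>
      (κ.k (s⁻¹ * g) * κ.α (s⁻¹ * g) (ρ s⁻¹ v)) •
        (r.offWeight b).mkQ (r.T g (r.rootInv b (s⁻¹ * g) m))]
  intro g hg
  rw [r.mkQ_offWeight_T_eq_zero b hg (r.rootInv b _ m).2, smul_zero]

open Classical in
/-- The coefficient of `g` in the contribution to `y y'` of the pairs of summands that both move
`b`, for `g` in the stabilizer of `b`. -/
def crossTerm (g : W) (v v' : V) : Module.End ℂ (r.weightSpace b) :=
  ∑ s with ρ s b ≠ b, (κ.k s * κ.k (s⁻¹ * g) * (κ.α s v' * κ.α (s⁻¹ * g) (ρ s⁻¹ v))) •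
    (r.rootInv b s * r.rootInv b (s⁻¹ * g))

theorem crossTerm_symm {g : W} (hg : ρ g b = b) (v v' : V) :
    r.crossTerm b g v v' = r.crossTerm b g v' v := by
  classical
  rw [← sub_eq_zero, crossTerm, crossTerm, ← Finset.sum_sub_distrib]
  refine Eq.trans (Finset.sum_congr rfl fun s _ => ?_) (κ.sum_wedge_ringInverse_eq_zero
    (r.weightX b) (r.weightX_comm b) (fun s hs hb => r.isUnit_weightX (κ.α_apply_ne_zero hs hb))
    κ.k_conj (fun _ => id) hg v' v)
  refine (sub_smul _ _ (r.rootInv b s * r.rootInv b (s⁻¹ * g))).symm.trans ?_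
  change _ = _ • (r.rootInv b s * r.rootInv b (s⁻¹ * g))
  by_cases hs : κ.k s = 0
  · simp only [hs, zero_mul, sub_zero, zero_smul]
  · rw [κ.α_inv_apply hs _ v, κ.α_inv_apply hs _ v', Coupling.wedge]
    congr 1
    ring

open Classical in
theorem mkQ_offWeight_Y_Y (v v' : V) (m : r.weightSpace b) :
    (r.offWeight b).mkQ (r.Y v (r.Y v' m)) =
      (r.offWeight b).mkQ (r.weightY b v (r.weightY b v' m)) +
      ∑ g with ρ g b = b, (r.offWeight b).mkQ (r.T g (r.crossTerm b g v v' m)) := by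
  have hterm : ∀ s ∈ Finset.univ.filter (ρ · b ≠ b),
      (r.offWeight b).mkQ (r.Y v (r.dunklTerm b s v' m)) = -∑ g with ρ g b = b,
        (κ.k s * κ.k (s⁻¹ * g) * (κ.α s v' * κ.α (s⁻¹ * g) (ρ s⁻¹ v))) •
          (r.offWeight b).mkQ (r.T g ((r.rootInv b s * r.rootInv b (s⁻¹ * g)) m)) := by
    intro s hs
    rw [dunklTerm_apply, map_smul, map_smul,
      r.mkQ_offWeight_Y_T b (Finset.mem_filter.mp hs).2, smul_neg, Finset.smul_sum]
    refine congrArg _ (Finset.sum_congr rfl fun g _ => ?_)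
    rw [smul_smul, (r.rootInv_comm b s _).eq, mul_mul_mul_comm, Module.End.mul_apply]
  rw [r.Y_apply_eq_weightY_sub b v', map_sub, map_sub, mkQ_offWeight_Y, map_sum, map_sum,
    Finset.sum_congr rfl hterm, Finset.sum_neg_distrib, sub_neg_eq_add, Finset.sum_comm]
  simp only [crossTerm, LinearMap.sum_apply, LinearMap.smul_apply, AddSubmonoidClass.coe_finsetSum,
    Submodule.coe_smul, map_sum, map_smul]

variable {b} {P : Subgroup W} (hP : ∀ g, g ∈ P ↔ ρ g b = b)

theorem weightT_weightY (g : P) (v : V) (m : r.weightSpace b) :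
    r.weightT hP g (r.weightY b v m) = r.weightY b (ρ g v) (r.weightT hP g m) := by
  refine Subtype.ext (r.mkQ_offWeight_injOn b (Subtype.prop _) (Subtype.prop _) ?_)
  have hT : (r.offWeight b).mkQ (r.T g (r.weightY b v m)) =
      (r.offWeight b).mkQ (r.T g (r.Y v m)) := by
    refine (Submodule.Quotient.eq _).mpr ?_
    rw [← map_sub]
    exact r.T_mem_offWeight b ((hP g).mp g.2)
      ((Submodule.Quotient.eq _).mp (r.mkQ_offWeight_Y b v m).symm)
  rw [coe_weightT, hT, ← Module.End.mul_apply, r.T_mul_Y, Module.End.mul_apply, ← coe_weightT r hP,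
    mkQ_offWeight_Y]

theorem weightY_comm (v v' : V) :
    r.weightY b v * r.weightY b v' = r.weightY b v' * r.weightY b v := by
  classical
  ext m
  refine r.mkQ_offWeight_injOn b (Subtype.prop _) (Subtype.prop _) ?_
  have hYY := congrArg (r.offWeight b).mkQ (LinearMap.congr_fun (r.Y_comm v v') (m : L))
  have hcross : ∑ g with ρ g b = b, (r.offWeight b).mkQ (r.T g (r.crossTerm b g v v' m)) =
      ∑ g with ρ g b = b, (r.offWeight b).mkQ (r.T g (r.crossTerm b g v' v m)) :=
    Finset.sum_congr rfl fun g hg => by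
      rw [r.crossTerm_symm b ((Finset.mem_filter_univ g).mp hg)]
  rw [Module.End.mul_apply, Module.End.mul_apply, mkQ_offWeight_Y_Y, mkQ_offWeight_Y_Y,
    hcross] at hYY
  exact add_right_cancel hYY

variable [Fintype P]

/-- The restriction of a realization to the stabilizer of `b`, acting on the generalized weight
space at `b`. -/
def restrict : Realization (ρ.comp P.subtype : Representation ℂ P V) (κ.restrict P).k
    (Module.End ℂ (r.weightSpace b)) where
  T := r.weightT hP
  X := r.weightX b
  Y := r.weightY b
  T_mul_X g a := by
    ext m
    exact LinearMap.congr_fun (r.T_mul_X g a) (m : L)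
  T_mul_Y g v := LinearMap.ext (r.weightT_weightY hP g v)
  X_comm := r.weightX_comm b
  Y_comm := r.weightY_comm
  Y_X v a := by
    classical
    ext m
    have hstab : ∑ g with ρ g b = b, (κ.k g * a (v - ρ g v)) • r.T g m =
        ∑ g : P, (κ.k g * a (v - ρ g v)) • r.T g m :=
      Finset.sum_subtype _ (fun g => (Finset.mem_filter_univ g).trans (hP g).symm) _
    refine ((r.diagonalY_weightX b v a m).trans (congrArg _ hstab)).trans ?_
    simp only [LinearMap.sub_apply, Module.algebraMap_end_apply, LinearMap.sum_apply,
      LinearMap.smul_apply, Submodule.coe_sub, Submodule.coe_smul, AddSubmonoidClass.coe_finsetSum]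
    rfl

variable {r} in
theorem Aspherical.restrict (hr : r.Aspherical) : (r.restrict hP).Aspherical := by
  classical
  have hsum : ∀ m : r.weightSpace b, (r.offWeight b).mkQ (∑ g : P, r.T g m) = 0 := by
    intro m
    have hr0 := congrArg (r.offWeight b).mkQ
      (LinearMap.congr_fun (show ∑ g, r.T g = 0 from hr) (m : L))
    rw [LinearMap.sum_apply, map_sum, LinearMap.zero_apply, map_zero] at hr0
    rw [map_sum, ← hr0, ← Finset.sum_subtype (Finset.univ.filter (ρ · b = b))
      (fun g => by rw [Finset.mem_filter_univ, hP]) fun g => (r.offWeight b).mkQ (r.T g m)]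
    refine Finset.sum_subset (Finset.subset_univ _) fun g _ hg => ?_
    exact r.mkQ_offWeight_T_eq_zero b (by rwa [Finset.mem_filter_univ] at hg) m.2
  ext m
  refine r.mkQ_offWeight_injOn b (Subtype.prop _) (zero_mem _) ?_
  refine Eq.trans ?_ ((hsum m).trans (map_zero (r.offWeight b).mkQ).symm)
  rw [LinearMap.sum_apply, AddSubmonoidClass.coe_finsetSum]
  rfl

end Realization

/-! ### Induction from the stabilizer of a point -/

theorem dual_inv_apply_apply (ρ : Representation ℂ W V) (w : W) (a : Module.Dual ℂ V) (v : V) :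
    ρ.dual w⁻¹ a v = a (ρ w v) := by
  rw [Representation.dual_apply, inv_inv, Module.Dual.transpose_apply]
  rfl

theorem conj_apply_eq_iff {ρ : Representation ℂ W V} {b : V} {q : W} (hq : ρ q b = b) (t : W) :
    ρ (q * t * q⁻¹) b = b ↔ ρ t b = b := by
  have hq' : ρ q⁻¹ b = b := ρ.inv_apply_eq_iff.mpr hq.symm
  rw [map_mul, map_mul, Module.End.mul_apply, Module.End.mul_apply, hq']
  refine ⟨fun h => (ρ.apply_bijective q).injective (h.trans hq.symm), fun h => ?_⟩
  rw [h, hq]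

namespace Coupling

section

variable [Fintype W] {ρ : Representation ℂ W V} (κ : Coupling ρ) {A : Type*} [Ring A] [Algebra ℂ A]
  {T : W → A} {X : Module.Dual ℂ V → A} {Y : V →ₗ[ℂ] A} (hT : ∀ g v, T g * Y v = Y (ρ g v) * T g)
  (hY : ∀ v a, Y v * X a - X a * Y v = algebraMap ℂ A (a v) - ∑ g, (κ.k g * a (v - ρ g v)) • T g)

include hT hY

theorem Y_commutator_Y_X (v v' : V) (a : Module.Dual ℂ V) :
    Y v * (Y v' * X a - X a * Y v') - (Y v' * X a - X a * Y v') * Y v =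
      -∑ g, (κ.k g * κ.α g v * κ.α g v' * a (κ.β g)) • (Y (κ.β g) * T g) := by
  rw [hY, mul_sub, sub_mul, Algebra.commutes, sub_sub_sub_cancel_left, Finset.mul_sum,
    Finset.sum_mul, ← Finset.sum_sub_distrib, ← Finset.sum_neg_distrib]
  refine Finset.sum_congr rfl fun g _ => ?_
  by_cases hg : κ.k g = 0
  · simp [hg]
  have hYg : Y (ρ g v) = Y v - κ.α g v • Y (κ.β g) := by
    rw [← map_smul, ← κ.sub_apply g hg, map_sub, sub_sub_cancel]
  rw [smul_mul_assoc, hT, mul_smul_comm, hYg, κ.sub_apply g hg, map_smul, smul_eq_mul, sub_mul,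
    smul_mul_assoc]
  module

theorem commute_commutator_X (v v' : V) (a : Module.Dual ℂ V) :
    Commute (Y v * Y v' - Y v' * Y v) (X a) := by
  have hjacobi : (Y v * Y v' - Y v' * Y v) * X a - X a * (Y v * Y v' - Y v' * Y v) =
      (Y v * (Y v' * X a - X a * Y v') - (Y v' * X a - X a * Y v') * Y v) -
      (Y v' * (Y v * X a - X a * Y v) - (Y v * X a - X a * Y v) * Y v') := by
    noncomm_ring
  rw [Commute, SemiconjBy, ← sub_eq_zero, hjacobi, κ.Y_commutator_Y_X hT hY,
    κ.Y_commutator_Y_X hT hY, sub_eq_zero]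
  simp only [mul_assoc, mul_left_comm]

end

theorem α_conj_mul {ρ : Representation ℂ W V} (κ : Coupling ρ) {t : W} {b : V} (q : W)
    (ht : κ.k t ≠ 0) (hb : ρ (q * t * q⁻¹) b ≠ b) (u x : V) :
    κ.α t u * κ.α (q * t * q⁻¹) (ρ q x) = κ.α (q * t * q⁻¹) (ρ q u) * κ.α t x := by
  have hs : κ.k (q * t * q⁻¹) ≠ 0 := (κ.k_conj q t).trans_ne ht
  have hβ : ∀ y, κ.α (q * t * q⁻¹) (ρ q y) • κ.β (q * t * q⁻¹) = κ.α t y • ρ q (κ.β t) := by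
    intro y
    rw [← κ.sub_apply _ hs, ← map_smul, ← κ.sub_apply t ht, map_sub, map_mul, map_mul,
      Module.End.mul_apply, Module.End.mul_apply, ρ.inv_self_apply]
  refine smul_left_injective ℂ (κ.β_ne_zero hs hb) ?_
  dsimp only
  rw [mul_smul, hβ, mul_comm, mul_smul, hβ, smul_comm]

end Coupling

namespace Realization

variable {ρ : Representation ℂ W V} {κ : Coupling ρ} {P : Subgroup W} [Fintype P]
  {N : Type*} [AddCommGroup N] [Module ℂ N]
  (r : Realization (ρ.comp P.subtype : Representation ℂ P V) (κ.restrict P).k (Module.End ℂ N))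

/-- The space of the induced realization: the `P`-equivariant functions on `W`. -/
def indSpace : Submodule ℂ (W → N) where
  carrier := {f | ∀ (w : W) (p : P), f (w * p) = r.T p⁻¹ (f w)}
  add_mem' hf hg w p := by simp [hf w p, hg w p]
  zero_mem' w p := by simp
  smul_mem' t f hf w p := by simp [hf w p]

variable (W N) in
/-- Left translation of functions. -/
def translate : W →* Module.End ℂ (W → N) where
  toFun g := LinearMap.funLeft ℂ N (g⁻¹ * ·)
  map_one' := by ext; simp [LinearMap.funLeft]
  map_mul' g h := by ext; simp [LinearMap.funLeft, mul_assoc]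

theorem translate_apply (g : W) (f : W → N) (w : W) : translate W N g f w = f (g⁻¹ * w) := rfl

/-- The action of `𝔥*` on functions on `W`; it preserves `indSpace`. -/
def indX : Module.Dual ℂ V →ₗ[ℂ] Module.End ℂ (W → N) where
  toFun a := LinearMap.pi fun w => r.X (ρ.dual w⁻¹ a) ∘ₗ LinearMap.proj w
  map_add' a a' := by ext; simp
  map_smul' t a := by ext; simp

theorem indX_apply (a : Module.Dual ℂ V) (f : W → N) (w : W) :
    r.indX a f w = r.X (ρ.dual w⁻¹ a) (f w) := rfl

/-- The summand `k'_s (u, α_s) α_s⁻¹` of the Dunkl-type operators on the induced realization. -/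
def indTerm (s : W) : V →ₗ[ℂ] Module.End ℂ N :=
  (κ.k' s • κ.α s).smulRight (Ring.inverse (r.X (κ.α s)))

theorem indTerm_apply (s : W) (u : V) :
    r.indTerm s u = (κ.k' s * κ.α s u) • Ring.inverse (r.X (κ.α s)) := rfl

theorem indTerm_of_eq_zero {s : W} (hs : κ.k s = 0) (u : V) : r.indTerm s u = 0 := by
  rw [indTerm_apply, (κ.k_eq_zero_iff s).mp hs, zero_mul, zero_smul]

theorem translate_mem {f : W → N} (hf : f ∈ r.indSpace) (g : W) :
    translate W N g f ∈ r.indSpace := fun w p => by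
  simp only [translate_apply, ← mul_assoc]
  exact hf _ p

theorem indX_mem {f : W → N} (hf : f ∈ r.indSpace) (a : Module.Dual ℂ V) :
    r.indX a f ∈ r.indSpace := fun w p => by
  rw [indX_apply, indX_apply, hf w p, mul_inv_rev, map_mul]
  exact (LinearMap.congr_fun (r.T_mul_X p⁻¹ (ρ.dual w⁻¹ a)) (f w)).symm

theorem translate_indX (g : W) (a : Module.Dual ℂ V) (f : W → N) :
    translate W N g (r.indX a f) = r.indX (ρ.dual g a) (translate W N g f) := by
  funext w
  rw [translate_apply, indX_apply, indX_apply, translate_apply, mul_inv_rev, inv_inv, map_mul,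
    Module.End.mul_apply]

theorem indX_comm (a a' : Module.Dual ℂ V) (f : W → N) :
    r.indX a (r.indX a' f) = r.indX a' (r.indX a f) :=
  funext fun w => LinearMap.congr_fun (r.X_comm (ρ.dual w⁻¹ a) (ρ.dual w⁻¹ a')) (f w)

theorem indX_sub_pow_apply (a : Module.Dual ℂ V) (t : ℂ) (n : ℕ) (f : W → N) (w : W) :
    ((r.indX a - t • 1) ^ n) f w = ((r.X (ρ.dual w⁻¹ a) - t • 1) ^ n) (f w) := by
  induction n generalizing f with
  | zero => simp
  | succ n ih =>
    rw [pow_succ, pow_succ, Module.End.mul_apply, Module.End.mul_apply, ih]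
    rfl

/-- The restriction of translation to the space of the induced realization. -/
def indSpaceT : W →* Module.End ℂ r.indSpace where
  toFun g := (translate W N g).restrict fun _ hf => r.translate_mem hf g
  map_one' := by ext f : 2; simp
  map_mul' g h := by ext f : 2; simp

/-- The action of `𝔥*` on the space of the induced realization. -/
def indSpaceX : Module.Dual ℂ V →ₗ[ℂ] Module.End ℂ r.indSpace where
  toFun a := (r.indX a).restrict fun _ hf => r.indX_mem hf a
  map_add' a a' := by ext f : 2; simp
  map_smul' t a := by ext f : 2; simp

theorem coe_indSpaceX_sub_pow (a : Module.Dual ℂ V) (t : ℂ) (n : ℕ) (f : r.indSpace) :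
    (((r.indSpaceX a - t • 1) ^ n) f : W → N) = ((r.indX a - t • 1) ^ n) f := by
  induction n generalizing f with
  | zero => simp
  | succ n ih =>
    rw [pow_succ, pow_succ, Module.End.mul_apply, Module.End.mul_apply, ih]
    rfl

variable {b : V}

theorem indicator_mem_indSpace (hP : ∀ g ∈ P, ρ g b = b) {f : W → N} (hf : f ∈ r.indSpace)
    (u : V) : Set.indicator {w | ρ w b = u} f ∈ r.indSpace := fun w p => by
  classical
  have hwp : ρ (w * p) b = ρ w b := by rw [map_mul, Module.End.mul_apply, hP p p.2]
  simp only [Set.indicator_apply, Set.mem_ofPred_eq, hwp, hf w p, apply_ite (r.T p⁻¹), map_zero]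

/-- The values of the induced realization at `1` are arbitrary. -/
instance nontrivial_indSpace [Nontrivial N] : Nontrivial r.indSpace := by
  classical
  obtain ⟨n, hn⟩ := exists_ne (0 : N)
  let f : W → N := fun w => if h : w ∈ P then r.T (⟨w, h⟩⁻¹ : P) n else 0
  have hf : f ∈ r.indSpace := by
    intro w p
    by_cases hw : w ∈ P
    · have hwp : w * p ∈ P := P.mul_mem hw p.2
      have hinv : (⟨w * p, hwp⟩⁻¹ : P) = p⁻¹ * ⟨w, hw⟩⁻¹ := (mul_inv_rev (⟨w, hw⟩ : P) p)
      simp only [f, dif_pos hw, dif_pos hwp, hinv, map_mul, Module.End.mul_apply]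
    · simp only [f, dif_neg hw, dif_neg (mt (P.mul_mem_cancel_right p.2).mp hw), map_zero]
  have hf1 : f 1 = n := by
    have hone : (⟨1, P.one_mem⟩⁻¹ : P) = 1 := inv_one
    simp only [f, dif_pos P.one_mem, hone, map_one, Module.End.one_apply]
  exact ⟨⟨⟨f, hf⟩, 0, fun h => hn (hf1.symm.trans (congrFun (congrArg Subtype.val h) 1))⟩⟩

section Weight

variable (hX : ∀ a m, m ∈ (r.X a).maxGenEigenspace (a b))

include hX

theorem isUnit_X_α {s : W} (hs : κ.k s ≠ 0) (hb : ρ s b ≠ b) : IsUnit (r.X (κ.α s)) :=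
  isUnit_of_forall_mem_maxGenEigenspace (κ.α_apply_ne_zero hs hb) (hX _)

theorem X_α_ringInverse {s : W} (hs : κ.k s ≠ 0) (hb : ρ s b ≠ b) (n : N) :
    r.X (κ.α s) (Ring.inverse (r.X (κ.α s)) n) = n :=
  LinearMap.congr_fun (Ring.mul_inverse_cancel _ (r.isUnit_X_α hX hs hb)) n

theorem indTerm_conj {t : W} (ht : ρ t b ≠ b) (q : P) (hq : ρ q b = b) (v : V) (n : N) :
    r.indTerm (q * t * (q : W)⁻¹) (ρ q v) (r.T q n) = r.T q (r.indTerm t v n) := by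
  by_cases h0 : κ.k t = 0
  · rw [r.indTerm_of_eq_zero h0, r.indTerm_of_eq_zero ((κ.k_conj _ t).trans h0)]
    simp only [LinearMap.zero_apply, map_zero]
  set s := q * t * (q : W)⁻¹
  have hsb : ρ s b ≠ b := mt (conj_apply_eq_iff hq t).mp ht
  have hs0 : κ.k s ≠ 0 := (κ.k_conj _ t).trans_ne h0
  have hdual : κ.α t v • ρ.dual (q : W)⁻¹ (κ.α s) = κ.α s (ρ q v) • κ.α t := by
    ext x
    rw [LinearMap.smul_apply, dual_inv_apply_apply]
    exact κ.α_conj_mul (q : W) h0 hsb v x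
  have hXT : ∀ x, r.X (κ.α s) (r.T q x) = r.T q (r.X (ρ.dual (q : W)⁻¹ (κ.α s)) x) :=
    LinearMap.congr_fun (r.X_mul_T q (κ.α s))
  have hXinv : κ.α t v • r.X (ρ.dual (q : W)⁻¹ (κ.α s)) (Ring.inverse (r.X (κ.α t)) n) =
      κ.α s (ρ q v) • n := by
    rw [← LinearMap.smul_apply, ← map_smul, hdual, map_smul, LinearMap.smul_apply,
      r.X_α_ringInverse hX h0 ht]
  rw [indTerm_apply, indTerm_apply, κ.k'_conj, mul_smul, mul_smul, LinearMap.smul_apply,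
    LinearMap.smul_apply _ (κ.α t v • _), map_smul (r.T q)]
  congr 1
  apply ((Module.End.isUnit_iff _).mp (r.isUnit_X_α hX hs0 hsb)).injective
  rw [LinearMap.smul_apply, LinearMap.smul_apply, map_smul, map_smul, map_smul,
    r.X_α_ringInverse hX hs0 hsb, hXT, ← map_smul, ← map_smul, hXinv]

theorem indTerm_X {s : W} (hb : ρ s b ≠ b) (u : V) (a : Module.Dual ℂ V) (n : N) :
    r.indTerm s u (r.X (ρ.dual s a) n) - r.X a (r.indTerm s u n) =
      -((κ.k s * a (u - ρ s u)) • n) := by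
  by_cases h0 : κ.k s = 0
  · simp [r.indTerm_of_eq_zero h0, h0]
  have hcomm : r.X a (Ring.inverse (r.X (κ.α s)) n) = Ring.inverse (r.X (κ.α s)) (r.X a n) :=
    LinearMap.congr_fun (commute_ringInverse_right (r.X_comm a (κ.α s))).eq n
  have hdual : κ.k' s • (ρ.dual s a - a) = -(κ.k s * a (κ.β s)) • κ.α s := by
    ext x
    have h := congrArg a (κ.compat s x)
    rw [κ.sub_apply s h0] at h
    simp only [map_smul, smul_eq_mul, map_sub] at h
    simp only [LinearMap.smul_apply, LinearMap.sub_apply, Representation.dual_apply,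
      Module.Dual.transpose_apply, LinearMap.comp_apply, smul_eq_mul]
    linear_combination h
  have hinv : Ring.inverse (r.X (κ.α s)) (r.X (κ.α s) n) = n :=
    LinearMap.congr_fun (Ring.inverse_mul_cancel _ (r.isUnit_X_α hX h0 hb)) n
  have hX' : κ.k' s • r.X (ρ.dual s a - a) n = -(κ.k s * a (κ.β s)) • r.X (κ.α s) n := by
    rw [← LinearMap.smul_apply, ← map_smul, hdual, map_smul, LinearMap.smul_apply]
  rw [indTerm_apply, LinearMap.smul_apply, LinearMap.smul_apply, map_smul, hcomm, ← smul_sub,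
    ← map_sub, ← LinearMap.sub_apply, ← map_sub, mul_comm, mul_smul, ← map_smul _ (κ.k' s), hX',
    map_smul, hinv, κ.sub_apply s h0, map_smul, smul_eq_mul]
  module

theorem exists_indX_sub_pow_eq_zero [Finite W] {u : V} {f : W → N}
    (hf : ∀ w, ρ w b ≠ u → f w = 0) (a : Module.Dual ℂ V) :
    ∃ n : ℕ, ((r.indX a - a u • 1) ^ n) f = 0 := by
  classical
  have := Fintype.ofFinite W
  have hpointwise : ∀ w, ∃ n : ℕ, ((r.X (ρ.dual w⁻¹ a) - a u • 1) ^ n) (f w) = 0 := by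
    intro w
    by_cases hw : ρ w b = u
    · simpa only [dual_inv_apply_apply, hw] using
        (Module.End.mem_maxGenEigenspace _ _ _).mp (hX (ρ.dual w⁻¹ a) (f w))
    · exact ⟨0, by rw [hf w hw, map_zero]⟩
  choose n hn using hpointwise
  refine ⟨∑ w, n w, funext fun w => ?_⟩
  rw [indX_sub_pow_apply, ← Finset.sum_erase_add _ _ (Finset.mem_univ w), pow_add,
    Module.End.mul_apply, hn, map_zero, Pi.zero_apply]

theorem apply_eq_zero_of_indX_sub_pow {u : V} {w : W} (hw : ρ w b ≠ u) {f : W → N}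
    (hf : ∀ a : Module.Dual ℂ V, ∃ n : ℕ, ((r.indX a - a u • 1) ^ n) f = 0) : f w = 0 := by
  obtain ⟨a, ha⟩ := Module.Projective.exists_dual_ne_zero ℂ (sub_ne_zero.mpr hw.symm)
  rw [map_sub, sub_ne_zero] at ha
  obtain ⟨n, hn⟩ := hf a
  have hmem : f w ∈ (r.X (ρ.dual w⁻¹ a)).maxGenEigenspace (a u) :=
    (Module.End.mem_maxGenEigenspace _ _ _).mpr
      ⟨n, by rw [← indX_sub_pow_apply, hn, Pi.zero_apply]⟩
  have hmem' := hX (ρ.dual w⁻¹ a) (f w)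
  rw [dual_inv_apply_apply] at hmem'
  exact Submodule.disjoint_def.mp (Module.End.disjoint_genEigenspace _ ha ⊤ ⊤) _ hmem hmem'

end Weight

variable [Fintype W]

variable (b) in
open Classical in
/-- The action of `𝔥` on functions on `W`; it preserves `indSpace`. -/
def indY : V →ₗ[ℂ] Module.End ℂ (W → N) where
  toFun v := LinearMap.pi fun w => r.Y (ρ w⁻¹ v) ∘ₗ LinearMap.proj w +
    ∑ s with ρ s b ≠ b, r.indTerm s (ρ w⁻¹ v) ∘ₗ LinearMap.proj (w * s⁻¹)
  map_add' a a' := by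
    refine LinearMap.ext fun f => funext fun w => ?_
    simp only [LinearMap.pi_apply, LinearMap.add_apply, map_add, Finset.sum_add_distrib,
      LinearMap.comp_apply, LinearMap.proj_apply, Pi.add_apply, LinearMap.sum_apply]
    abel
  map_smul' t a := by
    refine LinearMap.ext fun f => funext fun w => ?_
    simp only [LinearMap.pi_apply, LinearMap.add_apply, map_smul, LinearMap.smul_apply,
      Pi.smul_apply, LinearMap.comp_apply, LinearMap.proj_apply, LinearMap.sum_apply, smul_add,
      Finset.smul_sum, RingHom.id_apply]

open Classical in
theorem indY_apply (v : V) (f : W → N) (w : W) : r.indY b v f w = r.Y (ρ w⁻¹ v) (f w) +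
    ∑ s with ρ s b ≠ b, r.indTerm s (ρ w⁻¹ v) (f (w * s⁻¹)) := by
  simp [indY]

theorem translate_indY (g : W) (v : V) (f : W → N) :
    translate W N g (r.indY b v f) = r.indY b (ρ g v) (translate W N g f) := by
  funext w
  rw [translate_apply, indY_apply, indY_apply, translate_apply, mul_inv_rev, inv_inv, map_mul,
    Module.End.mul_apply]
  simp only [translate_apply, mul_assoc]

theorem sum_smul_translate_apply (f : W → N) (v : V) (a : Module.Dual ℂ V) (w : W) :
    (∑ g, (κ.k g * a (v - ρ g v)) • translate W N g f) w =
      ∑ s, (κ.k s * ρ.dual w⁻¹ a (ρ w⁻¹ v - ρ s (ρ w⁻¹ v))) • f (w * s⁻¹) := by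
  rw [Finset.sum_apply]
  refine (Fintype.sum_equiv (MulAut.conj w).toEquiv _ _ fun s => ?_).symm
  have hconj : (MulAut.conj w).toEquiv s = w * s * w⁻¹ := rfl
  have harg : (w * s * w⁻¹)⁻¹ * w = w * s⁻¹ := by group
  rw [hconj, Pi.smul_apply, translate_apply, κ.k_conj, harg, dual_inv_apply_apply, map_sub,
    ρ.self_inv_apply, map_mul, map_mul]
  rfl

open Classical in
theorem Y_X_apply_of_mem_indSpace (hP : ∀ g, g ∈ P ↔ ρ g b = b) {f : W → N} (hf : f ∈ r.indSpace)
    (u : V) (a : Module.Dual ℂ V) (w : W) :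
    r.Y u (r.X a (f w)) - r.X a (r.Y u (f w)) =
      a u • f w - ∑ g with ρ g b = b, (κ.k g * a (u - ρ g u)) • f (w * g⁻¹) := by
  have hYX := LinearMap.congr_fun (r.Y_X u a) (f w)
  simp only [LinearMap.sub_apply, Module.End.mul_apply, Module.algebraMap_end_apply,
    LinearMap.sum_apply, LinearMap.smul_apply] at hYX
  rw [hYX, Finset.sum_subtype (p := (· ∈ P)) (F := ‹Fintype P›) (Finset.univ.filter (ρ · b = b))
    (fun g => (Finset.mem_filter_univ g).trans (hP g).symm)
    fun g => (κ.k g * a (u - ρ g u)) • f (w * g⁻¹)]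
  refine congrArg _ (Finset.sum_congr rfl fun p _ => congrArg _ ?_)
  have hp := hf w p⁻¹
  rw [inv_inv, Subgroup.coe_inv] at hp
  exact hp.symm

section

variable (hP : ∀ g, g ∈ P ↔ ρ g b = b) (hX : ∀ a m, m ∈ (r.X a).maxGenEigenspace (a b))

include hP hX

theorem indY_mem {f : W → N} (hf : f ∈ r.indSpace) (v : V) : r.indY b v f ∈ r.indSpace := by
  classical
  intro w p
  have hp : ρ (p⁻¹ : P) b = b := (hP _).mp (p⁻¹).2
  rw [indY_apply, indY_apply, hf w p, map_add, map_sum, mul_inv_rev, map_mul]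
  congr 1
  · exact (LinearMap.congr_fun (r.T_mul_Y p⁻¹ (ρ w⁻¹ v)) (f w)).symm
  · refine (Finset.sum_equiv (MulAut.conj (p⁻¹ : P).1).toEquiv (fun t => ?_) fun t ht => ?_).symm
    · rw [Finset.mem_filter_univ, Finset.mem_filter_univ]
      exact (conj_apply_eq_iff hp t).not.symm
    · have hconj : (MulAut.conj (p⁻¹ : P).1).toEquiv t = (p⁻¹ : P) * t * ((p⁻¹ : P) : W)⁻¹ := rfl
      have harg : w * p * ((p⁻¹ : P) * t * ((p⁻¹ : P) : W)⁻¹)⁻¹ = w * t⁻¹ * p := by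
        rw [Subgroup.coe_inv]
        group
      rw [hconj, harg, hf]
      exact (r.indTerm_conj hX (Finset.mem_filter.mp ht).2 p⁻¹ hp (ρ w⁻¹ v) _).symm

theorem indY_X {f : W → N} (hf : f ∈ r.indSpace) (v : V) (a : Module.Dual ℂ V) :
    r.indY b v (r.indX a f) - r.indX a (r.indY b v f) =
      a v • f - ∑ g, (κ.k g * a (v - ρ g v)) • translate W N g f := by
  classical
  funext w
  have hdiag := r.Y_X_apply_of_mem_indSpace hP hf (ρ w⁻¹ v) (ρ.dual w⁻¹ a) w
  have hoff : ∀ s ∈ Finset.univ.filter (ρ · b ≠ b), r.indTerm s (ρ w⁻¹ v)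
      (r.indX a f (w * s⁻¹)) - r.X (ρ.dual w⁻¹ a) (r.indTerm s (ρ w⁻¹ v) (f (w * s⁻¹))) =
      -((κ.k s * ρ.dual w⁻¹ a (ρ w⁻¹ v - ρ s (ρ w⁻¹ v))) • f (w * s⁻¹)) := by
    intro s hs
    rw [← r.indTerm_X hX (Finset.mem_filter.mp hs).2, indX_apply, mul_inv_rev, inv_inv, map_mul,
      Module.End.mul_apply]
  have hpair : ρ.dual w⁻¹ a (ρ w⁻¹ v) = a v := by rw [dual_inv_apply_apply, ρ.self_inv_apply]
  rw [Pi.sub_apply, Pi.sub_apply, sum_smul_translate_apply, indX_apply, indY_apply, indY_apply,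
    indX_apply, map_add, map_sum, add_sub_add_comm, hdiag, ← Finset.sum_sub_distrib,
    Finset.sum_congr rfl hoff, Finset.sum_neg_distrib, hpair, Pi.smul_apply,
    ← Finset.sum_filter_add_sum_filter_not Finset.univ (ρ · b = b)]
  abel

end

variable (b) in
open Classical in
/-- The coefficient of `g` in the contribution to `y y'` of the pairs of summands that both move
`b`, for `g` in the stabilizer of `b`. -/
def indCrossTerm (g : W) (u u' : V) : Module.End ℂ N :=
  ∑ t with ρ t b ≠ b, r.indTerm (t⁻¹ * g) u * r.indTerm t (ρ (t⁻¹ * g) u')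

theorem indCrossTerm_symm (hX : ∀ a m, m ∈ (r.X a).maxGenEigenspace (a b)) {g : W}
    (hg : ρ g b = b) (u u' : V) : r.indCrossTerm b g u u' = r.indCrossTerm b g u' u := by
  classical
  rw [← sub_eq_zero, indCrossTerm, indCrossTerm, ← Finset.sum_sub_distrib]
  refine Eq.trans (Finset.sum_congr rfl fun t _ => ?_) (κ.sum_wedge_ringInverse_eq_zero
    r.X r.X_comm (fun s hs hb => r.isUnit_X_α hX hs hb)
    κ.k'_conj (fun g => mt (κ.k_eq_zero_iff g).mp) hg u' u)
  by_cases hk : κ.k (t⁻¹ * g) = 0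
  · simp [r.indTerm_of_eq_zero hk, (κ.k_eq_zero_iff _).mp hk]
  have hcomm : Ring.inverse (r.X (κ.α (t⁻¹ * g))) * Ring.inverse (r.X (κ.α t)) =
      Ring.inverse (r.X (κ.α t)) * Ring.inverse (r.X (κ.α (t⁻¹ * g))) :=
    Commute.ringInverse_ringInverse (r.X_comm _ _)
  rw [indTerm_apply, indTerm_apply, indTerm_apply, indTerm_apply, smul_mul_smul_comm,
    smul_mul_smul_comm, hcomm, ← sub_smul]
  congr 1
  rw [κ.apply_eq hk, κ.apply_eq hk, map_sub, map_sub, map_smul, map_smul, smul_eq_mul, smul_eq_mul,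
    Coupling.wedge]
  ring

open Classical in
theorem indY_indY_apply {w : W} {f : W → N} (hf : ∀ x, ρ x b ≠ ρ w b → f x = 0) (v v' : V) :
    r.indY b v (r.indY b v' f) w = r.Y (ρ w⁻¹ v) (r.Y (ρ w⁻¹ v') (f w)) +
      ∑ g with ρ g b = b, r.indCrossTerm b g (ρ w⁻¹ v) (ρ w⁻¹ v') (f (w * g⁻¹)) := by
  have hvanish : ∀ s, ρ s b ≠ b → f (w * s⁻¹) = 0 := by
    refine fun s hs => hf _ fun h => hs ?_
    rw [map_mul, Module.End.mul_apply] at h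
    exact (ρ.inv_apply_eq_iff.mp ((ρ.apply_bijective w).injective h)).symm
  have hfirst : r.indY b v' f w = r.Y (ρ w⁻¹ v') (f w) := by
    rw [indY_apply, Finset.sum_eq_zero, add_zero]
    intro s hs
    rw [hvanish s (Finset.mem_filter.mp hs).2, map_zero]
  have hsecond : ∀ s ∈ Finset.univ.filter (ρ · b ≠ b),
      r.indTerm s (ρ w⁻¹ v) (r.indY b v' f (w * s⁻¹)) = ∑ t with ρ t b ≠ b,
        r.indTerm s (ρ w⁻¹ v) (r.indTerm t (ρ s (ρ w⁻¹ v')) (f (w * (t * s)⁻¹))) := by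
    intro s hs
    rw [indY_apply, hvanish s (Finset.mem_filter.mp hs).2, map_zero, zero_add, map_sum]
    refine Finset.sum_congr rfl fun t _ => ?_
    rw [mul_inv_rev, mul_inv_rev, inv_inv, map_mul, Module.End.mul_apply, mul_assoc]
  have hreindex : ∀ t ∈ Finset.univ.filter (ρ · b ≠ b), ∑ s with ρ s b ≠ b,
      r.indTerm s (ρ w⁻¹ v) (r.indTerm t (ρ s (ρ w⁻¹ v')) (f (w * (t * s)⁻¹))) =
      ∑ g with ρ g b = b, r.indTerm (t⁻¹ * g) (ρ w⁻¹ v)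
        (r.indTerm t (ρ (t⁻¹ * g) (ρ w⁻¹ v')) (f (w * g⁻¹))) := by
    intro t ht
    rw [← sum_mul_left_of_apply_ne (Finset.mem_filter.mp ht).2]
    · simp only [inv_mul_cancel_left]
    · intro g hg
      rw [hvanish g hg, map_zero, map_zero]
  rw [indY_apply, hfirst, Finset.sum_congr rfl hsecond, Finset.sum_comm,
    Finset.sum_congr rfl hreindex, Finset.sum_comm]
  simp only [indCrossTerm, LinearMap.sum_apply, Module.End.mul_apply]

variable (hP : ∀ g, g ∈ P ↔ ρ g b = b) (hX : ∀ a m, m ∈ (r.X a).maxGenEigenspace (a b))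

/-- The action of `𝔥` on the space of the induced realization. -/
def indSpaceY : V →ₗ[ℂ] Module.End ℂ r.indSpace where
  toFun v := (r.indY b v).restrict fun _ hf => r.indY_mem hP hX hf v
  map_add' a a' := by ext f : 2; simp
  map_smul' t a := by ext f : 2; simp

theorem indSpaceT_mul_indSpaceY (g : W) (v : V) :
    r.indSpaceT g * r.indSpaceY hP hX v = r.indSpaceY hP hX (ρ g v) * r.indSpaceT g :=
  LinearMap.ext fun f => Subtype.ext (r.translate_indY g v f.1)

theorem indSpaceY_X (v : V) (a : Module.Dual ℂ V) :
    r.indSpaceY hP hX v * r.indSpaceX a - r.indSpaceX a * r.indSpaceY hP hX v =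
      algebraMap ℂ _ (a v) - ∑ g, (κ.k g * a (v - ρ g v)) • r.indSpaceT g := by
  refine LinearMap.ext fun f => Subtype.ext ((r.indY_X hP hX f.2 v a).trans ?_)
  simp only [LinearMap.sub_apply, Module.algebraMap_end_apply, LinearMap.sum_apply,
    LinearMap.smul_apply, Submodule.coe_sub, Submodule.coe_smul, AddSubmonoidClass.coe_finsetSum]
  rfl

/-- On the support of `f` the two products are compared directly. Elsewhere the commutator
vanishes because it preserves the generalized weights of `𝔥*`, and those of functions supported
over different points of the orbit of `b` are different. -/
theorem commutator_indSpaceY_eq_zero (v v' : V) {u : V} {f : r.indSpace}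
    (hf : ∀ w, ρ w b ≠ u → f.1 w = 0) :
    (r.indSpaceY hP hX v * r.indSpaceY hP hX v' - r.indSpaceY hP hX v' * r.indSpaceY hP hX v) f =
      0 := by
  classical
  refine Subtype.ext (funext fun w => ?_)
  by_cases hw : ρ w b = u
  · change r.indY b v (r.indY b v' f.1) w - r.indY b v' (r.indY b v f.1) w = 0
    subst hw
    rw [r.indY_indY_apply hf, r.indY_indY_apply hf, sub_eq_zero]
    congr 1
    · exact LinearMap.congr_fun (r.Y_comm (ρ w⁻¹ v) (ρ w⁻¹ v')) (f.1 w)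
    · refine Finset.sum_congr rfl fun g hg => ?_
      rw [r.indCrossTerm_symm hX (Finset.mem_filter.mp hg).2]
  · refine r.apply_eq_zero_of_indX_sub_pow hX hw fun a => ?_
    obtain ⟨n, hn⟩ := r.exists_indX_sub_pow_eq_zero hX hf a
    have hcomm : Commute (r.indSpaceY hP hX v * r.indSpaceY hP hX v' -
        r.indSpaceY hP hX v' * r.indSpaceY hP hX v) (r.indSpaceX a - a u • 1) := by
      refine Commute.sub_right (R := Module.End ℂ r.indSpace) ?_
        ((Commute.one_right _).smul_right _)
      exact κ.commute_commutator_X (T := r.indSpaceT) (X := r.indSpaceX)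
        (r.indSpaceT_mul_indSpaceY hP hX) (r.indSpaceY_X hP hX) v v' a
    have hfn : ((r.indSpaceX a - a u • 1) ^ n) f = 0 :=
      Subtype.ext (by rw [coe_indSpaceX_sub_pow, hn]; rfl)
    refine ⟨n, ?_⟩
    rw [← coe_indSpaceX_sub_pow, ← Module.End.mul_apply, ← (hcomm.pow_right n).eq,
      Module.End.mul_apply, hfn, map_zero]
    rfl

theorem indSpaceY_comm (v v' : V) :
    r.indSpaceY hP hX v * r.indSpaceY hP hX v' = r.indSpaceY hP hX v' * r.indSpaceY hP hX v := by
  classical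
  rw [← sub_eq_zero]
  ext f : 1
  let part (u : V) : r.indSpace :=
    ⟨Set.indicator {w | ρ w b = u} f.1, r.indicator_mem_indSpace (fun g => (hP g).mp) f.2 u⟩
  have hsum : f = ∑ u ∈ Finset.univ.image (ρ · b), part u := by
    refine Subtype.ext (funext fun w => ?_)
    rw [AddSubmonoidClass.coe_finsetSum, Finset.sum_apply]
    simp only [part, Set.indicator_apply, Set.mem_ofPred_eq, Finset.sum_ite_eq,
      Finset.mem_image_of_mem (ρ · b) (Finset.mem_univ w), if_true]
  rw [hsum, map_sum]
  refine (Finset.sum_eq_zero fun u _ => ?_).trans (LinearMap.zero_apply _).symm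
  exact r.commutator_indSpaceY_eq_zero hP hX v v' fun w (hw : w ∉ {w | ρ w b = u}) =>
    Set.indicator_of_notMem hw _

/-- The realization induced from the stabilizer of `b`. -/
def induce : Realization ρ κ.k (Module.End ℂ r.indSpace) where
  T := r.indSpaceT
  X := r.indSpaceX
  Y := r.indSpaceY hP hX
  T_mul_X g a := LinearMap.ext fun f => Subtype.ext (r.translate_indX g a f.1)
  T_mul_Y := r.indSpaceT_mul_indSpaceY hP hX
  X_comm a a' := LinearMap.ext fun f => Subtype.ext (r.indX_comm a a' f.1)
  Y_comm := r.indSpaceY_comm hP hX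
  Y_X := r.indSpaceY_X hP hX

variable {r} in
theorem Aspherical.induce (hr : r.Aspherical) : (r.induce hP hX).Aspherical := by
  refine LinearMap.ext fun f => Subtype.ext (funext fun w => ?_)
  rw [LinearMap.sum_apply, AddSubmonoidClass.coe_finsetSum, Finset.sum_apply]
  change ∑ g : W, f.1 (g⁻¹ * w) = 0
  have htranslate : ∑ g : W, f.1 (g⁻¹ * w) = ∑ g, f.1 g :=
    Fintype.sum_equiv ((Equiv.inv W).trans (Equiv.mulRight w)) _ _ fun g => rfl
  have hequivariant : ∀ p : P, ∑ g, f.1 g = r.T p⁻¹ (∑ g, f.1 g) := fun p => by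
    rw [map_sum]
    exact (Fintype.sum_equiv (Equiv.mulRight p.1) _ _ fun g => (f.2 g p).symm).symm
  have haverage : ∑ _p : P, ∑ g, f.1 g = 0 := by
    rw [Finset.sum_congr rfl fun p _ => hequivariant p, ← LinearMap.sum_apply,
      Fintype.sum_equiv (Equiv.inv P) (fun p => r.T p⁻¹) r.T fun p => rfl,
      show ∑ p, r.T p = 0 from hr, LinearMap.zero_apply]
  rw [Finset.sum_const, Finset.card_univ, ← Nat.cast_smul_eq_nsmul ℂ] at haverage
  rw [htranslate]
  exact (smul_eq_zero.mp haverage).resolve_left (Nat.cast_ne_zero.mpr Fintype.card_ne_zero)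

end Realization

/-! ### Splitting off a trivial summand -/

section TensorProduct

open scoped TensorProduct

variable {A B : Type*} [Ring A] [Algebra ℂ A] [Ring B] [Algebra ℂ B]

theorem tmul_one_mul_tmul_one_add_one_tmul {t x z : A} (h : t * x = z * t) (x' : B) :
    t ⊗ₜ[ℂ] 1 * (x ⊗ₜ[ℂ] 1 + 1 ⊗ₜ[ℂ] x') = (z ⊗ₜ[ℂ] 1 + 1 ⊗ₜ[ℂ] x') * t ⊗ₜ[ℂ] 1 := by
  simp only [mul_add, add_mul, Algebra.TensorProduct.tmul_mul_tmul, one_mul, mul_one, h]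

theorem commutator_tmul_one_add_one_tmul (x y : A) (x' y' : B) :
    (y ⊗ₜ[ℂ] 1 + 1 ⊗ₜ[ℂ] y') * (x ⊗ₜ[ℂ] 1 + 1 ⊗ₜ[ℂ] x') -
      (x ⊗ₜ[ℂ] 1 + 1 ⊗ₜ[ℂ] x') * (y ⊗ₜ[ℂ] 1 + 1 ⊗ₜ[ℂ] y') =
      (y * x - x * y) ⊗ₜ[ℂ] (1 : B) + (1 : A) ⊗ₜ[ℂ] (y' * x' - x' * y') := by
  simp only [mul_add, add_mul, Algebra.TensorProduct.tmul_mul_tmul, one_mul, mul_one,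
    TensorProduct.sub_tmul, TensorProduct.tmul_sub]
  abel

theorem tmul_one_add_one_tmul_comm {x y : A} {x' y' : B} (h : y * x = x * y)
    (h' : y' * x' = x' * y') :
    (y ⊗ₜ[ℂ] 1 + 1 ⊗ₜ[ℂ] y') * (x ⊗ₜ[ℂ] 1 + 1 ⊗ₜ[ℂ] x') =
      (x ⊗ₜ[ℂ] 1 + 1 ⊗ₜ[ℂ] x') * (y ⊗ₜ[ℂ] 1 + 1 ⊗ₜ[ℂ] y') := by
  rw [← sub_eq_zero, commutator_tmul_one_add_one_tmul, h, h', sub_self, sub_self,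
    TensorProduct.zero_tmul, TensorProduct.tmul_zero, add_zero]

end TensorProduct

/-- A decomposition of the representation `ρ` as the direct sum of `ρ'` and a trivial
representation, given by the equivariant projection `π` onto `ρ'` and its section `σ`. -/
structure Splitting (ρ : Representation ℂ W V) {V' : Type*} [AddCommGroup V'] [Module ℂ V']
    (ρ' : Representation ℂ W V') where
  π : V →ₗ[ℂ] V'
  σ : V' →ₗ[ℂ] V
  π_σ : ∀ q, π (σ q) = q
  π_map : ∀ g v, π (ρ g v) = ρ' g (π v)
  σ_map : ∀ g q, σ (ρ' g q) = ρ g (σ q)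
  fixed : ∀ g v, ρ g (v - σ (π v)) = v - σ (π v)

namespace Splitting

variable {ρ : Representation ℂ W V} {V' : Type*} [AddCommGroup V'] [Module ℂ V']
  {ρ' : Representation ℂ W V'} (S : Splitting ρ ρ')

/-- The projection to the trivial summand. -/
def proj : V →ₗ[ℂ] V := LinearMap.id - S.σ ∘ₗ S.π

theorem proj_apply (v : V) : S.proj v = v - S.σ (S.π v) := rfl

theorem map_proj (g : W) (v : V) : ρ g (S.proj v) = S.proj v := S.fixed g v

theorem proj_map (g : W) (v : V) : S.proj (ρ g v) = S.proj v := by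
  rw [← S.map_proj g v, proj_apply, proj_apply, S.π_map, S.σ_map, map_sub]

theorem proj_proj (v : V) : S.proj (S.proj v) = S.proj v := by
  rw [proj_apply S (S.proj v), proj_apply, map_sub, S.π_σ, sub_self, map_zero, sub_zero]

theorem sub_map (g : W) (v : V) : v - ρ g v = S.σ (S.π v - ρ' g (S.π v)) := by
  have hfixed := S.fixed g v
  rw [map_sub, sub_eq_sub_iff_sub_eq_sub] at hfixed
  rw [map_sub, S.σ_map, ← neg_sub, hfixed, neg_sub]

theorem dual_comp_π (g : W) (a : Module.Dual ℂ V') : ρ.dual g (a ∘ₗ S.π) = ρ'.dual g a ∘ₗ S.π := by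
  ext v
  simp [Representation.dual_apply, Module.Dual.transpose_apply, S.π_map]

theorem dual_comp_σ (g : W) (a : Module.Dual ℂ V) : ρ.dual g a ∘ₗ S.σ = ρ'.dual g (a ∘ₗ S.σ) := by
  ext v
  simp [Representation.dual_apply, Module.Dual.transpose_apply, S.σ_map]

section Weyl

variable [FiniteDimensional ℂ V]

/-- The polynomial given by the restriction of a linear form to the trivial summand, in the
coordinates of a basis of `𝔥`. -/
def polyX : Module.Dual ℂ V →ₗ[ℂ] MvPolynomial (Fin (Module.finrank ℂ V)) ℂ where
  toFun a := ∑ i, a (S.proj (Module.finBasis ℂ V i)) • MvPolynomial.X i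
  map_add' a a' := by simp [add_smul, Finset.sum_add_distrib]
  map_smul' t a := by simp [Finset.smul_sum, mul_smul]

/-- The derivative of polynomials in the direction of the trivial component of a vector. -/
def polyY : V →ₗ[ℂ] Derivation ℂ (MvPolynomial (Fin (Module.finrank ℂ V)) ℂ)
    (MvPolynomial (Fin (Module.finrank ℂ V)) ℂ) where
  toFun v := MvPolynomial.mkDerivation ℂ fun i =>
    algebraMap ℂ _ ((Module.finBasis ℂ V).coord i (S.proj v))
  map_add' v v' := by ext i; simp [MvPolynomial.mkDerivation_X]
  map_smul' t v := by ext i; simp [MvPolynomial.mkDerivation_X]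

theorem polyY_polyX (v : V) (a : Module.Dual ℂ V) :
    S.polyY v (S.polyX a) = algebraMap ℂ _ (a (S.proj v)) := by
  have hexpand : a (S.proj v) = ∑ i, a (S.proj (Module.finBasis ℂ V i)) *
      (Module.finBasis ℂ V).coord i (S.proj v) := by
    conv_lhs => rw [← S.proj_proj, ← (Module.finBasis ℂ V).sum_repr (S.proj v)]
    rw [map_sum, map_sum]
    refine Finset.sum_congr rfl fun i _ => ?_
    rw [map_smul, map_smul, smul_eq_mul, mul_comm, Module.Basis.coord_apply]
  rw [hexpand, map_sum]
  simp only [polyX, polyY, LinearMap.coe_mk, AddHom.coe_mk, map_sum]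
  refine Finset.sum_congr rfl fun i _ => ?_
  rw [Derivation.map_smul, MvPolynomial.mkDerivation_X, Algebra.smul_def, map_mul]

theorem polyY_comm (v v' : V) (p : MvPolynomial (Fin (Module.finrank ℂ V)) ℂ) :
    S.polyY v (S.polyY v' p) = S.polyY v' (S.polyY v p) := by
  have hbracket : ⁅S.polyY v, S.polyY v'⁆ = 0 := by
    refine MvPolynomial.derivation_ext fun i => ?_
    rw [Derivation.commutator_apply]
    simp [polyY, MvPolynomial.mkDerivation_X]
  rw [← sub_eq_zero, ← Derivation.commutator_apply, hbracket, Derivation.zero_apply]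

/-- Multiplication by the polynomials `polyX`. -/
def weylX : Module.Dual ℂ V →ₗ[ℂ] Module.End ℂ (MvPolynomial (Fin (Module.finrank ℂ V)) ℂ) :=
  (Algebra.lmul ℂ _).toLinearMap ∘ₗ S.polyX

/-- The derivations `polyY` as linear operators. -/
def weylY : V →ₗ[ℂ] Module.End ℂ (MvPolynomial (Fin (Module.finrank ℂ V)) ℂ) where
  toFun v := (S.polyY v).toLinearMap
  map_add' v v' := by rw [map_add]; rfl
  map_smul' t v := by rw [map_smul]; rfl

theorem weylX_dual (g : W) (a : Module.Dual ℂ V) : S.weylX (ρ.dual g a) = S.weylX a := by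
  simp [weylX, polyX, Representation.dual_apply, Module.Dual.transpose_apply, S.map_proj]

theorem weylY_map (g : W) (v : V) : S.weylY (ρ g v) = S.weylY v := by
  simp only [weylY, polyY, LinearMap.coe_mk, AddHom.coe_mk, S.proj_map]

theorem weylX_comm (a a' : Module.Dual ℂ V) : S.weylX a * S.weylX a' = S.weylX a' * S.weylX a :=
  LinearMap.ext fun _ => mul_left_comm _ _ _

theorem weylY_comm (v v' : V) : S.weylY v * S.weylY v' = S.weylY v' * S.weylY v :=
  LinearMap.ext fun p => S.polyY_comm v v' p

theorem weylY_X (v : V) (a : Module.Dual ℂ V) :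
    S.weylY v * S.weylX a - S.weylX a * S.weylY v = algebraMap ℂ _ (a (S.proj v)) := by
  refine LinearMap.ext fun p => ?_
  change S.polyY v (S.polyX a * p) - S.polyX a * S.polyY v p = _
  rw [Derivation.leibniz, polyY_polyX, smul_eq_mul, smul_eq_mul, add_sub_cancel_left, mul_comm,
    Module.algebraMap_end_apply, Algebra.smul_def]

end Weyl

variable [Fintype W] {k : W → ℂ} {A : Type*} [Ring A] [Algebra ℂ A]

/-- The restriction of a realization of `ρ` to the summand `ρ'`. -/
def descend (r : Realization ρ k A) : Realization ρ' k A where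
  T := r.T
  X := r.X ∘ₗ S.π.dualMap
  Y := r.Y ∘ₗ S.σ
  T_mul_X g a := by
    change r.T g * r.X (a ∘ₗ S.π) = r.X (ρ'.dual g a ∘ₗ S.π) * r.T g
    rw [r.T_mul_X, S.dual_comp_π]
  T_mul_Y g q := by
    rw [LinearMap.comp_apply, LinearMap.comp_apply, r.T_mul_Y, S.σ_map]
  X_comm _ _ := r.X_comm _ _
  Y_comm _ _ := r.Y_comm _ _
  Y_X q a := by
    refine (r.Y_X (S.σ q) (S.π.dualMap a)).trans ?_
    simp only [LinearMap.dualMap_apply, map_sub, S.π_σ, S.π_map]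

theorem descend_aspherical {r : Realization ρ k A} (hr : r.Aspherical) :
    (S.descend r).Aspherical := hr

open scoped TensorProduct

/-- The extension of a realization of `ρ'` to `ρ`, the trivial summand acting through the
polynomial differential operators `weylX` and `weylY`. -/
def extend [FiniteDimensional ℂ V] (r : Realization ρ' k A) : Realization ρ k
    (A ⊗[ℂ] Module.End ℂ (MvPolynomial (Fin (Module.finrank ℂ V)) ℂ)) where
  T := (Algebra.TensorProduct.includeLeft : A →ₐ[ℂ] _).toMonoidHom.comp r.T
  X := Algebra.TensorProduct.includeLeft.toLinearMap ∘ₗ r.X ∘ₗ S.σ.dualMap +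
    Algebra.TensorProduct.includeRight.toLinearMap ∘ₗ S.weylX
  Y := Algebra.TensorProduct.includeLeft.toLinearMap ∘ₗ r.Y ∘ₗ S.π +
    Algebra.TensorProduct.includeRight.toLinearMap ∘ₗ S.weylY
  T_mul_X g a := by
    have hX : r.T g * r.X (a ∘ₗ S.σ) = r.X (ρ.dual g a ∘ₗ S.σ) * r.T g := by
      rw [r.T_mul_X, S.dual_comp_σ]
    refine (tmul_one_mul_tmul_one_add_one_tmul hX (S.weylX a)).trans ?_
    rw [← S.weylX_dual g a]
    rfl
  T_mul_Y g v := by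
    have hY : r.T g * r.Y (S.π v) = r.Y (S.π (ρ g v)) * r.T g := by
      rw [r.T_mul_Y, S.π_map]
    refine (tmul_one_mul_tmul_one_add_one_tmul hY (S.weylY v)).trans ?_
    rw [← S.weylY_map g v]
    rfl
  X_comm a a' := tmul_one_add_one_tmul_comm (r.X_comm (a ∘ₗ S.σ) (a' ∘ₗ S.σ)) (S.weylX_comm a a')
  Y_comm v v' := tmul_one_add_one_tmul_comm (r.Y_comm (S.π v) (S.π v')) (S.weylY_comm v v')
  Y_X v a := by
    have hsplit : a v = (a ∘ₗ S.σ) (S.π v) + a (S.proj v) := by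
      rw [LinearMap.comp_apply, ← map_add, S.proj_apply, add_sub_cancel]
    refine (commutator_tmul_one_add_one_tmul (r.X (a ∘ₗ S.σ)) (r.Y (S.π v)) (S.weylX a)
      (S.weylY v)).trans ?_
    rw [r.Y_X, S.weylY_X, hsplit, map_add, TensorProduct.sub_tmul, TensorProduct.sum_tmul,
      sub_add_eq_add_sub]
    refine congrArg₂ (· - ·) ?_ (Finset.sum_congr rfl fun g _ => ?_)
    · simp only [Algebra.algebraMap_eq_smul_one, TensorProduct.tmul_smul,
        ← TensorProduct.smul_tmul', Algebra.TensorProduct.one_def]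
    · rw [S.sub_map, ← TensorProduct.smul_tmul']
      rfl

theorem extend_aspherical [FiniteDimensional ℂ V] {r : Realization ρ' k A} (hr : r.Aspherical) :
    (S.extend r).Aspherical :=
  hr.map Algebra.TensorProduct.includeLeft

end Splitting

theorem averageMap_map [Fintype W] (ρ : Representation ℂ W V) (g : W) (v : V) :
    ρ.averageMap (ρ g v) = ρ.averageMap v := by
  rw [Representation.averageMap, ← Representation.asAlgebraHom_single_one,
    ← Module.End.mul_apply, ← map_mul, GroupAlgebra.mul_average_right]

/-- The splitting of `𝔥` into `𝔥 / 𝔥^P` and `𝔥^P`: the complement of `𝔥^P` is the kernel of the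
average over `P`. -/
def quotSplitting (ρ : Representation ℂ W V) (P : Subgroup W) [Fintype P] :
    Splitting (ρ.comp P.subtype : Representation ℂ P V) (quotRep ρ P) :=
  let ρP : Representation ℂ P V := ρ.comp P.subtype
  { π := (fixedSpace ρ P).mkQ
    σ := (fixedSpace ρ P).liftQ (LinearMap.id - ρP.averageMap) fun v hv => by
      rw [LinearMap.mem_ker, LinearMap.sub_apply, LinearMap.id_apply,
        ρP.averageMap_id v hv, sub_self]
    π_σ := by
      refine (fixedSpace ρ P).mkQ_surjective.forall.mpr fun v => ?_
      change (fixedSpace ρ P).mkQ (v - ρP.averageMap v) = (fixedSpace ρ P).mkQ v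
      rw [map_sub, sub_eq_self, Submodule.mkQ_apply, Submodule.Quotient.mk_eq_zero]
      exact ρP.averageMap_invariant v
    π_map := fun _ _ => rfl
    σ_map := fun g => by
      refine (fixedSpace ρ P).mkQ_surjective.forall.mpr fun v => ?_
      change ρP g v - ρP.averageMap (ρP g v) = ρP g (v - ρP.averageMap v)
      rw [map_sub, ρP.averageMap_invariant v g, averageMap_map]
    fixed := fun g v => by
      change ρP g (v - (v - ρP.averageMap v)) = v - (v - ρP.averageMap v)
      rw [sub_sub_cancel]
      exact ρP.averageMap_invariant v g }

theorem coupling_restrict_k [Finite W] {ρ : Representation ℂ W V} (P : Subgroup W)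
    (c : Parameter ρ) :
    (Parameter.restrict P c).coupling.k = (c.coupling.restrict P).k := by
  funext p
  change (Parameter.restrict P c).weight.extend p = c.weight.extend p
  by_cases hp : p ∈ reflections (quotRep ρ P)
  · let s : reflections ρ := ⟨p, (mem_reflections_quotRep ρ P p).mp hp⟩
    let s' : reflections (quotRep ρ P) := ⟨p, hp⟩
    have hcoroot : (fixedSpace ρ P).mkQ (coroot ρ s) ≠ 0 := by
      rw [Submodule.mkQ_apply, Ne, Submodule.Quotient.mk_eq_zero]
      intro hfixed
      obtain ⟨v, hv⟩ := exists_sub_eq_coroot ρ s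
      exact coroot_ne_zero ρ s (eq_zero_of_fixed ρ p.1 hv (hfixed p))
    calc (Parameter.restrict P c).weight.extend s' = c.weight.1 s := by
          rw [Parameter.extend_coe, Parameter.weight_apply, Parameter.weight_apply,
            reflectionEigenvalue_eq_of_intertwining ρ s (quotRep ρ P) s' (fixedSpace ρ P).mkQ
              (fun _ => rfl) hcoroot]
          rfl
      _ = c.weight.extend s := (c.weight.extend_coe s).symm
  · rw [Parameter.extend_of_notMem _ hp,
      Parameter.extend_of_notMem _ (mt (mem_reflections_quotRep ρ P p).mpr hp)]

/-! ### Realizations with a single generalized weight -/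

namespace Realization

section Corestrict

variable [Fintype W] {ρ : Representation ℂ W V} {k k' : W → ℂ} {A : Type*} [Ring A] [Algebra ℂ A]
  (r : Realization ρ k A)

/-- Transport of a realization along an equality of coefficients. -/
def cast (hk : k = k') : Realization ρ k' A :=
  { r with Y_X := hk ▸ r.Y_X }

variable {r} in
theorem Aspherical.cast (hr : r.Aspherical) (hk : k = k') : (r.cast hk).Aspherical := hr

/-- The subalgebra generated by a realization. -/
def subalgebra : Subalgebra ℂ A :=
  Algebra.adjoin ℂ (Set.range r.X ∪ Set.range r.Y ∪ Set.range r.T)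

/-- A realization, viewed in the subalgebra that it generates. -/
def corestrict : Realization ρ k r.subalgebra where
  T := r.T.codRestrict r.subalgebra fun g => Algebra.subset_adjoin (Or.inr ⟨g, rfl⟩)
  X := r.X.codRestrict (Subalgebra.toSubmodule r.subalgebra) fun a =>
    Algebra.subset_adjoin (Or.inl (Or.inl ⟨a, rfl⟩))
  Y := r.Y.codRestrict (Subalgebra.toSubmodule r.subalgebra) fun b =>
    Algebra.subset_adjoin (Or.inl (Or.inr ⟨b, rfl⟩))
  T_mul_X g a := Subtype.ext (r.T_mul_X g a)
  T_mul_Y g b := Subtype.ext (r.T_mul_Y g b)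
  X_comm a a' := Subtype.ext (r.X_comm a a')
  Y_comm b b' := Subtype.ext (r.Y_comm b b')
  Y_X b a := by
    refine Subtype.ext ((r.Y_X b a).trans ?_)
    rw [Subalgebra.coe_sub, AddSubmonoidClass.coe_finsetSum]
    rfl

variable {r} in
theorem Aspherical.corestrict (hr : r.Aspherical) : r.corestrict.Aspherical := by
  refine Subtype.ext (Eq.trans ?_ hr)
  rw [AddSubmonoidClass.coe_finsetSum]
  rfl

theorem corestrict_generates : r.corestrict.Generates := by
  have hX : Set.range r.corestrict.X = Subtype.val ⁻¹' Set.range r.X := Set.range_codRestrict _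
  have hY : Set.range r.corestrict.Y = Subtype.val ⁻¹' Set.range r.Y := Set.range_codRestrict _
  have hT : Set.range r.corestrict.T = Subtype.val ⁻¹' Set.range r.T := Set.range_codRestrict _
  rw [Generates, hX, hY, hT]
  exact Algebra.adjoin_adjoin_coe_preimage

end Corestrict

section Shift

variable [Fintype W] {ρ : Representation ℂ W V} {k : W → ℂ} {A : Type*} [Ring A] [Algebra ℂ A]
  (r : Realization ρ k A) (b : V) (hb : ∀ g, ρ g b = b)

/-- The translation of a realization by a `W`-fixed vector. -/
def shift : Realization ρ k A where
  T := r.T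
  X := r.X - (Algebra.linearMap ℂ A) ∘ₗ Module.Dual.eval ℂ V b
  Y := r.Y
  T_mul_X g a := by
    simp only [LinearMap.sub_apply, LinearMap.comp_apply, Module.Dual.eval_apply,
      Algebra.linearMap_apply, mul_sub, sub_mul, r.T_mul_X, Representation.dual_apply,
      Module.Dual.transpose_apply, hb]
    rw [Algebra.commutes]
  T_mul_Y := r.T_mul_Y
  X_comm a a' := by
    have hX : Commute (r.X a) (r.X a') := r.X_comm a a'
    exact (hX.sub_right (Algebra.commute_algebraMap_right _ _)).sub_left
      (Algebra.commute_algebraMap_left _ _)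
  Y_comm := r.Y_comm
  Y_X b' a := by
    rw [← r.Y_X]
    simp only [LinearMap.sub_apply, LinearMap.comp_apply, Module.Dual.eval_apply,
      Algebra.linearMap_apply, mul_sub, sub_mul]
    rw [Algebra.commutes]
    abel

variable {r b}

theorem Generates.shift (hr : r.Generates) : (r.shift b hb).Generates := by
  rw [Generates, eq_top_iff, ← show _ = ⊤ from hr, Algebra.adjoin_le_iff]
  rintro _ ((⟨a, rfl⟩ | ⟨v, rfl⟩) | ⟨g, rfl⟩)
  · rw [show r.X a = (r.shift b hb).X a + algebraMap ℂ A (a b) from (sub_add_cancel _ _).symm]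
    exact add_mem (Algebra.subset_adjoin (Or.inl (Or.inl ⟨a, rfl⟩)))
      (Subalgebra.algebraMap_mem _ _)
  · exact Algebra.subset_adjoin (Or.inl (Or.inr ⟨v, rfl⟩))
  · exact Algebra.subset_adjoin (Or.inr ⟨g, rfl⟩)

variable (r b) in
/-- The left ideal generated by the elements `X a - (a, b)`. -/
def weightIdeal : Ideal A := Ideal.span (Set.range fun a => r.X a - algebraMap ℂ A (a b))

theorem Generates.nontrivial_quotient_weightIdeal [FiniteDimensional ℂ V] [Nontrivial A]
    (hr : r.Generates) (hb : ∀ g, ρ g b = b) : Nontrivial (A ⧸ r.weightIdeal b) := by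
  rw [Submodule.Quotient.nontrivial_iff, Ne, Ideal.eq_top_iff_one]
  exact (hr.shift hb).one_notMem_span_X

variable (r b) in
/-- The action on the quotient by `weightIdeal`, on which `𝔥*` has the single generalized weight
`b`. -/
def weightQuotient : Realization ρ k (Module.End ℂ (A ⧸ r.weightIdeal b)) :=
  r.map (Algebra.lsmul ℂ ℂ _)

theorem Generates.mem_maxGenEigenspace_weightQuotient (hr : r.Generates)
    (hb : ∀ g, ρ g b = b) (a : Module.Dual ℂ V) (m : A ⧸ r.weightIdeal b) :
    m ∈ ((r.weightQuotient b).X a).maxGenEigenspace (a b) := by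
  have hgen := hr.shift hb
  rw [Generates, Set.union_comm (Set.range _) (Set.range (r.shift b hb).Y)] at hgen
  obtain ⟨n, hn⟩ := (r.shift b hb).triangular_swap.exists_pow_smul_eq_zero hgen
    (J := r.weightIdeal b) Ideal.subset_span m ⟨a, rfl⟩
  have hX : (r.weightQuotient b).X a - a b • 1 =
      Algebra.lsmul ℂ ℂ (A ⧸ r.weightIdeal b) ((r.shift b hb).X a) := by
    rw [show (r.shift b hb).X a = r.X a - algebraMap ℂ A (a b) from rfl, map_sub,
      AlgHom.commutes, Algebra.algebraMap_eq_smul_one]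
    rfl
  rw [Module.End.mem_maxGenEigenspace]
  refine ⟨n, ?_⟩
  rw [hX, ← map_pow]
  exact hn

end Shift

end Realization

theorem Realization.Aspherical.sphericalIdeal_ne_top_of_stabilizer [Finite W]
    [FiniteDimensional ℂ V] {ρ : Representation ℂ W V} {c : Parameter ρ} {P : Subgroup W}
    [Fintype P] {A : Type*} [Ring A] [Algebra ℂ A] [Nontrivial A]
    {r : Realization (ρ.comp P.subtype : Representation ℂ P V) (c.coupling.restrict P).k A}
    (hr : r.Aspherical) {b : V} (hb : ∀ g, g ∈ P ↔ ρ g b = b) : sphericalIdeal ρ c ≠ ⊤ := by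
  have := Fintype.ofFinite W
  have hfixed (g : P) : ρ g.1 b = b := (hb g).mp g.2
  have hgen := r.corestrict_generates
  have := hgen.nontrivial_quotient_weightIdeal hfixed
  have hweight : (r.corestrict.weightQuotient b).Aspherical := hr.corestrict.map _
  exact (hweight.induce hb (hgen.mem_maxGenEigenspace_weightQuotient hfixed)).sphericalIdeal_ne_top

theorem sphericalIdeal_ne_top_of_restrict [Finite W] [FiniteDimensional ℂ V]
    {ρ : Representation ℂ W V} {c : Parameter ρ} {P : Subgroup W} (hP : IsParabolic ρ P)
    (h : sphericalIdeal (quotRep ρ P) (Parameter.restrict P c) ≠ ⊤) : sphericalIdeal ρ c ≠ ⊤ := by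
  have := Fintype.ofFinite W
  have := Fintype.ofFinite P
  have := nontrivial_quotient_sphericalTwoSidedIdeal h
  obtain ⟨b, hb⟩ := hP
  have hr := (quotSplitting ρ P).extend_aspherical
    ((quotientRealization_aspherical (Parameter.restrict P c)).cast (coupling_restrict_k P c))
  exact hr.sphericalIdeal_ne_top_of_stabilizer hb

/-! ### Duality -/

/-- The coupling of the dual realization. -/
def Coupling.dagger {ρ : Representation ℂ W V} (κ : Coupling ρ) : Coupling ρ where
  k g := κ.k' g⁻¹
  k' g := κ.k g⁻¹
  α g := κ.α g⁻¹
  β g := (κ.k g⁻¹ / κ.k' g⁻¹) • κ.β g⁻¹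
  k_conj h g := by
    rw [← κ.k'_conj h g⁻¹]
    congr 1
    group
  k'_conj h g := by
    rw [← κ.k_conj h g⁻¹]
    congr 1
    group
  k_eq_zero_iff g := (κ.k_eq_zero_iff g⁻¹).symm
  sub_apply g hg v := by
    have h := κ.compat g⁻¹ v
    rw [inv_inv, κ.sub_apply _ fun h0 => hg ((κ.k_eq_zero_iff _).mp h0)] at h
    rw [smul_comm, div_eq_inv_mul, mul_smul, smul_comm (κ.k g⁻¹), smul_comm _ (κ.α g⁻¹ v),
      smul_comm (κ.α g⁻¹ v), smul_comm (κ.α g⁻¹ v), h, smul_smul, inv_mul_cancel₀ hg, one_smul]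
  compat g v := by
    have h := κ.compat g⁻¹ v
    rw [inv_inv] at h
    exact h.symm

theorem Coupling.dagger_restrict_dagger_k {ρ : Representation ℂ W V} (κ : Coupling ρ)
    (P : Subgroup W) : (κ.dagger.restrict P).dagger.k = (κ.restrict P).k :=
  funext fun p => congrArg κ.k (inv_inv p.1)

namespace Realization

section Dual

variable [Fintype W] {ρ : Representation ℂ W V} {κ : Coupling ρ} {M : Type*} [AddCommGroup M]
  [Module ℂ M] (r : Realization ρ κ.k (Module.End ℂ M))

theorem sum_inv_eq_sum_dagger (φ : Module.Dual ℂ M) (v : V) (a : Module.Dual ℂ V) (m : M) :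
    ∑ g, (κ.dagger.k g * a (v - ρ g v)) • φ (r.T g⁻¹ m) =
      ∑ g, (κ.k g * a (v - ρ g v)) • φ (r.T g m) := by
  refine Fintype.sum_equiv (Equiv.inv W) _ _ fun g => ?_
  have hcompat := congrArg a (κ.compat g⁻¹ v)
  rw [map_smul, map_smul, smul_eq_mul, smul_eq_mul, inv_inv] at hcompat
  rw [Equiv.inv_apply, hcompat]
  rfl

/-- The realization on the dual space, on which `W` and `𝔥` act through the antipode of `ℂW` and
a sign. -/
def dual : Realization ρ κ.dagger.k (Module.End ℂ (Module.Dual ℂ M)) where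
  T :=
    { toFun := fun g => (r.T g⁻¹).dualMap
      map_one' := by rw [inv_one, map_one]; rfl
      map_mul' := fun g h => by rw [mul_inv_rev, map_mul]; rfl }
  X :=
    { toFun := fun a => (r.X a).dualMap
      map_add' := fun a a' => by rw [map_add]; ext; simp
      map_smul' := fun t a => by rw [map_smul]; ext; simp }
  Y :=
    { toFun := fun v => -(r.Y v).dualMap
      map_add' := fun v v' => by rw [map_add]; ext; simp; ring
      map_smul' := fun t v => by rw [map_smul]; ext; simp }
  T_mul_X g a := by
    ext φ m
    have h := LinearMap.congr_fun (r.X_mul_T g⁻¹ a) m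
    rw [inv_inv] at h
    exact congrArg φ h
  T_mul_Y g v := by
    ext φ m
    have h := LinearMap.congr_fun (r.Y_mul_T g⁻¹ v) m
    rw [inv_inv] at h
    exact congrArg (fun x => -φ x) h
  X_comm a a' := by
    ext φ m
    exact congrArg φ (LinearMap.congr_fun (r.X_comm a' a) m)
  Y_comm v v' := by
    ext φ m
    simpa using congrArg φ (LinearMap.congr_fun (r.Y_comm v' v) m)
  Y_X v a := by
    ext φ m
    have h := congrArg φ (LinearMap.congr_fun (r.Y_X v a) m)
    simp only [LinearMap.sub_apply, Module.End.mul_apply, Module.algebraMap_end_apply,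
      LinearMap.sum_apply, LinearMap.smul_apply, map_sub φ, map_sum, map_smul,
      ← r.sum_inv_eq_sum_dagger] at h
    simp only [LinearMap.sub_apply, Module.End.mul_apply, Module.algebraMap_end_apply,
      LinearMap.sum_apply, LinearMap.smul_apply, LinearMap.coe_mk, AddHom.coe_mk,
      LinearMap.neg_apply, LinearMap.dualMap_apply, MonoidHom.coe_mk, OneHom.coe_mk]
    rw [← h]
    ring

variable {r} in
theorem Aspherical.dual (hr : r.Aspherical) : r.dual.Aspherical := by
  have hinv : ∑ g, r.T g⁻¹ = 0 := (Fintype.sum_equiv (Equiv.inv W) _ _ fun g => rfl).trans hr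
  ext φ m
  have hm := congrArg φ (LinearMap.congr_fun hinv m)
  rw [LinearMap.sum_apply, map_sum, LinearMap.zero_apply, map_zero] at hm
  rw [LinearMap.sum_apply, LinearMap.sum_apply]
  exact hm

theorem dual_X_apply (a : Module.Dual ℂ V) (φ : Module.Dual ℂ M) (m : M) :
    r.dual.X a φ m = φ (r.X a m) := rfl

theorem mem_weightSpace_dual {b : V} {φ : Module.Dual ℂ M}
    (h : ∀ a m, φ (r.X a m) = a b * φ m) : φ ∈ r.dual.weightSpace b := by
  rw [mem_weightSpace]
  refine fun a => ⟨1, LinearMap.ext fun m => ?_⟩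
  rw [pow_one, LinearMap.sub_apply, LinearMap.sub_apply, dual_X_apply, h]
  exact sub_self _

end Dual

section RestrictTop

variable [Fintype W] [Fintype (⊤ : Subgroup W)] {ρ : Representation ℂ W V} {κ : Coupling ρ}
  {A : Type*} [Ring A] [Algebra ℂ A]

/-- A realization, viewed as one of the improper subgroup. -/
def restrictTop (r : Realization ρ κ.k A) :
    Realization (ρ.comp (⊤ : Subgroup W).subtype : Representation ℂ (⊤ : Subgroup W) V)
      (κ.restrict ⊤).k A where
  T := r.T.comp (⊤ : Subgroup W).subtype
  X := r.X
  Y := r.Y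
  T_mul_X g a := r.T_mul_X g a
  T_mul_Y g a := r.T_mul_Y g a
  X_comm := r.X_comm
  Y_comm := r.Y_comm
  Y_X v a := by
    rw [r.Y_X]
    congr 1
    exact (Fintype.sum_equiv (Subgroup.topEquiv (G := W)).toEquiv _ _ fun g => rfl).symm

theorem Aspherical.restrictTop {r : Realization ρ κ.k A} (hr : r.Aspherical) :
    r.restrictTop.Aspherical :=
  (Fintype.sum_equiv (Subgroup.topEquiv (G := W)).toEquiv _ _ fun _ => rfl).trans hr

end RestrictTop

end Realization

section Subgroup

variable {ρ : Representation ℂ W V} {c : Parameter ρ}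

theorem sphericalIdeal_quotRep_ne_top [Finite W] {P : Subgroup W} [Fintype P] {A : Type*} [Ring A]
    [Algebra ℂ A] [Nontrivial A]
    {r : Realization (ρ.comp P.subtype : Representation ℂ P V) (c.coupling.restrict P).k A}
    (hr : r.Aspherical) : sphericalIdeal (quotRep ρ P) (Parameter.restrict P c) ≠ ⊤ :=
  (((quotSplitting ρ P).descend_aspherical hr).cast
    (coupling_restrict_k P c).symm).sphericalIdeal_ne_top

theorem sphericalIdeal_quotRep_ne_top_of_eigenfunctional [Fintype W] {M : Type*}
    [AddCommGroup M] [Module ℂ M] {r : Realization ρ c.coupling.k (Module.End ℂ M)}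
    (hr : r.Aspherical) {b : V} {φ : Module.Dual ℂ M} (hφ : φ ≠ 0)
    (h : ∀ a m, φ (r.X a m) = a b * φ m) {P : Subgroup W} (hP : ∀ g, g ∈ P ↔ ρ g b = b) :
    sphericalIdeal (quotRep ρ P) (Parameter.restrict P c) ≠ ⊤ := by
  have := Fintype.ofFinite P
  have : Nontrivial (r.dual.weightSpace b) :=
    ⟨⟨φ, r.mem_weightSpace_dual h⟩, 0, fun h0 => hφ (congrArg Subtype.val h0)⟩
  exact sphericalIdeal_quotRep_ne_top
    ((hr.dual.restrict hP).dual.cast (c.coupling.dagger_restrict_dagger_k P))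

theorem sphericalIdeal_quotRep_top_ne_top [Finite W] (h : sphericalIdeal ρ c ≠ ⊤) :
    sphericalIdeal (quotRep ρ ⊤) (Parameter.restrict ⊤ c) ≠ ⊤ := by
  have := Fintype.ofFinite W
  have := Fintype.ofFinite (⊤ : Subgroup W)
  have := nontrivial_quotient_sphericalTwoSidedIdeal h
  exact sphericalIdeal_quotRep_ne_top (quotientRealization_aspherical c).restrictTop

end Subgroup

/-! ### Supports of finitely generated modules -/

section Support

variable {K : Type*} [Field K] {E : Type*} [AddCommGroup E] [Module K E]

theorem adjoin_range_comp_basis {A : Type*} [Semiring A] [Algebra K A] {ι : Type*}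
    (B : Module.Basis ι K E) (x : E →ₗ[K] A) :
    Algebra.adjoin K (Set.range (x ∘ B)) = Algebra.adjoin K (Set.range x) := by
  rw [← Algebra.adjoin_span, Set.range_comp, ← Submodule.map_span, B.span_eq, Submodule.map_top,
    LinearMap.coe_range]

variable {S : Type*} [CommRing S] [Algebra K S]

theorem finiteType_of_adjoin_range [FiniteDimensional K E] {x : E →ₗ[K] S}
    (hx : Algebra.adjoin K (Set.range x) = ⊤) : Algebra.FiniteType K S := by
  refine ⟨⟨(Set.finite_range (x ∘ Module.finBasis K E)).toFinset, ?_⟩⟩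
  rw [Set.Finite.coe_toFinset, adjoin_range_comp_basis, hx]

theorem exists_algHom_ker_eq [IsAlgClosed K] [Algebra.FiniteType K S] (I : Ideal S)
    [I.IsMaximal] : ∃ χ : S →ₐ[K] K, RingHom.ker χ = I := by
  let _ : Field (S ⧸ I) := Ideal.Quotient.field I
  have : Module.Finite K (S ⧸ I) := finite_of_finite_type_of_isJacobsonRing K (S ⧸ I)
  let e : K ≃ₐ[K] (S ⧸ I) := AlgEquiv.ofBijective (Algebra.ofId K (S ⧸ I))
    IsAlgClosed.algebraMap_bijective_of_isIntegral
  refine ⟨e.symm.toAlgHom.comp (Ideal.Quotient.mkₐ K I), Ideal.ext fun s => ?_⟩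
  rw [← Ideal.Quotient.eq_zero_iff_mem (I := I), ← map_eq_zero_iff e.symm e.symm.injective]
  rfl

variable {M : Type*} [AddCommGroup M] [Module K M] [Module S M] [IsScalarTower K S M]
  [Module.Finite S M]

theorem exists_eigenfunctional_of_algHom {χ : S →ₐ[K] K}
    (hχ : Module.annihilator S M ≤ RingHom.ker χ) :
    ∃ φ : Module.Dual K M, φ ≠ 0 ∧ ∀ s m, φ (s • m) = χ s * φ m := by
  have hne : RingHom.ker χ • (⊤ : Submodule S M) ≠ ⊤ := by
    intro htop
    obtain ⟨s, hs_sub, hs_smul⟩ :=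
      Submodule.exists_sub_one_mem_and_smul_eq_zero_of_fg_of_le_smul (RingHom.ker χ) ⊤
        Module.Finite.fg_top htop.ge
    have hs : χ s = 0 := hχ (Module.mem_annihilator.mpr fun m => hs_smul m Submodule.mem_top)
    rw [RingHom.mem_ker, map_sub, hs, map_one, zero_sub, neg_eq_zero] at hs_sub
    exact one_ne_zero hs_sub
  obtain ⟨m₀, hm₀⟩ : ∃ m₀, m₀ ∉ (RingHom.ker χ • (⊤ : Submodule S M)).restrictScalars K := by
    by_contra! hall
    exact hne (eq_top_iff.mpr fun m _ => hall m)
  obtain ⟨φ, hφ, hker⟩ := Submodule.exists_le_ker_of_notMem hm₀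
  refine ⟨φ, fun h0 => hφ (by rw [h0]; rfl), fun s m => ?_⟩
  have hs : s - algebraMap K S (χ s) ∈ RingHom.ker χ := by
    rw [RingHom.mem_ker, map_sub, AlgHom.commutes, Algebra.algebraMap_self, RingHom.id_apply,
      sub_self]
  have hsub : φ ((s - algebraMap K S (χ s)) • m) = 0 :=
    LinearMap.mem_ker.mp (hker ((Submodule.restrictScalars_mem K _ _).mpr
      (Submodule.smul_mem_smul hs (Submodule.mem_top (x := m)))))
  rwa [sub_smul, map_sub, algebraMap_smul, map_smul φ (χ s), sub_eq_zero, smul_eq_mul] at hsub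

theorem finite_quotient_of_mem_radical [FiniteDimensional K E] {x : E →ₗ[K] S}
    (hx : Algebra.adjoin K (Set.range x) = ⊤) {I : Ideal S} (h : ∀ a, x a ∈ I.radical) :
    Module.Finite K (S ⧸ I) := by
  let B := Module.finBasis K E
  have hgen : Algebra.adjoin K (Ideal.Quotient.mkₐ K I '' Set.range (x ∘ B)) = ⊤ := by
    rw [← AlgHom.map_adjoin, adjoin_range_comp_basis, hx, Algebra.map_top]
    exact (AlgHom.range_eq_top _).mpr (Ideal.Quotient.mkₐ_surjective K I)
  refine ⟨?_⟩
  rw [← Algebra.top_toSubmodule, ← hgen]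
  refine fg_adjoin_of_finite ((Set.finite_range _).image _) ?_
  rintro _ ⟨_, ⟨i, rfl⟩, rfl⟩
  obtain ⟨n, hn⟩ := h (B i)
  refine IsIntegral.of_pow n.succ_pos ?_
  have hpow : Ideal.Quotient.mkₐ K I (x (B i)) ^ (n + 1) = 0 := by
    rw [← map_pow, Ideal.Quotient.mkₐ_eq_mk, Ideal.Quotient.eq_zero_iff_mem]
    exact I.pow_mem_of_pow_mem hn n.le_succ
  exact hpow ▸ isIntegral_zero

theorem finiteDimensional_of_mem_radical [FiniteDimensional K E] {x : E →ₗ[K] S}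
    (hx : Algebra.adjoin K (Set.range x) = ⊤)
    (h : ∀ a, x a ∈ (Module.annihilator S M).radical) : FiniteDimensional K M := by
  have := finite_quotient_of_mem_radical hx h
  let _ : Module (S ⧸ Module.annihilator S M) M := Module.quotientAnnihilator
  have : IsScalarTower K (S ⧸ Module.annihilator S M) M := ⟨fun t q m => by
    obtain ⟨s, rfl⟩ := Ideal.Quotient.mk_surjective q
    exact smul_assoc t s m⟩
  have : IsScalarTower S (S ⧸ Module.annihilator S M) M := ⟨fun t q m => by
    obtain ⟨s, rfl⟩ := Ideal.Quotient.mk_surjective q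
    exact smul_assoc t s m⟩
  have : Module.Finite (S ⧸ Module.annihilator S M) M :=
    Module.Finite.of_restrictScalars_finite S _ _
  exact Module.Finite.trans (S ⧸ Module.annihilator S M) M

variable [IsAlgClosed K] [FiniteDimensional K E]

theorem finiteDimensional_or_exists_eigenfunctional {x : E →ₗ[K] S}
    (hx : Algebra.adjoin K (Set.range x) = ⊤) :
    FiniteDimensional K M ∨ ∃ μ : Module.Dual K E, μ ≠ 0 ∧ ∃ φ : Module.Dual K M, φ ≠ 0 ∧
      ∀ a m, φ (x a • m) = μ a * φ m := by
  have := finiteType_of_adjoin_range hx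
  have : IsJacobsonRing S := isJacobsonRing_of_finiteType (A := K)
  by_cases h : ∀ a, x a ∈ (Module.annihilator S M).radical
  · exact Or.inl (finiteDimensional_of_mem_radical hx h)
  push Not at h
  obtain ⟨a₀, ha₀⟩ := h
  rw [Ideal.radical_eq_jacobson, Ideal.jacobson, Submodule.mem_sInf] at ha₀
  push Not at ha₀
  obtain ⟨I, ⟨hle, hI⟩, haI⟩ := ha₀
  obtain ⟨χ, rfl⟩ := exists_algHom_ker_eq (K := K) I
  obtain ⟨φ, hφ, hχφ⟩ := exists_eigenfunctional_of_algHom hle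
  exact Or.inr ⟨χ.toLinearMap ∘ₗ x, fun h0 => haI (LinearMap.congr_fun h0 a₀), φ, hφ,
    fun a m => hχφ (x a) m⟩

open scoped IsMulCommutative in
theorem finiteDimensional_or_exists_eigenfunctional_of_commute {A : Type*} [Ring A] [Algebra K A]
    {N : Type*} [AddCommGroup N] [Module K N] [Module A N] [IsScalarTower K A N]
    (x : E →ₗ[K] A) (hx : ∀ a a', x a * x a' = x a' * x a)
    (hfin : Module.Finite (Algebra.adjoin K (Set.range x)) N) :
    FiniteDimensional K N ∨ ∃ μ : Module.Dual K E, μ ≠ 0 ∧ ∃ φ : Module.Dual K N, φ ≠ 0 ∧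
      ∀ a m, φ (x a • m) = μ a * φ m := by
  have : IsMulCommutative (Algebra.adjoin K (Set.range x)) :=
    Algebra.isMulCommutative_adjoin K (by
      rintro _ ⟨a, rfl⟩ _ ⟨a', rfl⟩
      exact hx a a')
  let z : E →ₗ[K] Algebra.adjoin K (Set.range x) :=
    x.codRestrict (Subalgebra.toSubmodule (Algebra.adjoin K (Set.range x))) fun a =>
      Algebra.subset_adjoin ⟨a, rfl⟩
  have hz : Algebra.adjoin K (Set.range z) = ⊤ := by
    rw [show Set.range z = Subtype.val ⁻¹' Set.range x from Set.range_codRestrict _]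
    exact Algebra.adjoin_adjoin_coe_preimage
  exact finiteDimensional_or_exists_eigenfunctional (M := N) hz

end Support

/-! ### The decomposition of the aspherical set -/

section Decomposition

variable (ρ : Representation ℂ W V)

/-- The stabilizer of a vector of the representation `ρ`, the general parabolic subgroup. -/
def pointStabilizer (b : V) : Subgroup W where
  carrier := {g | ρ g b = b}
  mul_mem' {g h} hg hh := by
    rw [Set.mem_ofPred_eq, map_mul, Module.End.mul_apply, hh, hg]
  one_mem' := by rw [Set.mem_ofPred_eq, map_one, Module.End.one_apply]
  inv_mem' {g} hg := ρ.inv_apply_eq_iff.mpr (Eq.symm hg)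

theorem mem_pointStabilizer {b : V} {g : W} : g ∈ pointStabilizer ρ b ↔ ρ g b = b := Iff.rfl

theorem isParabolic_top : IsParabolic ρ ⊤ :=
  ⟨0, fun g => by rw [map_zero]; exact iff_of_true (Subgroup.mem_top g) rfl⟩

variable {ρ} in
theorem pointStabilizer_ne_top (hρ : ρ.invariants = ⊥) {b : V} (hb : b ≠ 0) :
    pointStabilizer ρ b ≠ ⊤ := by
  intro htop
  have hinv : b ∈ ρ.invariants := fun g => (htop ▸ Subgroup.mem_top g : g ∈ pointStabilizer ρ b)
  rw [hρ, Submodule.mem_bot] at hinv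
  exact hb hinv

variable {ρ} [Finite W] [FiniteDimensional ℂ V] {c : Parameter ρ}

theorem mem_asphericalSet_of_restrict {P : Subgroup W} (hP : IsParabolic ρ P)
    (h : Parameter.restrict P c ∈ asphericalSet (quotRep ρ P)) : c ∈ asphericalSet ρ :=
  mem_asphericalSet_iff_sphericalIdeal_ne_top.mpr (sphericalIdeal_ne_top_of_restrict hP
    (mem_asphericalSet_iff_sphericalIdeal_ne_top.mp h))

theorem restrict_top_mem_asphericalSet (hc : c ∈ asphericalSet ρ) :
    Parameter.restrict ⊤ c ∈ asphericalSet (quotRep ρ ⊤) :=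
  mem_asphericalSet_iff_sphericalIdeal_ne_top.mpr
    (sphericalIdeal_quotRep_top_ne_top (mem_asphericalSet_iff_sphericalIdeal_ne_top.mp hc))

theorem mem_fdaSet_or_exists_restrict_pointStabilizer (hc : c ∈ asphericalSet ρ) :
    c ∈ fdaSet ρ ∨ ∃ b ≠ 0, Parameter.restrict (pointStabilizer ρ b) c ∈
      asphericalSet (quotRep ρ (pointStabilizer ρ b)) := by
  have := Fintype.ofFinite W
  obtain ⟨M, _, _, ⟨hfin, -⟩, hM⟩ := hc
  let _ : Module ℂ M := Module.compHom M (algebraMap ℂ (H ρ c))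
  have : IsScalarTower ℂ (H ρ c) M := .of_algebraMap_smul fun _ _ => rfl
  rcases finiteDimensional_or_exists_eigenfunctional_of_commute (N := M) (universalRealization c).X
      (universalRealization c).X_comm hfin with hfd | ⟨μ, hμ, φ, hφ, hφμ⟩
  · exact Or.inl ⟨M, _, _, _, inferInstance, hfd, hM⟩
  have hr : ((universalRealization c).map (Algebra.lsmul ℂ ℂ M)).Aspherical :=
    (universalRealization_map_aspherical_iff _).mpr (LinearMap.ext hM.2)
  obtain ⟨b, rfl⟩ := (Module.evalEquiv ℂ V).surjective μ
  refine Or.inr ⟨b, fun hb => hμ (by rw [hb, map_zero]), ?_⟩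
  rw [mem_asphericalSet_iff_sphericalIdeal_ne_top]
  exact sphericalIdeal_quotRep_ne_top_of_eigenfunctional hr hφ hφμ
    fun _ => mem_pointStabilizer ρ

end Decomposition

end Cherednik

end

open Cherednik in
theorem mainTheorem4_general {W : Type u} [Group W] [Finite W]
    {V : Type v} [AddCommGroup V] [Module ℂ V] [FiniteDimensional ℂ V]
    (ρ : Representation ℂ W V) :
    (∀ c : Parameter ρ, c ∈ asphericalSet ρ ↔ sphericalIdeal ρ c ≠ ⊤) ∧
    (asphericalSet ρ = fdaSet ρ ∪
      ⋃ P ∈ {P : Subgroup W | IsParabolic ρ P},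
        Parameter.restrict P ⁻¹' asphericalSet (quotRep ρ P)) ∧
    (ρ.invariants = ⊥ → asphericalSet ρ = fdaSet ρ ∪
      ⋃ P ∈ {P : Subgroup W | IsParabolic ρ P ∧ P ≠ ⊤},
        Parameter.restrict P ⁻¹' asphericalSet (quotRep ρ P)) := by
  refine ⟨fun c => mem_asphericalSet_iff_sphericalIdeal_ne_top,
    Set.Subset.antisymm (fun c hc => Or.inr ?_) ?_,
    fun hρ => Set.Subset.antisymm (fun c hc => ?_) ?_⟩
  · exact Set.mem_iUnion₂.mpr ⟨⊤, isParabolic_top ρ, restrict_top_mem_asphericalSet hc⟩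
  · exact Set.union_subset fdaSet_subset_asphericalSet
      (Set.iUnion₂_subset fun P hP c hc => mem_asphericalSet_of_restrict hP hc)
  · refine (mem_fdaSet_or_exists_restrict_pointStabilizer hc).imp_right fun ⟨b, hb, hP⟩ => ?_
    exact Set.mem_iUnion₂.mpr
      ⟨pointStabilizer ρ b, ⟨⟨b, fun _ => Iff.rfl⟩, pointStabilizer_ne_top hρ hb⟩, hP⟩
  · exact Set.union_subset fdaSet_subset_asphericalSet
      (Set.iUnion₂_subset fun P hP c hc => mem_asphericalSet_of_restrict hP.1 hc)

open Cherednik in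
theorem mainTheorem4 {W : Type u} [Group W] [Finite W]
    {V : Type v} [AddCommGroup V] [Module ℂ V] [FiniteDimensional ℂ V]
    (ρ : Representation ℂ W V) (hρ : Function.Injective ρ) :
    (∀ c : Parameter ρ, c ∈ asphericalSet ρ ↔ sphericalIdeal ρ c ≠ ⊤) ∧
    (asphericalSet ρ = fdaSet ρ ∪
      ⋃ P ∈ {P : Subgroup W | IsParabolic ρ P},
        Parameter.restrict P ⁻¹' asphericalSet (quotRep ρ P)) ∧
    (ρ.invariants = ⊥ → asphericalSet ρ = fdaSet ρ ∪
      ⋃ P ∈ {P : Subgroup W | IsParabolic ρ P ∧ P ≠ ⊤},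
        Parameter.restrict P ⁻¹' asphericalSet (quotRep ρ P)) :=
  mainTheorem4_general ρ
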